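/- **Notation.** $[X]$ denotes the closed linear span. Let $\mu$ be a faithful KMS-state on a unital $C^*$-algebra $B$ with modular automorphism group $\sigma$, GNS-space $H_\mu$ and GNS-map $\Lambda_\mu$. Regard $B$ and $B^{op}$ as commuting $C^*$-algebras on $H_\mu=H_{\mu^{op}}$: $B$ acts by the GNS-representation, and $b^{op}\Lambda_\mu(x)=\Lambda_\mu(x\sigma_{-i/2}(b))$ for $b\in\mathrm{Dom}(\sigma_{-i/2})$, $x\in B$. Passing from $\mu$ to $\mu^{op}$ exchanges $B$ and $B^{op}$. A *$C^*$-$\mu$-module* $(H,\alpha)$ is a Hilbert space $H$ with a closed subspace $\alpha\subseteq L(H_\mu,H)$ such that $[\alpha H_\mu]=H$, $[\alpha B]=\alpha$, $[\alpha^*\alpha]=B$; it defines $\rho_\alpha\colon B^{op}\to L(H)$ by $\rho_\alpha(b^{op})\xi\zeta=\xi b^{op}\zeta$. A *$C^*$-$(\mu_1,\dots,\mu_n)$-module* $(H,\alpha_1,\dots,\alpha_n)$, where each $\mu_i\in\{\mu,\mu^{op}\}$, consists of $C^*$-$\mu_i$-modules $(H,\alpha_i)$ with $[\rho_{\alpha_i}(B_i^{op})\alpha_j]=\alpha_j$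 for $i\ne j$, where $B_i=B$ if $\mu_i=\mu$ and $B_i=B^{op}$ if $\mu_i=\mu^{op}$. Put $L(H_\alpha,L_\gamma)=\{T\in L(H,L): T\alpha\subseteq\gamma,\ T^*\gamma\subseteq\alpha\}$ and $L(H_\alpha)=L(H_\alpha,H_\alpha)$. For a $C^*$-$\mu$-module $(H,\beta)$ and a $C^*$-$\mu^{op}$-module $(L,\gamma)$, $H\,{}_\beta\!\otimes_\gamma L$ is the Hilbert space spanned by elements $\xi\otimes\zeta\otimes\eta$ ($\xi\in\beta,\zeta\in H_\mu,\eta\in\gamma$) with inner product $\langle\zeta|\xi^*\xi'\eta^*\eta'\zeta'\rangle$; $|\xi\rangle_1\colon\eta\zeta\mapsto\xi\otimes\zeta\otimes\eta$ and $|\eta\rangle_2\colon\xi\zeta\mapsto\xi\otimes\zeta\otimes\eta$ are operators $L\to H\,{}_\beta\!\otimes_\gamma L$ and $H\to H\,{}_\beta\!\otimes_\gamma L$ with adjoints $\langle\xi|_1$, $\langle\eta|_2$, and $|\beta\rangle_1=\{|\xi\rangle_1:\xi\in\beta\}$, etc. For further modules $\alpha$ on $H$ and $\delta$ on $L$ put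 $\alpha\triangleleft\gamma=[|\gamma\rangle_2\alpha]$ and $\beta\triangleright\delta=[|\beta\rangle_1\delta]$. A *$C^*$-pseudo-multiplicative unitary* $(H,\hat\beta,\alpha,\beta,V)$ over $\mu$ is a $C^*$-$(\mu^{op},\mu,\mu^{op})$-module $(H,\hat\beta,\alpha,\beta)$ with a unitary $V\colon H\,{}_{\hat\beta}\!\otimes_\alpha H\to H\,{}_\alpha\!\otimes_\beta H$ such that $V(\alpha\triangleleft\alpha)=\alpha\triangleright\alpha$, $V(\hat\beta\triangleright\beta)=\hat\beta\triangleleft\beta$, $V(\hat\beta\triangleright\hat\beta)=\alpha\triangleright\hat\beta$, $V(\beta\triangleleft\alpha)=\beta\triangleleft\beta$ and the pentagon equation $V_{23}V_{12}=V_{12}V_{13}V_{23}$ holds (with the evident identifications of iterated relative tensor products). Put $$\hat A(V)=[\langle\beta|_2V|\alpha\rangle_2],\quad A(V)=[\langle\alpha|_1V|\hat\beta\rangle_1]\subseteq L(H),$$ $$\hat\Delta_V(\hat a)=V^*(1\otimes\hat a)V,\quad \Delta_V(a)=V(a\otimes1)V^*.$$ $V$ is *regular* if $[\langle\alpha|_1V|\alpha\rangle_2]=[\alpha\alpha^*]$.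 Put $\mathrm{Fix}(V)=\{\eta\in\hat\beta\cap\alpha: V|\eta\rangle_1=|\eta\rangle_1\}$ and $\mathrm{Cofix}(V)=\{\xi\in\alpha\cap\beta: V|\xi\rangle_2=|\xi\rangle_2\}$. $V$ is *étale* if $\eta^*\eta=\mathrm{id}_{H_\mu}$ for some $\eta\in\mathrm{Fix}(V)$, and *compact* if $\xi^*\xi=\mathrm{id}_{H_\mu}$ for some $\xi\in\mathrm{Cofix}(V)$. A *$C^*$-$(\mu,\mu^{op})$-algebra* $A^{\alpha,\beta}_H$ is a $C^*$-$(\mu,\mu^{op})$-module $(H,\alpha,\beta)$ with a nondegenerate $C^*$-algebra $A\subseteq L(H)$ such that $\rho_\alpha(B^{op})A\subseteq A$ and $\rho_\beta(B)A\subseteq A$. A *morphism* to $C^{\gamma,\delta}_L$ is a $*$-homomorphism $\phi\colon A\to M(C)\subseteq L(L)$ with $[\phi(A)L]=L$ such that the sets of those $T$ in $L(H_\alpha,L_\gamma)$, respectively $L(H_\beta,L_\delta)$, with $Ta=\phi(a)T$ for all $a\in A$ satisfy $[I\alpha]=\gamma$, respectively $[I'\beta]=\delta$. The *fiber product* $A*A$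 is the set of all $x\in L(H\,{}_\alpha\!\otimes_\beta H)$ such that $x|\alpha\rangle_1,x^*|\alpha\rangle_1\subseteq[|\alpha\rangle_1A]$ and $x|\beta\rangle_2,x^*|\beta\rangle_2\subseteq[|\beta\rangle_2A]$. A *Hopf $C^*$-bimodule* over $\mu$ is such an $A^{\alpha,\beta}_H$ (with $A*A$ nondegenerate) together with a morphism $\Delta$ from $A^{\alpha,\beta}_H$ to $(A*A)^{\alpha\triangleright\alpha,\beta\triangleleft\beta}$ satisfying $(\Delta*\mathrm{Id})\Delta=(\mathrm{Id}*\Delta)\Delta$. $V$ is *well-behaved* if $(\hat A(V)^{\hat\beta,\alpha}_H,\hat\Delta_V)$ and $(A(V)^{\alpha,\beta}_H,\Delta_V)$ are Hopf $C^*$-bimodules over $\mu^{op}$ and $\mu$, respectively. Let $(A^{\alpha,\beta}_H,\Delta)$ be a Hopf $C^*$-bimodule over $\mu$. A *bounded left* (*right*) *counit* is a morphism $\epsilon$ from $A^{\alpha,\beta}_H$ to $L(H_\mu)^{B,B^{op}}_{H_\mu}$ with $\epsilon(\langle\eta|_2\Delta(a)|\eta'\rangle_2)=\eta^*a\eta'$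 for all $a\in A$, $\eta,\eta'\in\beta$ (respectively $\epsilon(\langle\xi|_1\Delta(a)|\xi'\rangle_1)=\xi^*a\xi'$ for all $a\in A$, $\xi,\xi'\in\alpha$); a *bounded counit* is both. A *bounded left Haar weight* is a non-zero completely positive contraction $\phi\colon A\to B$ with $\phi(\rho_\beta(b)a\rho_\beta(c))=b\phi(a)c$ and $\phi(\langle\xi|_1\Delta(a)|\xi'\rangle_1)=\xi^*\rho_\beta(\phi(a))\xi'$ for all $a\in A$, $b,c\in B$, $\xi,\xi'\in\alpha$. A *bounded right Haar weight* is a non-zero completely positive contraction $\psi\colon A\to B^{op}$ with $\psi(\rho_\alpha(b)a\rho_\alpha(c))=b\psi(a)c$ and $\psi(\langle\eta|_2\Delta(a)|\eta'\rangle_2)=\eta^*\rho_\alpha(\psi(a))\eta'$ for all $a\in A$, $b,c\in B^{op}$, $\eta,\eta'\in\beta$. Over $\mu^{op}$ the roles of $B$ and $B^{op}$ are exchanged. **Theorem.** Let $(H,\hat\beta,\alpha,\beta,V)$ be a well-behaved $C^*$-pseudo-multiplicative unitary over $\mu$. 1. Assume that $V$ is étale and that $\eta_0\in\mathrm{Fix}(V)$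 satisfies $\eta_0^*\eta_0=\mathrm{id}_{H_\mu}$. (a) $\hat\epsilon(\hat a):=\eta_0^*\hat a\eta_0$ defines a bounded left counit for $(\hat A(V)^{\hat\beta,\alpha}_H,\hat\Delta_V)$. For all $\eta\in\beta$, $\xi\in\alpha$ we have $\hat\epsilon(\langle\eta|_2V|\xi\rangle_2)=\eta^*\xi$. In particular, $\hat\epsilon$ does not depend on the choice of $\eta_0$, $\hat\epsilon(\hat A(V))=[\beta^*\alpha]$, and $[\beta^*\alpha]$ is a $C^*$-algebra. If $V$ is regular, then $\hat\epsilon$ is a bounded counit. (b) $\psi(a):=\eta_0^*a\eta_0$ defines a bounded right Haar weight for $(A(V)^{\alpha,\beta}_H,\Delta_V)$. 2. Assume that $V$ is compact and that $\xi_0\in\mathrm{Cofix}(V)$ satisfies $\xi_0^*\xi_0=\mathrm{id}_{H_\mu}$. (a) $\epsilon(a):=\xi_0^*a\xi_0$ defines a bounded right counit for $(A(V)^{\alpha,\beta}_H,\Delta_V)$. For all $\eta\in\alpha$, $\xi\in\hat\beta$ we have $\epsilon(\langle\eta|_1V|\xi\rangle_1)=\eta^*\xi$. In particular, $\epsilon$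 does not depend on the choice of $\xi_0$, $\epsilon(A(V))=[\alpha^*\hat\beta]$, and $[\alpha^*\hat\beta]$ is a $C^*$-algebra. If $V$ is regular, then $\epsilon$ is a bounded counit. (b) $\hat\phi(\hat a):=\xi_0^*\hat a\xi_0$ defines a bounded left Haar weight for $(\hat A(V)^{\hat\beta,\alpha}_H,\hat\Delta_V)$. -/

import Mathlib

open scoped InnerProductSpace InnerProduct ComplexOrder ComplexConjugate

noncomputable section

namespace CQG

/-- Closed linear span `[S]` of a subset of a normed space. -/
def cspan {E : Type*} [NormedAddCommGroup E] [NormedSpace ℂ E] (S : Set E) : Submodule ℂ E :=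
  (Submodule.span ℂ S).topologicalClosure

section Gram

variable {ι E F : Type*} [NormedAddCommGroup E] [InnerProductSpace ℂ E]
  [NormedAddCommGroup F] [InnerProductSpace ℂ F]

theorem denseRange_lc (u : ι → E) (h : cspan (Set.range u) = ⊤) :
    DenseRange (Finsupp.linearCombination ℂ u) := by
  have := Submodule.dense_iff_topologicalClosure_eq_top.mpr h
  rw [← Finsupp.range_linearCombination] at this
  exact this

theorem inner_lc (u : ι → E) (f g : ι →₀ ℂ) :
    ⟪Finsupp.linearCombination ℂ u f, Finsupp.linearCombination ℂ u g⟫_ℂ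
      = f.sum fun i a => g.sum fun j b => conj a * (b * ⟪u i, u j⟫_ℂ) := by
  rw [Finsupp.linearCombination_apply, Finsupp.linearCombination_apply, Finsupp.sum, Finsupp.sum,
    Finsupp.sum, sum_inner]
  refine Finset.sum_congr rfl fun i _ => ?_
  rw [inner_sum, Finsupp.sum]
  refine Finset.sum_congr rfl fun j _ => ?_
  rw [inner_smul_left, inner_smul_right]

/-- Bounded extension of `u i ↦ v i` from a total family. -/
theorem exists_extend [CompleteSpace F] (u : ι → E) (v : ι → F) (hu : cspan (Set.range u) = ⊤)
    (C : ℝ) (hC : 0 ≤ C)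
    (h : ∀ f : ι →₀ ℂ, 0 ≤ f.sum fun i a => f.sum fun j b =>
      conj a * (b * ((C : ℂ) ^ 2 * ⟪u i, u j⟫_ℂ - ⟪v i, v j⟫_ℂ))) :
    ∃ T : E →L[ℂ] F, ‖T‖ ≤ C ∧ ∀ i, T (u i) = v i := by
  have key : ∀ x, ‖Finsupp.linearCombination ℂ v x‖ ≤ C * ‖Finsupp.linearCombination ℂ u x‖ := by
    intro f
    have h1 := h f
    have h2 : (f.sum fun i a => f.sum fun j b =>
        conj a * (b * ((C : ℂ) ^ 2 * ⟪u i, u j⟫_ℂ - ⟪v i, v j⟫_ℂ)))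
        = (C : ℂ) ^ 2 * ⟪Finsupp.linearCombination ℂ u f, Finsupp.linearCombination ℂ u f⟫_ℂ
          - ⟪Finsupp.linearCombination ℂ v f, Finsupp.linearCombination ℂ v f⟫_ℂ := by
      rw [inner_lc, inner_lc]
      simp only [Finsupp.sum, Finset.mul_sum, ← Finset.sum_sub_distrib]
      refine Finset.sum_congr rfl fun i _ => Finset.sum_congr rfl fun j _ => ?_
      ring
    rw [h2, inner_self_eq_norm_sq_to_K, inner_self_eq_norm_sq_to_K] at h1
    have h3 : (0 : ℝ) ≤ C ^ 2 * ‖Finsupp.linearCombination ℂ u f‖ ^ 2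
        - ‖Finsupp.linearCombination ℂ v f‖ ^ 2 := by
      have : (0 : ℂ) ≤ ((C ^ 2 * ‖Finsupp.linearCombination ℂ u f‖ ^ 2
        - ‖Finsupp.linearCombination ℂ v f‖ ^ 2 : ℝ) : ℂ) := by
        push_cast; simpa using h1
      exact_mod_cast this
    rw [← mul_pow] at h3
    exact (sq_le_sq₀ (by positivity) (by positivity)).mp (by linarith)
  refine ⟨(Finsupp.linearCombination ℂ v).extendOfNorm (Finsupp.linearCombination ℂ u),
    LinearMap.opNorm_extendOfNorm_le (denseRange_lc u hu) hC key, fun i => ?_⟩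
  have := LinearMap.extendOfNorm_eq (denseRange_lc u hu) ⟨C, key⟩ (Finsupp.single i 1)
  simpa using this

theorem eq_of_total {u : ι → E} (hu : cspan (Set.range u) = ⊤) {S T : E →L[ℂ] F}
    (h : ∀ i, S (u i) = T (u i)) : S = T := by
  refine ContinuousLinearMap.ext_on (Submodule.dense_iff_topologicalClosure_eq_top.mpr hu) ?_
  rintro _ ⟨i, rfl⟩
  exact h i

/-- Two total families with the same Gram matrix are related by a unitary. -/
theorem exists_unitary [CompleteSpace E] [CompleteSpace F] (u : ι → E) (v : ι → F)
    (hu : cspan (Set.range u) = ⊤) (hv : cspan (Set.range v) = ⊤)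
    (h : ∀ i j, ⟪u i, u j⟫_ℂ = ⟪v i, v j⟫_ℂ) :
    ∃ T : E ≃ₗᵢ[ℂ] F, ∀ i, T (u i) = v i := by
  obtain ⟨T, -, hT⟩ := exists_extend u v hu 1 zero_le_one (fun f => by simp [h])
  obtain ⟨S, -, hS⟩ := exists_extend v u hv 1 zero_le_one (fun f => by simp [h])
  have hST : S ∘L T = ContinuousLinearMap.id ℂ E := eq_of_total hu (by simp [hT, hS])
  have hTS : T ∘L S = ContinuousLinearMap.id ℂ F := eq_of_total hv (by simp [hT, hS])
  have hadj : T† ∘L T = ContinuousLinearMap.id ℂ E := by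
    refine eq_of_total hu fun i => ?_
    refine ext_inner_left ℂ fun x => ?_
    have : ((innerSL ℂ) (u i)) ∘L (T† ∘L T) = (innerSL ℂ) (u i) := by
      refine eq_of_total hu fun j => ?_
      simp [ContinuousLinearMap.adjoint_inner_right, hT, h]
    have h2 := congrArg (fun A => conj (A x)) this
    simp only [ContinuousLinearMap.comp_apply, innerSL_apply_apply, inner_conj_symm] at h2
    simp only [ContinuousLinearMap.comp_apply, ContinuousLinearMap.adjoint_inner_right,
      ContinuousLinearMap.adjoint_inner_left, ContinuousLinearMap.id_apply] at h2 ⊢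
    exact h2
  have hnorm : ∀ x, ‖T x‖ = ‖x‖ := by
    intro x
    have := congrArg (fun A => ⟪x, A x⟫_ℂ) hadj
    simp only [ContinuousLinearMap.comp_apply, ContinuousLinearMap.adjoint_inner_right,
      ContinuousLinearMap.id_apply, inner_self_eq_norm_sq_to_K] at this
    have h3 : ‖T x‖ ^ 2 = ‖x‖ ^ 2 := by exact_mod_cast this
    exact (sq_eq_sq₀ (norm_nonneg _) (norm_nonneg _)).mp h3
  refine ⟨{ toLinearEquiv := LinearEquiv.ofLinearMap T.toLinearMap S.toLinearMap
              (by ext x; simpa using! congrArg (fun A => A x) hTS)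
              (by ext x; simpa using! congrArg (fun A => A x) hST)
            norm_map' := hnorm }, hT⟩

end Gram

section PSD

variable {ι K : Type*} [NormedAddCommGroup K] [InnerProductSpace ℂ K] [CompleteSpace K]

/-- Positivity of an operator-valued kernel. -/
def OpPSD (P : ι → ι → (K →L[ℂ] K)) : Prop :=
  ∀ (s : Finset ι) (x : ι → K), 0 ≤ ∑ i ∈ s, ∑ j ∈ s, ⟪x i, P i j (x j)⟫_ℂ

/-- The operator on the finite direct sum of copies of `K` given by a matrix of operators. -/
def matOp [Fintype ι] (P : ι → ι → (K →L[ℂ] K)) :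
    PiLp 2 (fun _ : ι => K) →L[ℂ] PiLp 2 (fun _ : ι => K) :=
  ((PiLp.continuousLinearEquiv 2 ℂ (fun _ : ι => K)).symm :
      (ι → K) →L[ℂ] PiLp 2 (fun _ : ι => K)) ∘L
    ContinuousLinearMap.pi (fun i => ∑ j, P i j ∘L PiLp.proj 2 (fun _ : ι => K) j)

theorem matOp_apply [Fintype ι] (P : ι → ι → (K →L[ℂ] K)) (x : PiLp 2 (fun _ : ι => K)) (i : ι) :
    (matOp P x) i = ∑ j, P i j (x j) := by
  simp [matOp]

theorem exists_sqrt {E : Type*} [NormedAddCommGroup E] [InnerProductSpace ℂ E] [CompleteSpace E]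
    (T : E →L[ℂ] E) (hT : 0 ≤ T) :
    ∃ C : E →L[ℂ] E, C * C = T ∧ star C = C ∧ ∀ D, T * D = D * T → C * D = D * C := by
  refine ⟨CFC.sqrt T, CFC.sqrt_mul_sqrt_self _ hT, (CFC.sqrt_nonneg T).isSelfAdjoint, ?_⟩
  intro D hD
  have h : Commute T D := hD
  have : Commute (CFC.sqrt T) D := by
    rw [CFC.sqrt_eq_cfc]
    exact h.cfc_nnreal _
  exact this

theorem OpPSD.mul_fintype [Fintype ι] [DecidableEq ι] {P Q : ι → ι → (K →L[ℂ] K)}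
    (hP : ∀ x : ι → K, 0 ≤ ∑ i, ∑ j, ⟪x i, P i j (x j)⟫_ℂ)
    (hQ : ∀ x : ι → K, 0 ≤ ∑ i, ∑ j, ⟪x i, Q i j (x j)⟫_ℂ)
    (hc : ∀ i j k l, P i j * Q k l = Q k l * P i j) (x : ι → K) :
    0 ≤ ∑ i, ∑ j, ⟪x i, (P i j * Q i j) (x j)⟫_ℂ := by
  have hin : ∀ y z : PiLp 2 (fun _ : ι => K),
      ⟪y, matOp P z⟫_ℂ = ∑ i, ∑ j, ⟪y i, P i j (z j)⟫_ℂ := by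
    intro y z
    simp [PiLp.inner_apply, matOp_apply, inner_sum]
  have hpos : 0 ≤ matOp P := by
    rw [ContinuousLinearMap.nonneg_iff_isPositive, ContinuousLinearMap.isPositive_iff_complex]
    intro y
    have h0 : 0 ≤ ⟪y, matOp P y⟫_ℂ := by rw [hin]; exact hP _
    rw [← inner_conj_symm]
    have h1 : conj ⟪y, matOp P y⟫_ℂ = ⟪y, matOp P y⟫_ℂ := by
      exact Complex.conj_eq_iff_im.mpr (Complex.nonneg_iff.mp h0).2.symm
    rw [h1]
    exact ⟨Complex.ext rfl (by simpa using (Complex.nonneg_iff.mp h0).2), (Complex.nonneg_iff.mp h0).1⟩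
  obtain ⟨C, hCC, hCsa, hCc⟩ := exists_sqrt (matOp P) hpos
  let e : ι → K → PiLp 2 (fun _ : ι => K) := fun j y => WithLp.toLp 2 (Pi.single j y)
  let D : (K →L[ℂ] K) → (PiLp 2 (fun _ : ι => K) →L[ℂ] PiLp 2 (fun _ : ι => K)) :=
    fun q => matOp (fun i j => if i = j then q else 0)
  have hD : ∀ q y i, (D q y) i = q (y i) := by
    intro q y i
    simp only [D, matOp_apply]
    rw [Finset.sum_eq_single i] <;> simp +contextual [eq_comm]
  have hDe : ∀ q j y, D q (e j y) = e j (q y) := by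
    intro q j y
    ext i
    rw [hD]
    by_cases hij : i = j
    · subst hij; simp [e]
    · simp [e, hij]
  have hcomm : ∀ k l, C * D (Q k l) = D (Q k l) * C := by
    intro k l
    refine hCc _ ?_
    ext y i
    change (matOp P (D (Q k l) y)) i = (D (Q k l) (matOp P y)) i
    rw [hD, matOp_apply, matOp_apply, map_sum]
    simp only [hD]
    refine Finset.sum_congr rfl fun j _ => ?_
    exact congrArg (fun A => A (y j)) (hc i j k l)
  have main : ∀ i j, ⟪x i, (P i j * Q i j) (x j)⟫_ℂ
      = ∑ k, ⟪(C (e i (x i))) k, Q i j ((C (e j (x j))) k)⟫_ℂ := by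
    intro i j
    have h1 : ⟪x i, (P i j * Q i j) (x j)⟫_ℂ = ⟪e i (x i), matOp P (e j (Q i j (x j)))⟫_ℂ := by
      rw [hin]
      rw [Finset.sum_eq_single i, Finset.sum_eq_single j]
      · simp [e]
      · intro b _ hb; simp [e, hb]
      · simp
      · intro b _ hb; simp [e, hb]
      · simp
    have h2 : ⟪e i (x i), matOp P (e j (Q i j (x j)))⟫_ℂ
        = ⟪C (e i (x i)), C (e j (Q i j (x j)))⟫_ℂ := by
      rw [← hCC]
      change ⟪e i (x i), C (C (e j (Q i j (x j))))⟫_ℂ = _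
      rw [← ContinuousLinearMap.adjoint_inner_left, ← ContinuousLinearMap.star_eq_adjoint, hCsa]
    have h3 : C (e j (Q i j (x j))) = D (Q i j) (C (e j (x j))) := by
      rw [← hDe]
      exact congrArg (fun A => A (e j (x j))) (hcomm i j)
    rw [h1, h2, h3, PiLp.inner_apply]
    simp only [hD]
  simp_rw [main]
  have : ∑ i, ∑ j, ∑ k, ⟪(C (e i (x i))) k, Q i j ((C (e j (x j))) k)⟫_ℂ
      = ∑ k, ∑ i, ∑ j, ⟪(C (e i (x i))) k, Q i j ((C (e j (x j))) k)⟫_ℂ := by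
    simp_rw [fun i => Finset.sum_comm (s := (Finset.univ : Finset ι)) (t := (Finset.univ : Finset ι))
      (f := fun j k => ⟪(C (e i (x i))) k, Q i j ((C (e j (x j))) k)⟫_ℂ)]
    rw [Finset.sum_comm]
  rw [this]
  exact Finset.sum_nonneg fun k _ => hQ fun i => (C (e i (x i))) k

theorem OpPSD.mul {P Q : ι → ι → (K →L[ℂ] K)} (hP : OpPSD P) (hQ : OpPSD Q)
    (hc : ∀ i j k l, P i j * Q k l = Q k l * P i j) : OpPSD (fun i j => P i j * Q i j) := by
  classical
  intro s x
  have red : ∀ R : ι → ι → (K →L[ℂ] K), ∀ y : ι → K,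
      ∑ i ∈ s, ∑ j ∈ s, ⟪y i, R i j (y j)⟫_ℂ
        = ∑ i : s, ∑ j : s, ⟪y i, R i j (y j)⟫_ℂ := by
    intro R y
    rw [← Finset.sum_coe_sort s]
    refine Finset.sum_congr rfl fun i _ => ?_
    rw [← Finset.sum_coe_sort s]
  have ext : ∀ y : s → K, ∃ y' : ι → K, ∀ i : s, y' i = y i := fun y =>
    ⟨fun i => if h : i ∈ s then y ⟨i, h⟩ else 0, fun i => by simp⟩
  rw [red]
  refine OpPSD.mul_fintype (P := fun i j : s => P i j) (Q := fun i j : s => Q i j) ?_ ?_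
    (fun _ _ _ _ => hc _ _ _ _) (fun i => x i)
  · intro y
    obtain ⟨y', hy⟩ := ext y
    have := hP s y'
    rw [red] at this
    simpa only [hy] using this
  · intro y
    obtain ⟨y', hy⟩ := ext y
    have := hQ s y'
    rw [red] at this
    simpa only [hy] using this

end PSD

section Kernel

/-- A positive semidefinite Hermitian kernel on an index set. -/
structure PSDKernel (ι : Type*) where
  k : ι → ι → ℂ
  herm : ∀ i j, conj (k j i) = k i j
  nonneg : ∀ f : ι →₀ ℂ, 0 ≤ f.sum fun i a => f.sum fun j b => conj a * (b * k i j)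

variable {ι : Type*}

/-- Formal finite linear combinations of the index set of a kernel. -/
def PSDKernel.Pre (_κ : PSDKernel ι) : Type _ := ι →₀ ℂ

instance (κ : PSDKernel ι) : AddCommGroup κ.Pre := inferInstanceAs (AddCommGroup (ι →₀ ℂ))
instance (κ : PSDKernel ι) : Module ℂ κ.Pre := inferInstanceAs (Module ℂ (ι →₀ ℂ))

/-- The semi-inner product with `⟪i, j⟫ = k i j`. -/
def PSDKernel.ip (κ : PSDKernel ι) (f g : ι →₀ ℂ) : ℂ :=
  f.sum fun i a => g.sum fun j b => conj a * (b * κ.k i j)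

theorem PSDKernel.ip_add (κ : PSDKernel ι) (f g h : ι →₀ ℂ) :
    κ.ip (f + g) h = κ.ip f h + κ.ip g h := by
  refine Finsupp.sum_add_index' (fun i => by simp [Finsupp.sum]) (fun i a b => ?_)
  simp only [Finsupp.sum, map_add, add_mul, Finset.sum_add_distrib]

theorem PSDKernel.ip_smul (κ : PSDKernel ι) (r : ℂ) (f g : ι →₀ ℂ) :
    κ.ip (r • f) g = conj r * κ.ip f g := by
  rw [PSDKernel.ip, Finsupp.sum_smul_index' (fun i => by simp [Finsupp.sum])]
  simp only [PSDKernel.ip, Finsupp.sum, Finset.mul_sum, smul_eq_mul, map_mul, mul_assoc]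

abbrev PSDKernel.core (κ : PSDKernel ι) : PreInnerProductSpace.Core ℂ κ.Pre where
  inner f g := κ.ip f g
  conj_inner_symm f g := by
    simp only [PSDKernel.ip, Finsupp.sum, map_sum, map_mul, κ.herm, Complex.conj_conj]
    rw [Finset.sum_comm]
    refine Finset.sum_congr rfl fun i _ => Finset.sum_congr rfl fun j _ => ?_
    ring
  re_inner_nonneg f := (Complex.nonneg_iff.mp (κ.nonneg f)).1
  add_left f g h := κ.ip_add f g h
  smul_left f g r := κ.ip_smul r f g

instance (κ : PSDKernel ι) : SeminormedAddCommGroup κ.Pre :=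
  InnerProductSpace.Core.toSeminormedAddCommGroup (c := κ.core)
instance (κ : PSDKernel ι) : InnerProductSpace ℂ κ.Pre :=
  InnerProductSpace.ofCore κ.core

/-- The Hilbert space spanned by vectors `κ.vec i` with `⟪κ.vec i, κ.vec j⟫ = κ.k i j`
(separation and completion of the formal linear combinations). -/
def PSDKernel.Space (κ : PSDKernel ι) : Type _ := UniformSpace.Completion κ.Pre

instance (κ : PSDKernel ι) : NormedAddCommGroup κ.Space :=
  inferInstanceAs (NormedAddCommGroup (UniformSpace.Completion κ.Pre))
instance (κ : PSDKernel ι) : InnerProductSpace ℂ κ.Space :=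
  inferInstanceAs (InnerProductSpace ℂ (UniformSpace.Completion κ.Pre))
instance (κ : PSDKernel ι) : CompleteSpace κ.Space :=
  inferInstanceAs (CompleteSpace (UniformSpace.Completion κ.Pre))

/-- The canonical map from formal linear combinations. -/
def PSDKernel.ofFinsupp (κ : PSDKernel ι) : (ι →₀ ℂ) →ₗ[ℂ] κ.Space :=
  (UniformSpace.Completion.toComplL (𝕜 := ℂ) (E := κ.Pre)).toLinearMap

theorem PSDKernel.inner_ofFinsupp (κ : PSDKernel ι) (f g : ι →₀ ℂ) :
    ⟪κ.ofFinsupp f, κ.ofFinsupp g⟫_ℂ = κ.ip f g :=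
  UniformSpace.Completion.inner_coe (𝕜 := ℂ) (E := κ.Pre) f g

def PSDKernel.vec (κ : PSDKernel ι) (i : ι) : κ.Space := κ.ofFinsupp (Finsupp.single i 1)

theorem PSDKernel.inner_vec (κ : PSDKernel ι) (i j : ι) :
    ⟪κ.vec i, κ.vec j⟫_ℂ = κ.k i j := by
  rw [vec, vec, inner_ofFinsupp]
  simp [PSDKernel.ip]

theorem PSDKernel.vec_total (κ : PSDKernel ι) : cspan (Set.range κ.vec) = ⊤ := by
  refine Submodule.dense_iff_topologicalClosure_eq_top.mp ?_
  have hd : DenseRange ((↑) : κ.Pre → UniformSpace.Completion κ.Pre) :=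
    UniformSpace.Completion.denseRange_coe
  refine Dense.mono ?_ hd
  rintro _ ⟨f, rfl⟩
  change κ.ofFinsupp f ∈ Submodule.span ℂ (Set.range κ.vec)
  induction f using Finsupp.induction_linear with
  | zero => rw [map_zero]; exact Submodule.zero_mem _
  | add f g hf hg => rw [map_add]; exact Submodule.add_mem _ hf hg
  | single i a =>
    rw [← mul_one a, ← smul_eq_mul, ← Finsupp.smul_single, map_smul]
    exact Submodule.smul_mem _ _ (Submodule.subset_span ⟨i, rfl⟩)

end Kernel

section Span

variable {E F : Type*} [NormedAddCommGroup E] [NormedSpace ℂ E]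
  [NormedAddCommGroup F] [NormedSpace ℂ F]

theorem subset_cspan (S : Set E) : S ⊆ cspan S :=
  fun _ hx => Submodule.le_topologicalClosure _ (Submodule.subset_span hx)

theorem isClosed_cspan (S : Set E) : IsClosed (cspan S : Set E) :=
  Submodule.isClosed_topologicalClosure _

theorem cspan_le {S : Set E} {N : Submodule ℂ E} (hN : IsClosed (N : Set E)) (h : S ⊆ N) :
    cspan S ≤ N :=
  Submodule.topologicalClosure_minimal _ (Submodule.span_le.mpr h) hN

theorem cspan_mono {S T : Set E} (h : S ⊆ T) : cspan S ≤ cspan T :=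
  cspan_le (isClosed_cspan T) (h.trans (subset_cspan T))

/-- A continuous linear map sending `S` into a closed subspace sends `[S]` there. -/
theorem cspan_map_mem {S : Set E} {N : Submodule ℂ F} (hN : IsClosed (N : Set F))
    (f : E →L[ℂ] F) (h : ∀ x ∈ S, f x ∈ N) {x : E} (hx : x ∈ cspan S) : f x ∈ N := by
  have : cspan S ≤ N.comap f.toLinearMap := cspan_le (hN.preimage f.continuous) h
  exact this hx

end Span

section Operators

variable {E F G : Type*} [NormedAddCommGroup E] [InnerProductSpace ℂ E] [CompleteSpace E]
  [NormedAddCommGroup F] [InnerProductSpace ℂ F] [CompleteSpace F]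
  [NormedAddCommGroup G] [InnerProductSpace ℂ G] [CompleteSpace G]

/-- `[X Y]`, the closed linear span of the products `x y`, `x ∈ X`, `y ∈ Y`. -/
def opMul (X : Set (F →L[ℂ] G)) (Y : Set (E →L[ℂ] F)) : Submodule ℂ (E →L[ℂ] G) :=
  cspan {T | ∃ x ∈ X, ∃ y ∈ Y, T = x ∘L y}

/-- `[X E]`, the closed linear span of the vectors `x e`, `x ∈ X`, `e ∈ E`. -/
def opApp (X : Set (E →L[ℂ] F)) : Submodule ℂ F := cspan {v | ∃ x ∈ X, ∃ e : E, v = x e}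

/-- `X*`, the set of adjoints. -/
def opAdj (X : Set (E →L[ℂ] F)) : Set (F →L[ℂ] E) := {T | ∃ x ∈ X, T = x†}

end Operators

variable {K : Type*} [NormedAddCommGroup K] [InnerProductSpace ℂ K] [CompleteSpace K]

/-- A (unital) C*-base: two commuting C*-algebras of operators on a Hilbert space `K`, both
containing the identity. -/
structure CStarBase (K : Type*) [NormedAddCommGroup K] [InnerProductSpace ℂ K]
    [CompleteSpace K] where
  B : StarSubalgebra ℂ (K →L[ℂ] K)
  Bop : StarSubalgebra ℂ (K →L[ℂ] K)
  isClosed_B : IsClosed (B : Set (K →L[ℂ] K))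
  isClosed_Bop : IsClosed (Bop : Set (K →L[ℂ] K))
  comm : ∀ b ∈ B, ∀ c ∈ Bop, b * c = c * b

/-- The opposite C*-base, with the two algebras exchanged. -/
@[reducible] def CStarBase.op (𝔟 : CStarBase K) : CStarBase K where
  B := 𝔟.Bop
  Bop := 𝔟.B
  isClosed_B := 𝔟.isClosed_Bop
  isClosed_Bop := 𝔟.isClosed_B
  comm b hb c hc := (𝔟.comm c hc b hb).symm

variable {H L M : Type*} [NormedAddCommGroup H] [InnerProductSpace ℂ H] [CompleteSpace H]
  [NormedAddCommGroup L] [InnerProductSpace ℂ L] [CompleteSpace L]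
  [NormedAddCommGroup M] [InnerProductSpace ℂ M] [CompleteSpace M]

/-- A C*-module structure over the C*-base `𝔟` on `H`: a closed subspace `α ⊆ L(K, H)` with
`[α K] = H`, `[α B] = α`, `[α* α] = B`. -/
structure CMod (𝔟 : CStarBase K) (H : Type*) [NormedAddCommGroup H] [InnerProductSpace ℂ H]
    [CompleteSpace H] where
  carrier : Submodule ℂ (K →L[ℂ] H)
  isClosed : IsClosed (carrier : Set (K →L[ℂ] H))
  total : opApp (carrier : Set (K →L[ℂ] H)) = ⊤
  mul : opMul (carrier : Set (K →L[ℂ] H)) (𝔟.B : Set (K →L[ℂ] K)) = carrier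
  adj : (opMul (opAdj (carrier : Set (K →L[ℂ] H))) (carrier : Set (K →L[ℂ] H)) :
    Set (K →L[ℂ] K)) = 𝔟.B

variable {𝔟 𝔠 : CStarBase K}

namespace CMod

instance : Membership (K →L[ℂ] H) (CMod 𝔟 H) := ⟨fun α ξ => ξ ∈ α.carrier⟩

theorem gram_mem (α : CMod 𝔟 H) {ξ ξ' : K →L[ℂ] H} (h : ξ ∈ α.carrier) (h' : ξ' ∈ α.carrier) :
    ξ† ∘L ξ' ∈ 𝔟.B := by
  have : ξ† ∘L ξ' ∈ (opMul (opAdj (α.carrier : Set (K →L[ℂ] H))) (α.carrier : Set (K →L[ℂ] H)) :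
    Set (K →L[ℂ] K)) := subset_cspan _ ⟨_, ⟨ξ, h, rfl⟩, _, h', rfl⟩
  rw [α.adj] at this
  exact this

theorem mul_mem (α : CMod 𝔟 H) {ξ : K →L[ℂ] H} (h : ξ ∈ α.carrier) {b : K →L[ℂ] K}
    (hb : b ∈ 𝔟.B) : ξ ∘L b ∈ α.carrier := by
  rw [← α.mul]
  exact subset_cspan _ ⟨ξ, h, b, hb, rfl⟩

/-- The total family `ξ ζ`. -/
def app (α : CMod 𝔟 H) (p : α.carrier × K) : H := (p.1 : K →L[ℂ] H) p.2

theorem app_total (α : CMod 𝔟 H) : cspan (Set.range α.app) = ⊤ := by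
  rw [← α.total, opApp]
  congr 1
  ext v
  constructor
  · rintro ⟨⟨ξ, ζ⟩, rfl⟩; exact ⟨ξ, ξ.2, ζ, rfl⟩
  · rintro ⟨ξ, hξ, ζ, rfl⟩; exact ⟨⟨⟨ξ, hξ⟩, ζ⟩, rfl⟩

end CMod

theorem opPSD_gram {ι : Type*} (ξ : ι → (K →L[ℂ] H)) : OpPSD fun i j => (ξ i)† ∘L ξ j := by
  intro s x
  have : ∑ i ∈ s, ∑ j ∈ s, ⟪x i, ((ξ i)† ∘L ξ j) (x j)⟫_ℂ
      = ⟪∑ i ∈ s, ξ i (x i), ∑ i ∈ s, ξ i (x i)⟫_ℂ := by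
    simp only [ContinuousLinearMap.comp_apply, ContinuousLinearMap.adjoint_inner_right]
    rw [sum_inner]
    simp only [inner_sum]
  rw [this, inner_self_eq_norm_sq_to_K]
  have : (0 : ℂ) ≤ ((‖∑ i ∈ s, ξ i (x i)‖ ^ 2 : ℝ) : ℂ) := by
    exact_mod_cast sq_nonneg ‖∑ i ∈ s, ξ i (x i)‖
  push_cast at this
  exact this

theorem opPSD_defect {ι : Type*} (ξ : ι → (K →L[ℂ] H)) (T : H →L[ℂ] L) :
    OpPSD fun i j => ((‖T‖ : ℂ) ^ 2) • ((ξ i)† ∘L ξ j) - (T ∘L ξ i)† ∘L (T ∘L ξ j) := by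
  intro s x
  have : ∑ i ∈ s, ∑ j ∈ s, ⟪x i, (((‖T‖ : ℂ) ^ 2) • ((ξ i)† ∘L ξ j)
        - (T ∘L ξ i)† ∘L (T ∘L ξ j)) (x j)⟫_ℂ
      = ((‖T‖ : ℂ) ^ 2) * ⟪∑ i ∈ s, ξ i (x i), ∑ i ∈ s, ξ i (x i)⟫_ℂ
        - ⟪T (∑ i ∈ s, ξ i (x i)), T (∑ i ∈ s, ξ i (x i))⟫_ℂ := by
    simp only [ContinuousLinearMap.comp_apply, ContinuousLinearMap.adjoint_inner_right,
      _root_.sub_apply, _root_.smul_apply, inner_sub_right,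
      inner_smul_right, Finset.sum_sub_distrib, map_sum]
    rw [sum_inner, sum_inner]
    simp only [inner_sum, Finset.mul_sum]
  rw [this, inner_self_eq_norm_sq_to_K, inner_self_eq_norm_sq_to_K]
  set y := ∑ i ∈ s, ξ i (x i)
  have h : ‖T y‖ ^ 2 ≤ ‖T‖ ^ 2 * ‖y‖ ^ 2 := by
    rw [← mul_pow]
    gcongr
    exact T.le_opNorm y
  have : (0 : ℂ) ≤ ((‖T‖ ^ 2 * ‖y‖ ^ 2 - ‖T y‖ ^ 2 : ℝ) : ℂ) := by
    exact_mod_cast sub_nonneg.mpr h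
  push_cast at this
  simpa using this

/-- Pass from operator-valued positivity to scalar positivity. -/
theorem OpPSD.finsupp {ι : Type*} {P : ι → ι → (K →L[ℂ] K)} (hP : OpPSD P) (z : ι → K)
    (f : ι →₀ ℂ) :
    0 ≤ f.sum fun i a => f.sum fun j b => conj a * (b * ⟪z i, P i j (z j)⟫_ℂ) := by
  refine (hP f.support fun i => f i • z i).trans_eq ?_
  refine Finset.sum_congr rfl fun i _ => Finset.sum_congr rfl fun j _ => ?_
  rw [inner_smul_left, map_smul, inner_smul_right]


theorem exists_extend_of_opPSD {ι E F : Type*} [NormedAddCommGroup E] [InnerProductSpace ℂ E]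
    [NormedAddCommGroup F] [InnerProductSpace ℂ F] [CompleteSpace F] (u : ι → E) (v : ι → F)
    (hu : cspan (Set.range u) = ⊤) (C : ℝ) (hC : 0 ≤ C) (z : ι → K) (R : ι → ι → (K →L[ℂ] K))
    (hR : OpPSD R)
    (h : ∀ i j, (C : ℂ) ^ 2 * ⟪u i, u j⟫_ℂ - ⟪v i, v j⟫_ℂ = ⟪z i, R i j (z j)⟫_ℂ) :
    ∃ T : E →L[ℂ] F, ‖T‖ ≤ C ∧ ∀ i, T (u i) = v i := by
  refine exists_extend u v hu C hC fun f => ?_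
  simp only [h]
  exact hR.finsupp z f

theorem opPSD_norm {ι : Type*} (T : K →L[ℂ] L) :
    OpPSD fun _ _ : ι => ((‖T‖ : ℂ) ^ 2) • (1 : K →L[ℂ] K) - (T†) ∘L T := by
  have := opPSD_defect (ι := ι) (fun _ => (1 : K →L[ℂ] K)) T
  have h1 : ((1 : K →L[ℂ] K)†) ∘L (1 : K →L[ℂ] K) = 1 := by
    rw [ContinuousLinearMap.adjoint_one]; rfl
  simp only [h1] at this
  exact this

theorem eq_of_inner_total {ι E : Type*} [NormedAddCommGroup E] [InnerProductSpace ℂ E]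
    {u : ι → E} (hu : cspan (Set.range u) = ⊤) {A B : E →L[ℂ] E}
    (h : ∀ p q, ⟪u p, A (u q)⟫_ℂ = ⟪u p, B (u q)⟫_ℂ) : A = B := by
  refine eq_of_total hu fun q => ?_
  refine ext_inner_left ℂ fun x => ?_
  have h1 : (innerSL ℂ (A (u q))) = innerSL ℂ (B (u q)) := by
    refine eq_of_total hu fun p => ?_
    have := congrArg conj (h p q)
    simpa only [innerSL_apply_apply, inner_conj_symm] using this
  have := congrArg (fun f => conj (f x)) h1
  simpa only [innerSL_apply_apply, inner_conj_symm] using this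

theorem inner_norm_defect (T : K →L[ℂ] L) (x y : K) :
    ⟪x, (((‖T‖ : ℂ) ^ 2) • (1 : K →L[ℂ] K) - (T†) ∘L T) y⟫_ℂ
      = (‖T‖ : ℂ) ^ 2 * ⟪x, y⟫_ℂ - ⟪T x, T y⟫_ℂ := by
  change ⟪x, ((‖T‖ : ℂ) ^ 2) • y - (T†) (T y)⟫_ℂ = _
  rw [inner_sub_right, inner_smul_right, ContinuousLinearMap.adjoint_inner_right]

namespace CMod

theorem gram_comm (β : CMod 𝔟 H) (γ : CMod 𝔟.op L) (ξ ξ' : β.carrier) (η η' : γ.carrier) :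
    ((ξ : K →L[ℂ] H)† ∘L (ξ' : K →L[ℂ] H)) * ((η : K →L[ℂ] L)† ∘L (η' : K →L[ℂ] L))
      = ((η : K →L[ℂ] L)† ∘L (η' : K →L[ℂ] L)) * ((ξ : K →L[ℂ] H)† ∘L (ξ' : K →L[ℂ] H)) :=
  𝔟.comm _ (β.gram_mem ξ.2 ξ'.2) _ (γ.gram_mem η.2 η'.2)

theorem exists_rho (α : CMod 𝔟 H) (d : 𝔟.Bop) :
    ∃ T : H →L[ℂ] H, ‖T‖ ≤ ‖(d : K →L[ℂ] K)‖ ∧ ∀ p : α.carrier × K,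
      T (α.app p) = (p.1 : K →L[ℂ] H) ((d : K →L[ℂ] K) p.2) := by
  have hP := opPSD_norm (ι := α.carrier × K) (d : K →L[ℂ] K)
  have hQ := opPSD_gram (ι := α.carrier × K) (fun p => (p.1 : K →L[ℂ] H))
  refine exists_extend_of_opPSD α.app _ α.app_total ‖(d : K →L[ℂ] K)‖ (norm_nonneg _)
    (fun p => p.2) _ (hP.mul hQ ?_) ?_
  · intro i j k l
    refine (𝔟.comm _ (α.gram_mem k.1.2 l.1.2) _ ?_).symm
    exact sub_mem (𝔟.Bop.smul_mem 𝔟.Bop.one_mem _) (MulMemClass.mul_mem (star_mem d.2) d.2)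
  · intro p q
    have hc : (((p.1 : K →L[ℂ] H))†) ((q.1 : K →L[ℂ] H) ((d : K →L[ℂ] K) q.2))
        = (d : K →L[ℂ] K) ((((p.1 : K →L[ℂ] H))†) ((q.1 : K →L[ℂ] H) q.2)) :=
      congrArg (fun A => A q.2) (𝔟.comm _ (α.gram_mem p.1.2 q.1.2) _ d.2)
    change _ = ⟪p.2, (((‖(d : K →L[ℂ] K)‖ : ℂ) ^ 2) • (1 : K →L[ℂ] K) - ((d : K →L[ℂ] K)†) ∘L (d : K →L[ℂ] K))
      ((((p.1 : K →L[ℂ] H))†) ((q.1 : K →L[ℂ] H) q.2))⟫_ℂ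
    rw [inner_norm_defect, ← hc, ContinuousLinearMap.adjoint_inner_right,
      ContinuousLinearMap.adjoint_inner_right]
    rfl

/-- The representation `ρ_α` of the opposite algebra on `H`: `ρ_α(d) ξ ζ = ξ d ζ`. -/
def rho (α : CMod 𝔟 H) (d : 𝔟.Bop) : H →L[ℂ] H := (α.exists_rho d).choose

theorem rho_apply (α : CMod 𝔟 H) (d : 𝔟.Bop) {ξ : K →L[ℂ] H} (hξ : ξ ∈ α.carrier) (ζ : K) :
    α.rho d (ξ ζ) = ξ ((d : K →L[ℂ] K) ζ) :=
  (α.exists_rho d).choose_spec.2 (⟨ξ, hξ⟩, ζ)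

theorem norm_rho_le (α : CMod 𝔟 H) (d : 𝔟.Bop) : ‖α.rho d‖ ≤ ‖(d : K →L[ℂ] K)‖ :=
  (α.exists_rho d).choose_spec.1

/-- `α` and `α'` are compatible one way: `[ρ_α(Bᵒᵖ) α'] = α'`. -/
def Stable (α : CMod 𝔟 H) (α' : CMod 𝔠 H) : Prop :=
  opMul (Set.range α.rho) (α'.carrier : Set (K →L[ℂ] H)) = α'.carrier

theorem Stable.mem {α : CMod 𝔟 H} {α' : CMod 𝔠 H} (h : α.Stable α') (d : 𝔟.Bop)
    {ξ : K →L[ℂ] H} (hξ : ξ ∈ α'.carrier) : α.rho d ∘L ξ ∈ α'.carrier := by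
  rw [← h]
  exact subset_cspan _ ⟨_, ⟨d, rfl⟩, ξ, hξ, rfl⟩

/-- `L(H_α, L_β)`: operators `T` with `T α ⊆ β` and `T* β ⊆ α`. -/
def IsModMap (α : CMod 𝔟 H) (β : CMod 𝔟 L) (T : H →L[ℂ] L) : Prop :=
  (∀ ξ ∈ α.carrier, T ∘L ξ ∈ β.carrier) ∧ ∀ η ∈ β.carrier, T† ∘L η ∈ α.carrier

theorem isModMap_one (α : CMod 𝔟 H) : α.IsModMap α 1 :=
  ⟨fun _ h => h, fun η h => by rw [ContinuousLinearMap.adjoint_one]; exact h⟩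

end CMod

/-- The kernel `⟨ξ ⊗ ζ ⊗ η | ξ' ⊗ ζ' ⊗ η'⟩ = ⟨ζ | ξ*ξ' η*η' ζ'⟩` of the relative tensor product. -/
def rtKernel (β : CMod 𝔟 H) (γ : CMod 𝔟.op L) : PSDKernel (β.carrier × K × γ.carrier) where
  k p q := ⟪p.2.1, ((p.1 : K →L[ℂ] H)† ∘L (q.1 : K →L[ℂ] H))
    (((p.2.2 : K →L[ℂ] L)† ∘L (q.2.2 : K →L[ℂ] L)) q.2.1)⟫_ℂ
  herm p q := by
    have hc : (((p.2.2 : K →L[ℂ] L))†) ((q.2.2 : K →L[ℂ] L)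
          ((((p.1 : K →L[ℂ] H))†) ((q.1 : K →L[ℂ] H) q.2.1)))
        = (((p.1 : K →L[ℂ] H))†) ((q.1 : K →L[ℂ] H)
          ((((p.2.2 : K →L[ℂ] L))†) ((q.2.2 : K →L[ℂ] L) q.2.1))) :=
      congrArg (fun A => A q.2.1) (CMod.gram_comm β γ p.1 q.1 p.2.2 q.2.2).symm
    simp only [ContinuousLinearMap.comp_apply, inner_conj_symm]
    rw [← hc]
    rw [ContinuousLinearMap.adjoint_inner_right, ← ContinuousLinearMap.adjoint_inner_left,
      ContinuousLinearMap.adjoint_inner_left, ContinuousLinearMap.adjoint_inner_right]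
  nonneg f := by
    have := (opPSD_gram (ι := β.carrier × K × γ.carrier) (fun p => (p.1 : K →L[ℂ] H))).mul
      (opPSD_gram (ι := β.carrier × K × γ.carrier) (fun p => (p.2.2 : K →L[ℂ] L)))
      (fun i j k l => CMod.gram_comm β γ i.1 j.1 k.2.2 l.2.2)
    exact this.finsupp (fun p => p.2.1) f

/-- The relative tensor product `H _β⊗_γ L` over the C*-base `𝔟`. -/
def RT (β : CMod 𝔟 H) (γ : CMod 𝔟.op L) : Type _ := (rtKernel β γ).Space

instance (β : CMod 𝔟 H) (γ : CMod 𝔟.op L) : NormedAddCommGroup (RT β γ) :=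
  inferInstanceAs (NormedAddCommGroup (rtKernel β γ).Space)
instance (β : CMod 𝔟 H) (γ : CMod 𝔟.op L) : InnerProductSpace ℂ (RT β γ) :=
  inferInstanceAs (InnerProductSpace ℂ (rtKernel β γ).Space)
instance (β : CMod 𝔟 H) (γ : CMod 𝔟.op L) : CompleteSpace (RT β γ) :=
  inferInstanceAs (CompleteSpace (rtKernel β γ).Space)

namespace RT

variable (β : CMod 𝔟 H) (γ : CMod 𝔟.op L)

/-- The elementary tensor `ξ ⊗ ζ ⊗ η`. -/
def tmul (ξ : β.carrier) (ζ : K) (η : γ.carrier) : RT β γ := (rtKernel β γ).vec (ξ, ζ, η)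

def tfam (p : β.carrier × K × γ.carrier) : RT β γ := tmul β γ p.1 p.2.1 p.2.2

theorem tfam_total : cspan (Set.range (tfam β γ)) = ⊤ := (rtKernel β γ).vec_total

variable {β γ}

theorem inner_tmul (ξ ξ' : β.carrier) (ζ ζ' : K) (η η' : γ.carrier) :
    ⟪tmul β γ ξ ζ η, tmul β γ ξ' ζ' η'⟫_ℂ
      = ⟪ζ, (((ξ : K →L[ℂ] H))†) ((ξ' : K →L[ℂ] H)
          ((((η : K →L[ℂ] L))†) ((η' : K →L[ℂ] L) ζ')))⟫_ℂ :=
  (rtKernel β γ).inner_vec _ _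

theorem inner_tmul' (ξ ξ' : β.carrier) (ζ ζ' : K) (η η' : γ.carrier) :
    ⟪tmul β γ ξ ζ η, tmul β γ ξ' ζ' η'⟫_ℂ
      = ⟪ζ, (((η : K →L[ℂ] L))†) ((η' : K →L[ℂ] L)
          ((((ξ : K →L[ℂ] H))†) ((ξ' : K →L[ℂ] H) ζ')))⟫_ℂ := by
  rw [inner_tmul]
  exact congrArg (fun A => ⟪ζ, A ζ'⟫_ℂ) (CMod.gram_comm β γ ξ ξ' η η')

theorem exists_ket1 (ξ : β.carrier) :
    ∃ T : L →L[ℂ] RT β γ, ‖T‖ ≤ ‖(ξ : K →L[ℂ] H)‖ ∧ ∀ p : γ.carrier × K, T (γ.app p) = tmul β γ ξ p.2 p.1 := by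
  have hP := opPSD_norm (ι := γ.carrier × K) (ξ : K →L[ℂ] H)
  have hQ := opPSD_gram (ι := γ.carrier × K) (fun p => (p.1 : K →L[ℂ] L))
  refine exists_extend_of_opPSD γ.app _ γ.app_total ‖(ξ : K →L[ℂ] H)‖ (norm_nonneg _)
    (fun p => p.2) _ (hP.mul hQ ?_) ?_
  · intro i j k l
    refine 𝔟.comm _ ?_ _ (γ.gram_mem k.1.2 l.1.2)
    exact sub_mem (𝔟.B.smul_mem 𝔟.B.one_mem _) (β.gram_mem ξ.2 ξ.2)
  · intro p q
    change _ = ⟪p.2, (((‖(ξ : K →L[ℂ] H)‖ : ℂ) ^ 2) • (1 : K →L[ℂ] K)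
      - ((ξ : K →L[ℂ] H)†) ∘L (ξ : K →L[ℂ] H)) ((((p.1 : K →L[ℂ] L))†) ((q.1 : K →L[ℂ] L) q.2))⟫_ℂ
    rw [inner_norm_defect, inner_tmul, ContinuousLinearMap.adjoint_inner_right,
      ContinuousLinearMap.adjoint_inner_right]
    rfl

theorem exists_ket2 (η : γ.carrier) :
    ∃ T : H →L[ℂ] RT β γ, ‖T‖ ≤ ‖(η : K →L[ℂ] L)‖ ∧ ∀ p : β.carrier × K, T (β.app p) = tmul β γ p.1 p.2 η := by
  have hP := opPSD_norm (ι := β.carrier × K) (η : K →L[ℂ] L)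
  have hQ := opPSD_gram (ι := β.carrier × K) (fun p => (p.1 : K →L[ℂ] H))
  refine exists_extend_of_opPSD β.app _ β.app_total ‖(η : K →L[ℂ] L)‖ (norm_nonneg _)
    (fun p => p.2) _ (hP.mul hQ ?_) ?_
  · intro i j k l
    refine (𝔟.comm _ (β.gram_mem k.1.2 l.1.2) _ ?_).symm
    exact sub_mem (𝔟.Bop.smul_mem 𝔟.Bop.one_mem _) (γ.gram_mem η.2 η.2)
  · intro p q
    change _ = ⟪p.2, (((‖(η : K →L[ℂ] L)‖ : ℂ) ^ 2) • (1 : K →L[ℂ] K)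
      - ((η : K →L[ℂ] L)†) ∘L (η : K →L[ℂ] L)) ((((p.1 : K →L[ℂ] H))†) ((q.1 : K →L[ℂ] H) q.2))⟫_ℂ
    rw [inner_norm_defect, inner_tmul', ContinuousLinearMap.adjoint_inner_right,
      ContinuousLinearMap.adjoint_inner_right]
    rfl

variable (β γ)

/-- The operator `|ξ⟩₁ : L → H _β⊗_γ L`, `|ξ⟩₁ η ζ = ξ ⊗ ζ ⊗ η`. -/
def ket1 (ξ : β.carrier) : L →L[ℂ] RT β γ := (exists_ket1 ξ).choose

/-- The operator `|η⟩₂ : H → H _β⊗_γ L`, `|η⟩₂ ξ ζ = ξ ⊗ ζ ⊗ η`. -/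
def ket2 (η : γ.carrier) : H →L[ℂ] RT β γ := (exists_ket2 η).choose

variable {β γ}

theorem ket1_apply (ξ : β.carrier) (η : γ.carrier) (ζ : K) :
    ket1 β γ ξ ((η : K →L[ℂ] L) ζ) = tmul β γ ξ ζ η := (exists_ket1 ξ).choose_spec.2 (η, ζ)

theorem ket2_apply (ξ : β.carrier) (η : γ.carrier) (ζ : K) :
    ket2 β γ η ((ξ : K →L[ℂ] H) ζ) = tmul β γ ξ ζ η := (exists_ket2 η).choose_spec.2 (ξ, ζ)

theorem bra1_ket1 (ξ ξ' : β.carrier) :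
    (ket1 β γ ξ)† ∘L ket1 β γ ξ'
      = γ.rho ⟨(ξ : K →L[ℂ] H)† ∘L (ξ' : K →L[ℂ] H), β.gram_mem ξ.2 ξ'.2⟩ := by
  refine eq_of_inner_total γ.app_total ?_
  intro p q
  rw [ContinuousLinearMap.comp_apply, ContinuousLinearMap.adjoint_inner_right]
  simp only [CMod.app, ket1_apply, CMod.rho_apply _ _ q.1.2]
  rw [inner_tmul']
  simp only [ContinuousLinearMap.adjoint_inner_right, ContinuousLinearMap.comp_apply]

theorem bra2_ket2 (η η' : γ.carrier) :
    (ket2 β γ η)† ∘L ket2 β γ η'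
      = β.rho ⟨(η : K →L[ℂ] L)† ∘L (η' : K →L[ℂ] L), γ.gram_mem η.2 η'.2⟩ := by
  refine eq_of_inner_total β.app_total ?_
  intro p q
  rw [ContinuousLinearMap.comp_apply, ContinuousLinearMap.adjoint_inner_right]
  simp only [CMod.app, ket2_apply, CMod.rho_apply _ _ q.1.2]
  rw [inner_tmul]
  simp only [ContinuousLinearMap.adjoint_inner_right, ContinuousLinearMap.comp_apply]

end RT

variable {𝔡 : CStarBase K}

/-- Closed subspaces given as `[X]` are stable once the generators are. -/
theorem comp_mem_cspan {E F G : Type*} [NormedAddCommGroup E] [InnerProductSpace ℂ E]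
    [NormedAddCommGroup F] [InnerProductSpace ℂ F] [NormedAddCommGroup G] [InnerProductSpace ℂ G]
    {S : Set (E →L[ℂ] F)} {N : Submodule ℂ (E →L[ℂ] G)} (hN : IsClosed (N : Set (E →L[ℂ] G)))
    (T : F →L[ℂ] G) (h : ∀ x ∈ S, T ∘L x ∈ N) {x : E →L[ℂ] F} (hx : x ∈ cspan S) : T ∘L x ∈ N :=
  cspan_map_mem hN (ContinuousLinearMap.compL ℂ E F G T) h hx

theorem cspan_comp_mem {E F G : Type*} [NormedAddCommGroup E] [InnerProductSpace ℂ E]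
    [NormedAddCommGroup F] [InnerProductSpace ℂ F] [NormedAddCommGroup G] [InnerProductSpace ℂ G]
    {S : Set (F →L[ℂ] G)} {N : Submodule ℂ (E →L[ℂ] G)} (hN : IsClosed (N : Set (E →L[ℂ] G)))
    (T : E →L[ℂ] F) (h : ∀ x ∈ S, x ∘L T ∈ N) {x : F →L[ℂ] G} (hx : x ∈ cspan S) : x ∘L T ∈ N :=
  cspan_map_mem hN ((ContinuousLinearMap.compL ℂ E F G).flip T) h hx

theorem adj_mem_cspan {E F : Type*} [NormedAddCommGroup E] [InnerProductSpace ℂ E]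
    [CompleteSpace E] [NormedAddCommGroup F] [InnerProductSpace ℂ F] [CompleteSpace F]
    {S : Set (E →L[ℂ] F)} {N : Submodule ℂ (F →L[ℂ] E)} (hN : IsClosed (N : Set (F →L[ℂ] E)))
    (h : ∀ x ∈ S, x† ∈ N) {x : E →L[ℂ] F} (hx : x ∈ cspan S) : x† ∈ N := by
  have hc : Continuous fun y : E →L[ℂ] F => y† := ContinuousLinearMap.adjoint.continuous
  have h1 : (Submodule.span ℂ S : Set (E →L[ℂ] F)) ⊆ (fun y => y†) ⁻¹' (N : Set (F →L[ℂ] E)) := by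
    intro y hy
    induction hy using Submodule.span_induction with
    | mem y hy => exact h y hy
    | zero => simp
    | add y z _ _ hy hz =>
      change (y + z)† ∈ N
      rw [map_add]; exact N.add_mem hy hz
    | smul c y _ hy =>
      change (c • y)† ∈ N
      rw [map_smulₛₗ]; exact N.smul_mem _ hy
  exact closure_minimal h1 (hN.preimage hc) hx

/-- A continuous linear map sends a spanning set to a spanning set of the image of the span. -/
theorem map_mem_cspan {E F : Type*} [NormedAddCommGroup E] [NormedSpace ℂ E]
    [NormedAddCommGroup F] [NormedSpace ℂ F] {S : Set E} (hS : cspan S = ⊤) {N : Submodule ℂ F}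
    (hN : IsClosed (N : Set F)) (T : E →L[ℂ] F) (h : ∀ x ∈ S, T x ∈ N) (x : E) : T x ∈ N :=
  cspan_map_mem hN T h (hS ▸ Submodule.mem_top : x ∈ cspan S)

namespace CMod

theorem rho_add (α : CMod 𝔟 H) (d e : 𝔟.Bop) : α.rho (d + e) = α.rho d + α.rho e := by
  refine eq_of_total α.app_total fun p => ?_
  simp only [app, _root_.add_apply, rho_apply _ _ p.1.2]
  change (p.1 : K →L[ℂ] H) ((d : K →L[ℂ] K) p.2 + (e : K →L[ℂ] K) p.2) = _
  rw [map_add]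

theorem rho_smul (α : CMod 𝔟 H) (c : ℂ) (d : 𝔟.Bop) : α.rho (c • d) = c • α.rho d := by
  refine eq_of_total α.app_total fun p => ?_
  simp only [app, _root_.smul_apply, rho_apply _ _ p.1.2]
  change (p.1 : K →L[ℂ] H) (c • (d : K →L[ℂ] K) p.2) = _
  rw [map_smul]

theorem rho_one (α : CMod 𝔟 H) : α.rho 1 = 1 := by
  refine eq_of_total α.app_total fun p => ?_
  simp only [app, rho_apply _ _ p.1.2]
  rfl

/-- `ρ_α` as a continuous linear map. -/
def rhoL (α : CMod 𝔟 H) : 𝔟.Bop →L[ℂ] (H →L[ℂ] H) :=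
  LinearMap.mkContinuous { toFun := α.rho, map_add' := α.rho_add, map_smul' := α.rho_smul } 1
    (fun d => by simpa using α.norm_rho_le d)

/-- If `S` spans `Bᵒᵖ`, then all `ρ_α(d)` lie in a closed subspace as soon as those with `d ∈ S`
do, after composing with a continuous linear map. -/
theorem rho_mem_of_span (α : CMod 𝔟 H) {F : Type*} [NormedAddCommGroup F] [NormedSpace ℂ F]
    {S : Set (K →L[ℂ] K)} (hS : (cspan S : Set (K →L[ℂ] K)) = 𝔟.Bop) {N : Submodule ℂ F}
    (hN : IsClosed (N : Set F)) (f : (H →L[ℂ] H) →L[ℂ] F)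
    (h : ∀ d : 𝔟.Bop, (d : K →L[ℂ] K) ∈ S → f (α.rho d) ∈ N) (d : 𝔟.Bop) : f (α.rho d) ∈ N := by
  have hSB : ∀ x ∈ S, x ∈ 𝔟.Bop := fun x hx => by
    have : x ∈ (cspan S : Set (K →L[ℂ] K)) := subset_cspan S hx
    rw [hS] at this; exact this
  have hsp : ∀ x ∈ Submodule.span ℂ S, ∃ hx : x ∈ 𝔟.Bop, f (α.rho ⟨x, hx⟩) ∈ N := by
    intro x hx
    induction hx using Submodule.span_induction with
    | mem y hy => exact ⟨hSB y hy, h ⟨y, hSB y hy⟩ hy⟩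
    | zero =>
      refine ⟨𝔟.Bop.zero_mem, ?_⟩
      have : α.rho ⟨0, 𝔟.Bop.zero_mem⟩ = 0 := by
        have := α.rhoL.map_zero
        exact this
      rw [this, map_zero]; exact N.zero_mem
    | add y z _ _ hy hz =>
      obtain ⟨hy, hy'⟩ := hy
      obtain ⟨hz, hz'⟩ := hz
      refine ⟨𝔟.Bop.add_mem hy hz, ?_⟩
      have : α.rho ⟨y + z, 𝔟.Bop.add_mem hy hz⟩ = α.rho ⟨y, hy⟩ + α.rho ⟨z, hz⟩ :=
        α.rho_add ⟨y, hy⟩ ⟨z, hz⟩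
      rw [this, map_add]; exact N.add_mem hy' hz'
    | smul c y _ hy =>
      obtain ⟨hy, hy'⟩ := hy
      refine ⟨𝔟.Bop.smul_mem hy c, ?_⟩
      have : α.rho ⟨c • y, 𝔟.Bop.smul_mem hy c⟩ = c • α.rho ⟨y, hy⟩ := α.rho_smul c ⟨y, hy⟩
      rw [this, map_smul]; exact N.smul_mem _ hy'
  have hd : (d : K →L[ℂ] K) ∈ closure (Submodule.span ℂ S : Set (K →L[ℂ] K)) := by
    have : (d : K →L[ℂ] K) ∈ (cspan S : Set (K →L[ℂ] K)) := by rw [hS]; exact d.2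
    exact this
  have hd' : d ∈ closure {e : 𝔟.Bop | f (α.rho e) ∈ N} := by
    rw [Metric.mem_closure_iff] at hd ⊢
    intro ε hε
    obtain ⟨x, hx, hdx⟩ := hd ε hε
    obtain ⟨hx', hx''⟩ := hsp x hx
    exact ⟨⟨x, hx'⟩, hx'', hdx⟩
  have hcl : IsClosed {e : 𝔟.Bop | f (α.rho e) ∈ N} :=
    hN.preimage (f.continuous.comp α.rhoL.continuous)
  rw [hcl.closure_eq] at hd'
  exact hd'

/-- If `ρ_γ` leaves the module `δ` invariant, then `ρ_γ` and `ρ_δ` commute. -/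
theorem rho_comm (γ : CMod 𝔟 H) (δ : CMod 𝔠 H) (h : γ.Stable δ) (b : 𝔟.Bop) (d : 𝔠.Bop) :
    γ.rho b ∘L δ.rho d = δ.rho d ∘L γ.rho b := by
  refine eq_of_total δ.app_total fun p => ?_
  have h1 : γ.rho b ((p.1 : K →L[ℂ] H) p.2) = (γ.rho b ∘L (p.1 : K →L[ℂ] H)) p.2 := rfl
  simp only [app, ContinuousLinearMap.comp_apply, rho_apply _ _ p.1.2]
  rw [h1, rho_apply _ _ (h.mem b p.1.2)]
  rfl

end CMod

namespace RT

variable (β : CMod 𝔟 H) (γ : CMod 𝔟.op L)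

theorem ket1_ket2_total_aux {N : Submodule ℂ (RT β γ)} (hN : IsClosed (N : Set (RT β γ)))
    (h : ∀ ξ ζ η, tmul β γ ξ ζ η ∈ N) : N = ⊤ := by
  rw [eq_top_iff, ← tfam_total β γ]
  refine cspan_le hN ?_
  rintro _ ⟨p, rfl⟩
  exact h _ _ _

/-- Generators of `α ◁ γ`. -/
def ltriSet (α : CMod 𝔠 H) : Set (K →L[ℂ] RT β γ) :=
  {T | ∃ η : γ.carrier, ∃ ξ ∈ α.carrier, T = ket2 β γ η ∘L ξ}

/-- Generators of `β ▷ δ`. -/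
def rtriSet (δ : CMod 𝔠 L) : Set (K →L[ℂ] RT β γ) :=
  {T | ∃ ξ : β.carrier, ∃ η ∈ δ.carrier, T = ket1 β γ ξ ∘L η}

end RT

/-- The common part of the construction of the two modules on a relative tensor product. -/
theorem exists_cmod {E : Type*} [NormedAddCommGroup E] [InnerProductSpace ℂ E] [CompleteSpace E]
    {ι : Type*} (α : CMod 𝔠 H) (β : CMod 𝔟 H) (h : β.Stable α) (k : ι → (H →L[ℂ] E))
    (g : ι → ι → 𝔟.Bop)
    (hg : (cspan {x : K →L[ℂ] K | ∃ i j, x = g i j} : Set (K →L[ℂ] K)) = 𝔟.Bop)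
    (hk : ∀ i j, (k i)† ∘L k j = β.rho (g i j))
    (htot : ∀ N : Submodule ℂ E, IsClosed (N : Set E) → (∀ i x, k i x ∈ N) → N = ⊤) :
    ∃ γ : CMod 𝔠 E, γ.carrier = cspan {T | ∃ i, ∃ ξ ∈ α.carrier, T = k i ∘L ξ} := by
  set S : Set (K →L[ℂ] E) := {T | ∃ i, ∃ ξ ∈ α.carrier, T = k i ∘L ξ}
  refine ⟨⟨cspan S, isClosed_cspan S, ?_, ?_, ?_⟩, rfl⟩
  · refine htot _ (isClosed_cspan _) fun i x => ?_
    refine map_mem_cspan α.app_total (isClosed_cspan _) (k i) ?_ x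
    rintro _ ⟨p, rfl⟩
    exact subset_cspan _ ⟨k i ∘L p.1, subset_cspan _ ⟨i, p.1, p.1.2, rfl⟩, p.2, rfl⟩
  · refine le_antisymm ?_ ?_
    · refine cspan_le (isClosed_cspan _) ?_
      rintro _ ⟨x, hx, b, hb, rfl⟩
      refine cspan_comp_mem (isClosed_cspan _) b ?_ hx
      rintro _ ⟨i, ξ, hξ, rfl⟩
      exact subset_cspan _ ⟨i, ξ ∘L b, α.mul_mem hξ hb, rfl⟩
    · intro x hx
      exact subset_cspan _ ⟨x, hx, 1, 𝔠.B.one_mem, rfl⟩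
  · refine Set.Subset.antisymm ?_ ?_
    · have hBc : IsClosed (𝔠.B.toSubalgebra.toSubmodule : Set (K →L[ℂ] K)) := 𝔠.isClosed_B
      have : opMul (opAdj (cspan S : Set (K →L[ℂ] E))) (cspan S : Set (K →L[ℂ] E))
          ≤ 𝔠.B.toSubalgebra.toSubmodule := by
        refine cspan_le hBc ?_
        rintro _ ⟨_, ⟨x, hx, rfl⟩, y, hy, rfl⟩
        refine comp_mem_cspan hBc _ ?_ hy
        rintro _ ⟨j, ξ', hξ', rfl⟩
        have : ((k j ∘L ξ')† ∘L x) ∈ 𝔠.B.toSubalgebra.toSubmodule := by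
          refine comp_mem_cspan hBc _ ?_ hx
          rintro _ ⟨i, ξ, hξ, rfl⟩
          have : (k j ∘L ξ')† ∘L (k i ∘L ξ) = ξ'† ∘L (β.rho (g j i) ∘L ξ) := by
            rw [ContinuousLinearMap.adjoint_comp, ← hk]; rfl
          rw [this]
          exact α.gram_mem hξ' (h.mem _ hξ)
        have h2 : star ((k j ∘L ξ')† ∘L x) ∈ 𝔠.B := star_mem (s := 𝔠.B) this
        rw [ContinuousLinearMap.star_eq_adjoint, ContinuousLinearMap.adjoint_comp,
          ContinuousLinearMap.adjoint_adjoint] at h2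
        exact h2
      exact this
    · rw [← α.adj]
      refine cspan_le (isClosed_cspan _) ?_
      rintro _ ⟨_, ⟨ξ, hξ, rfl⟩, ξ', hξ', rfl⟩
      have key := β.rho_mem_of_span hg
        (N := opMul (opAdj (cspan S : Set (K →L[ℂ] E))) (cspan S : Set (K →L[ℂ] E)))
        (isClosed_cspan _)
        ((ContinuousLinearMap.compL ℂ K H K (ξ†)) ∘L
          ((ContinuousLinearMap.compL ℂ K H H).flip ξ')) ?_ 1
      · rw [β.rho_one] at key
        exact key
      · rintro d ⟨i, j, hd⟩
        have hd' : d = g i j := Subtype.ext hd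
        refine subset_cspan _ ⟨(k i ∘L ξ)†, ⟨_, subset_cspan _ ⟨i, ξ, hξ, rfl⟩, rfl⟩,
          k j ∘L ξ', subset_cspan _ ⟨j, ξ', hξ', rfl⟩, ?_⟩
        rw [hd', ContinuousLinearMap.adjoint_comp]
        change ξ† ∘L (β.rho (g i j) ∘L ξ') = _
        rw [← hk]; rfl

namespace CMod

theorem adj_gen (α : CMod 𝔟 H) :
    (cspan {x : K →L[ℂ] K | ∃ ξ ξ' : α.carrier,
      x = (ξ : K →L[ℂ] H)† ∘L (ξ' : K →L[ℂ] H)} : Set (K →L[ℂ] K)) = 𝔟.B := by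
  rw [← α.adj, opMul]
  congr 2
  ext x
  constructor
  · rintro ⟨ξ, ξ', rfl⟩; exact ⟨_, ⟨ξ, ξ.2, rfl⟩, ξ', ξ'.2, rfl⟩
  · rintro ⟨_, ⟨ξ, h, rfl⟩, ξ', h', rfl⟩; exact ⟨⟨ξ, h⟩, ⟨ξ', h'⟩, rfl⟩

end CMod

namespace RT

variable (β : CMod 𝔟 H) (γ : CMod 𝔟.op L)

theorem exists_ltri (α : CMod 𝔠 H) (h : β.Stable α) :
    ∃ δ : CMod 𝔠 (RT β γ), δ.carrier = cspan (ltriSet β γ α) :=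
  exists_cmod α β h (ket2 β γ)
    (fun η η' => ⟨(η : K →L[ℂ] L)† ∘L (η' : K →L[ℂ] L), γ.gram_mem η.2 η'.2⟩)
    γ.adj_gen (fun η η' => bra2_ket2 η η')
    fun _ hN hN' => ket1_ket2_total_aux β γ hN fun ξ ζ η => by
      rw [← ket2_apply]; exact hN' _ _

theorem exists_rtri (δ : CMod 𝔠 L) (h : γ.Stable δ) :
    ∃ ε : CMod 𝔠 (RT β γ), ε.carrier = cspan (rtriSet β γ δ) :=
  exists_cmod δ γ h (ket1 β γ)
    (fun η η' => ⟨(η : K →L[ℂ] H)† ∘L (η' : K →L[ℂ] H), β.gram_mem η.2 η'.2⟩)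
    β.adj_gen (fun η η' => bra1_ket1 η η')
    fun _ hN hN' => ket1_ket2_total_aux β γ hN fun ξ ζ η => by
      rw [← ket1_apply]; exact hN' _ _

/-- The module `α ◁ γ = [|γ⟩₂ α]` on `H _β⊗_γ L`. -/
def ltri (α : CMod 𝔠 H) (h : β.Stable α) : CMod 𝔠 (RT β γ) where
  carrier := cspan (ltriSet β γ α)
  isClosed := isClosed_cspan _
  total := by obtain ⟨δ, hδ⟩ := exists_ltri β γ α h; rw [← hδ]; exact δ.total
  mul := by obtain ⟨δ, hδ⟩ := exists_ltri β γ α h; rw [← hδ]; exact δ.mul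
  adj := by obtain ⟨δ, hδ⟩ := exists_ltri β γ α h; rw [← hδ]; exact δ.adj

/-- The module `β ▷ δ = [|β⟩₁ δ]` on `H _β⊗_γ L`. -/
def rtri (δ : CMod 𝔠 L) (h : γ.Stable δ) : CMod 𝔠 (RT β γ) where
  carrier := cspan (rtriSet β γ δ)
  isClosed := isClosed_cspan _
  total := by obtain ⟨ε, hε⟩ := exists_rtri β γ δ h; rw [← hε]; exact ε.total
  mul := by obtain ⟨ε, hε⟩ := exists_rtri β γ δ h; rw [← hε]; exact ε.mul
  adj := by obtain ⟨ε, hε⟩ := exists_rtri β γ δ h; rw [← hε]; exact ε.adj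

theorem rho_ltri (α : CMod 𝔠 H) (h : β.Stable α) (d : 𝔠.Bop) (η : γ.carrier) (x : H) :
    (ltri β γ α h).rho d (ket2 β γ η x) = ket2 β γ η (α.rho d x) := by
  have : (ltri β γ α h).rho d ∘L ket2 β γ η = ket2 β γ η ∘L α.rho d := by
    refine eq_of_total α.app_total fun p => ?_
    have hm : ket2 β γ η ∘L (p.1 : K →L[ℂ] H) ∈ (ltri β γ α h).carrier :=
      subset_cspan _ ⟨η, p.1, p.1.2, rfl⟩
    simp only [CMod.app, ContinuousLinearMap.comp_apply, CMod.rho_apply _ _ p.1.2]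
    exact CMod.rho_apply _ d hm p.2
  exact congrArg (fun A => A x) this

theorem rho_rtri (δ : CMod 𝔠 L) (h : γ.Stable δ) (d : 𝔠.Bop) (ξ : β.carrier) (x : L) :
    (rtri β γ δ h).rho d (ket1 β γ ξ x) = ket1 β γ ξ (δ.rho d x) := by
  have : (rtri β γ δ h).rho d ∘L ket1 β γ ξ = ket1 β γ ξ ∘L δ.rho d := by
    refine eq_of_total δ.app_total fun p => ?_
    have hm : ket1 β γ ξ ∘L (p.1 : K →L[ℂ] L) ∈ (rtri β γ δ h).carrier :=
      subset_cspan _ ⟨ξ, p.1, p.1.2, rfl⟩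
    simp only [CMod.app, ContinuousLinearMap.comp_apply, CMod.rho_apply _ _ p.1.2]
    exact CMod.rho_apply _ d hm p.2
  exact congrArg (fun A => A x) this

variable {β γ}

theorem inner_ket1 (ξ ξ' : β.carrier) (x y : L) :
    ⟪ket1 β γ ξ x, ket1 β γ ξ' y⟫_ℂ
      = ⟪x, γ.rho ⟨(ξ : K →L[ℂ] H)† ∘L (ξ' : K →L[ℂ] H), β.gram_mem ξ.2 ξ'.2⟩ y⟫_ℂ := by
  rw [← bra1_ket1, ContinuousLinearMap.comp_apply, ContinuousLinearMap.adjoint_inner_right]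

theorem inner_ket2 (η η' : γ.carrier) (x y : H) :
    ⟪ket2 β γ η x, ket2 β γ η' y⟫_ℂ
      = ⟪x, β.rho ⟨(η : K →L[ℂ] L)† ∘L (η' : K →L[ℂ] L), γ.gram_mem η.2 η'.2⟩ y⟫_ℂ := by
  rw [← bra2_ket2, ContinuousLinearMap.comp_apply, ContinuousLinearMap.adjoint_inner_right]

theorem ket1_total {N : Submodule ℂ (RT β γ)} (hN : IsClosed (N : Set (RT β γ)))
    {S : Set L} (hS : cspan S = ⊤) (h : ∀ ξ, ∀ x ∈ S, ket1 β γ ξ x ∈ N) : N = ⊤ :=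
  ket1_ket2_total_aux β γ hN fun ξ ζ η => by
    rw [← ket1_apply]; exact map_mem_cspan hS hN _ (h ξ) _

theorem ket2_total {N : Submodule ℂ (RT β γ)} (hN : IsClosed (N : Set (RT β γ)))
    {S : Set H} (hS : cspan S = ⊤) (h : ∀ η, ∀ x ∈ S, ket2 β γ η x ∈ N) : N = ⊤ :=
  ket1_ket2_total_aux β γ hN fun ξ ζ η => by
    rw [← ket2_apply]; exact map_mem_cspan hS hN _ (h η) _

section Flip

theorem exists_flip (β : CMod 𝔟 H) (γ : CMod 𝔟.op L) :
    ∃ T : RT β γ ≃ₗᵢ[ℂ] RT γ β, ∀ p : β.carrier × K × γ.carrier,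
      T (tfam β γ p) = tmul γ β p.2.2 p.2.1 p.1 := by
  refine exists_unitary _ (fun p => tmul γ β p.2.2 p.2.1 p.1) (tfam_total β γ) ?_ ?_
  · rw [eq_top_iff, ← tfam_total γ β]
    refine cspan_mono ?_
    rintro _ ⟨⟨η, ζ, ξ⟩, rfl⟩
    exact ⟨(ξ, ζ, η), rfl⟩
  · intro p q
    exact (inner_tmul p.1 q.1 p.2.1 q.2.1 p.2.2 q.2.2).trans
      (inner_tmul' (β := γ) (γ := β) p.2.2 q.2.2 p.2.1 q.2.1 p.1 q.1).symm

/-- The flip `Σ : H _β⊗_γ L → L _γ⊗_β H`, `ξ ⊗ ζ ⊗ η ↦ η ⊗ ζ ⊗ ξ`. -/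
def flip (β : CMod 𝔟 H) (γ : CMod 𝔟.op L) : RT β γ ≃ₗᵢ[ℂ] RT γ β := (exists_flip β γ).choose

theorem flip_tmul (β : CMod 𝔟 H) (γ : CMod 𝔟.op L) (ξ : β.carrier) (ζ : K) (η : γ.carrier) :
    flip β γ (tmul β γ ξ ζ η) = tmul γ β η ζ ξ := (exists_flip β γ).choose_spec (ξ, ζ, η)

end Flip

section Assoc

variable (β : CMod 𝔟 H) (γ : CMod 𝔟.op L) (δ : CMod 𝔠 L) (ε : CMod 𝔠.op M)

theorem exists_assoc (hγδ : γ.Stable δ) (hδγ : δ.Stable γ) :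
    ∃ T : RT (rtri β γ δ hγδ) ε ≃ₗᵢ[ℂ] RT β (ltri δ ε γ hδγ),
      ∀ p : ε.carrier × β.carrier × L,
        T (ket2 (rtri β γ δ hγδ) ε p.1 (ket1 β γ p.2.1 p.2.2))
          = ket1 β (ltri δ ε γ hδγ) p.2.1 (ket2 δ ε p.1 p.2.2) := by
  refine exists_unitary (fun p : ε.carrier × β.carrier × L =>
    ket2 (rtri β γ δ hγδ) ε p.1 (ket1 β γ p.2.1 p.2.2)) _ ?_ ?_ ?_
  · refine ket2_total (isClosed_cspan _)
      (S := {x | ∃ ξ : β.carrier, ∃ y : L, x = ket1 β γ ξ y}) ?_ ?_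
    · refine ket1_total (isClosed_cspan _) (S := Set.univ) ?_ ?_
      · exact eq_top_iff.mpr fun x _ => subset_cspan _ trivial
      · intro ξ x _; exact subset_cspan _ ⟨ξ, x, rfl⟩
    · rintro η _ ⟨ξ, y, rfl⟩; exact subset_cspan _ ⟨(η, ξ, y), rfl⟩
  · refine ket1_total (isClosed_cspan _)
      (S := {x | ∃ η : ε.carrier, ∃ y : L, x = ket2 δ ε η y}) ?_ ?_
    · refine ket2_total (isClosed_cspan _) (S := Set.univ) ?_ ?_
      · exact eq_top_iff.mpr fun x _ => subset_cspan _ trivial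
      · intro ξ x _; exact subset_cspan _ ⟨ξ, x, rfl⟩
    · rintro ξ _ ⟨η, y, rfl⟩; exact subset_cspan _ ⟨(η, ξ, y), rfl⟩
  · rintro ⟨e, ξ, x⟩ ⟨e', ξ', x'⟩
    dsimp only
    rw [inner_ket2, inner_ket1, rho_rtri, rho_ltri, inner_ket1, inner_ket2]
    exact congrArg (fun A => ⟪x, A x'⟫_ℂ) (CMod.rho_comm γ δ hγδ _ _)

/-- The associator `(H _β⊗_γ L) _{β▷δ}⊗_ε M → H _β⊗_{γ◁ε} (L _δ⊗_ε M)`,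
`|e⟩₂ |ξ⟩₁ x ↦ |ξ⟩₁ |e⟩₂ x`. -/
def assoc (hγδ : γ.Stable δ) (hδγ : δ.Stable γ) :
    RT (rtri β γ δ hγδ) ε ≃ₗᵢ[ℂ] RT β (ltri δ ε γ hδγ) := (exists_assoc β γ δ ε hγδ hδγ).choose

theorem assoc_apply (hγδ : γ.Stable δ) (hδγ : δ.Stable γ) (e : ε.carrier) (ξ : β.carrier) (x : L) :
    assoc β γ δ ε hγδ hδγ (ket2 (rtri β γ δ hγδ) ε e (ket1 β γ ξ x))
      = ket1 β (ltri δ ε γ hδγ) ξ (ket2 δ ε e x) :=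
  (exists_assoc β γ δ ε hγδ hδγ).choose_spec (e, ξ, x)

end Assoc

section Flip23

variable (p : CMod 𝔟 H) (q : CMod 𝔠 H) (γ : CMod 𝔟.op L) (δ : CMod 𝔠.op M)

theorem exists_flip23 (hpq : p.Stable q) (hqp : q.Stable p) :
    ∃ T : RT (ltri p γ q hpq) δ ≃ₗᵢ[ℂ] RT (ltri q δ p hqp) γ,
      ∀ t : δ.carrier × γ.carrier × H,
        T (ket2 (ltri p γ q hpq) δ t.1 (ket2 p γ t.2.1 t.2.2))
          = ket2 (ltri q δ p hqp) γ t.2.1 (ket2 q δ t.1 t.2.2) := by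
  refine exists_unitary (fun t : δ.carrier × γ.carrier × H =>
    ket2 (ltri p γ q hpq) δ t.1 (ket2 p γ t.2.1 t.2.2)) _ ?_ ?_ ?_
  · refine ket2_total (isClosed_cspan _)
      (S := {x | ∃ η : γ.carrier, ∃ y : H, x = ket2 p γ η y}) ?_ ?_
    · refine ket2_total (isClosed_cspan _) (S := Set.univ) ?_ ?_
      · exact eq_top_iff.mpr fun x _ => subset_cspan _ trivial
      · intro ξ x _; exact subset_cspan _ ⟨ξ, x, rfl⟩
    · rintro η _ ⟨ξ, y, rfl⟩; exact subset_cspan _ ⟨(η, ξ, y), rfl⟩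
  · refine ket2_total (isClosed_cspan _)
      (S := {x | ∃ η : δ.carrier, ∃ y : H, x = ket2 q δ η y}) ?_ ?_
    · refine ket2_total (isClosed_cspan _) (S := Set.univ) ?_ ?_
      · exact eq_top_iff.mpr fun x _ => subset_cspan _ trivial
      · intro ξ x _; exact subset_cspan _ ⟨ξ, x, rfl⟩
    · rintro ξ _ ⟨η, y, rfl⟩; exact subset_cspan _ ⟨(η, ξ, y), rfl⟩
  · rintro ⟨d, g, x⟩ ⟨d', g', x'⟩
    dsimp only
    rw [inner_ket2, rho_ltri, inner_ket2, inner_ket2, rho_ltri, inner_ket2]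
    exact congrArg (fun A => ⟪x, A x'⟫_ℂ) (CMod.rho_comm p q hpq _ _)

/-- The flip of the last two tensor factors, `|d⟩₂ |g⟩₂ x ↦ |g⟩₂ |d⟩₂ x`. -/
def flip23 (hpq : p.Stable q) (hqp : q.Stable p) :
    RT (ltri p γ q hpq) δ ≃ₗᵢ[ℂ] RT (ltri q δ p hqp) γ := (exists_flip23 p q γ δ hpq hqp).choose

theorem flip23_apply (hpq : p.Stable q) (hqp : q.Stable p) (d : δ.carrier) (g : γ.carrier) (x : H) :
    flip23 p q γ δ hpq hqp (ket2 (ltri p γ q hpq) δ d (ket2 p γ g x))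
      = ket2 (ltri q δ p hqp) γ g (ket2 q δ d x) :=
  (exists_flip23 p q γ δ hpq hqp).choose_spec (d, g, x)

end Flip23

section Map

variable {H' L' : Type*} [NormedAddCommGroup H'] [InnerProductSpace ℂ H'] [CompleteSpace H']
  [NormedAddCommGroup L'] [InnerProductSpace ℂ L'] [CompleteSpace L']

theorem exists_map {β : CMod 𝔟 H} {β' : CMod 𝔟 H'} {γ : CMod 𝔟.op L} {γ' : CMod 𝔟.op L'}
    (S : H →L[ℂ] H') (hS : β.IsModMap β' S) (T : L →L[ℂ] L') (hT : γ.IsModMap γ' T) :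
    ∃ R : RT β γ →L[ℂ] RT β' γ', ∀ p : β.carrier × K × γ.carrier,
      R (tfam β γ p) = tmul β' γ' ⟨S ∘L (p.1 : K →L[ℂ] H), hS.1 _ p.1.2⟩ p.2.1
        ⟨T ∘L (p.2.2 : K →L[ℂ] L), hT.1 _ p.2.2.2⟩ := by
  let ι := β.carrier × K × γ.carrier
  have hP := opPSD_defect (ι := ι) (fun p => (p.1 : K →L[ℂ] H)) S
  have hQ := opPSD_defect (ι := ι) (fun p => (p.2.2 : K →L[ℂ] L)) T
  have hP' := opPSD_gram (ι := ι) (fun p => S ∘L (p.1 : K →L[ℂ] H))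
  have hQ' : OpPSD fun i j : ι => ((‖T‖ : ℂ) ^ 2) •
      ((i.2.2 : K →L[ℂ] L)† ∘L (j.2.2 : K →L[ℂ] L)) := by
    have := opPSD_gram (ι := ι) (fun p => (‖T‖ : ℂ) • (p.2.2 : K →L[ℂ] L))
    convert this using 3 with i j
    rw [map_smulₛₗ, ContinuousLinearMap.smul_comp, ContinuousLinearMap.comp_smul, smul_smul, sq]
    simp
  have hSB : ∀ i j : ι, ((S ∘L (i.1 : K →L[ℂ] H))† ∘L (S ∘L (j.1 : K →L[ℂ] H))) ∈ 𝔟.B :=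
    fun i j => β'.gram_mem (hS.1 _ i.1.2) (hS.1 _ j.1.2)
  have hTB : ∀ i j : ι, ((T ∘L (i.2.2 : K →L[ℂ] L))† ∘L (T ∘L (j.2.2 : K →L[ℂ] L))) ∈ 𝔟.Bop :=
    fun i j => γ'.gram_mem (hT.1 _ i.2.2.2) (hT.1 _ j.2.2.2)
  have h1 := hP.mul hQ' fun i j k l => 𝔟.comm _
    (sub_mem (𝔟.B.smul_mem (β.gram_mem i.1.2 j.1.2) _) (hSB i j)) _
    (𝔟.Bop.smul_mem (γ.gram_mem k.2.2.2 l.2.2.2) _)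
  have h2 := hP'.mul hQ fun i j k l => 𝔟.comm _ (hSB i j) _
    (sub_mem (𝔟.Bop.smul_mem (γ.gram_mem k.2.2.2 l.2.2.2) _) (hTB k l))
  have h3 : OpPSD fun i j : ι =>
      ((((‖S‖ : ℂ) ^ 2) • ((i.1 : K →L[ℂ] H)† ∘L (j.1 : K →L[ℂ] H))
        - (S ∘L (i.1 : K →L[ℂ] H))† ∘L (S ∘L (j.1 : K →L[ℂ] H)))
        * (((‖T‖ : ℂ) ^ 2) • ((i.2.2 : K →L[ℂ] L)† ∘L (j.2.2 : K →L[ℂ] L))))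
      + (((S ∘L (i.1 : K →L[ℂ] H))† ∘L (S ∘L (j.1 : K →L[ℂ] H)))
        * (((‖T‖ : ℂ) ^ 2) • ((i.2.2 : K →L[ℂ] L)† ∘L (j.2.2 : K →L[ℂ] L))
        - (T ∘L (i.2.2 : K →L[ℂ] L))† ∘L (T ∘L (j.2.2 : K →L[ℂ] L)))) := by
    intro s x
    have := add_nonneg (h1 s x) (h2 s x)
    simp only [← Finset.sum_add_distrib, ← inner_add_right] at this
    exact this
  have h4 : ∀ p q : ι, ((‖S‖ * ‖T‖ : ℝ) : ℂ) ^ 2 * ⟪tfam β γ p, tfam β γ q⟫_ℂ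
      - ⟪tmul β' γ' ⟨S ∘L (p.1 : K →L[ℂ] H), hS.1 _ p.1.2⟩ p.2.1
          ⟨T ∘L (p.2.2 : K →L[ℂ] L), hT.1 _ p.2.2.2⟩,
        tmul β' γ' ⟨S ∘L (q.1 : K →L[ℂ] H), hS.1 _ q.1.2⟩ q.2.1
          ⟨T ∘L (q.2.2 : K →L[ℂ] L), hT.1 _ q.2.2.2⟩⟫_ℂ = ⟪p.2.1, (((((‖S‖ : ℂ) ^ 2) •
          ((p.1 : K →L[ℂ] H)† ∘L (q.1 : K →L[ℂ] H))
        - (S ∘L (p.1 : K →L[ℂ] H))† ∘L (S ∘L (q.1 : K →L[ℂ] H)))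
        * (((‖T‖ : ℂ) ^ 2) • ((p.2.2 : K →L[ℂ] L)† ∘L (q.2.2 : K →L[ℂ] L))))
      + (((S ∘L (p.1 : K →L[ℂ] H))† ∘L (S ∘L (q.1 : K →L[ℂ] H)))
        * (((‖T‖ : ℂ) ^ 2) • ((p.2.2 : K →L[ℂ] L)† ∘L (q.2.2 : K →L[ℂ] L))
        - (T ∘L (p.2.2 : K →L[ℂ] L))† ∘L (T ∘L (q.2.2 : K →L[ℂ] L))))) q.2.1⟫_ℂ := by
    intro p q
    simp only [sub_mul, mul_sub, sub_add_sub_cancel]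
    rw [_root_.sub_apply, inner_sub_right, smul_mul_smul_comm, _root_.smul_apply, inner_smul_right]
    simp only [tfam, inner_tmul]
    push_cast
    rw [mul_pow]
    rfl
  obtain ⟨R, -, hR⟩ := exists_extend_of_opPSD (tfam β γ) _ (tfam_total β γ) (‖S‖ * ‖T‖)
    (by positivity) (fun p => p.2.1) _ h3 h4
  exact ⟨R, hR⟩

/-- The operator `S ⊗ T` on relative tensor products, for module maps `S` and `T`. -/
def map {β : CMod 𝔟 H} {β' : CMod 𝔟 H'} {γ : CMod 𝔟.op L} {γ' : CMod 𝔟.op L'}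
    (S : H →L[ℂ] H') (hS : β.IsModMap β' S) (T : L →L[ℂ] L') (hT : γ.IsModMap γ' T) :
    RT β γ →L[ℂ] RT β' γ' := (exists_map S hS T hT).choose

theorem map_tmul {β : CMod 𝔟 H} {β' : CMod 𝔟 H'} {γ : CMod 𝔟.op L} {γ' : CMod 𝔟.op L'}
    (S : H →L[ℂ] H') (hS : β.IsModMap β' S) (T : L →L[ℂ] L') (hT : γ.IsModMap γ' T)
    (ξ : β.carrier) (ζ : K) (η : γ.carrier) :
    map S hS T hT (tmul β γ ξ ζ η) = tmul β' γ' ⟨S ∘L (ξ : K →L[ℂ] H), hS.1 _ ξ.2⟩ ζ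
        ⟨T ∘L (η : K →L[ℂ] L), hT.1 _ η.2⟩ := (exists_map S hS T hT).choose_spec (ξ, ζ, η)

end Map

end RT

/-- The module `B` on `K` itself; over the opposite base this is the module `Bᵒᵖ` on `K`. -/
def unitMod (𝔟 : CStarBase K) : CMod 𝔟 K where
  carrier := 𝔟.B.toSubalgebra.toSubmodule
  isClosed := 𝔟.isClosed_B
  total := eq_top_iff.mpr fun x _ => subset_cspan _ ⟨1, 𝔟.B.one_mem, x, rfl⟩
  mul := le_antisymm
    (cspan_le 𝔟.isClosed_B (by rintro _ ⟨x, hx, y, hy, rfl⟩; exact 𝔟.B.mul_mem hx hy))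
    (fun x hx => subset_cspan _ ⟨x, hx, 1, 𝔟.B.one_mem, rfl⟩)
  adj := by
    refine Set.Subset.antisymm ?_ ?_
    · have : opMul (opAdj (𝔟.B.toSubalgebra.toSubmodule : Set (K →L[ℂ] K)))
          (𝔟.B.toSubalgebra.toSubmodule : Set (K →L[ℂ] K)) ≤ 𝔟.B.toSubalgebra.toSubmodule := by
        refine cspan_le 𝔟.isClosed_B ?_
        rintro _ ⟨_, ⟨x, hx, rfl⟩, y, hy, rfl⟩
        exact 𝔟.B.mul_mem (star_mem (s := 𝔟.B) hx) hy
      exact this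
    · intro x hx
      exact subset_cspan _ ⟨1, ⟨1, 𝔟.B.one_mem, ContinuousLinearMap.adjoint_one.symm⟩, x, hx, rfl⟩

/-- `A` is a (concrete) C*-algebra: a norm-closed subspace closed under products and adjoints. -/
structure IsCStarAlg (A : Submodule ℂ (H →L[ℂ] H)) : Prop where
  isClosed : IsClosed (A : Set (H →L[ℂ] H))
  mul_mem : ∀ a ∈ A, ∀ b ∈ A, a ∘L b ∈ A
  adj_mem : ∀ a ∈ A, a† ∈ A

/-- The C*-algebra `C ⊆ L(H)` acts non-degenerately: `[C H] = H`. -/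
def IsNondeg (C : Set (H →L[ℂ] H)) : Prop := opApp C = ⊤

/-- The multiplier algebra `M(C)` of an algebra `C` of operators on a Hilbert space, realized on
that Hilbert space. -/
def mult (C : Set (H →L[ℂ] H)) : Set (H →L[ℂ] H) :=
  {x | ∀ c ∈ C, x ∘L c ∈ C ∧ c ∘L x ∈ C}

/-- `(H, α, β, A)` is a C*-algebra over the pair of bases of the modules `α`, `β`. -/
structure IsAlg₂ (α : CMod 𝔟 H) (β : CMod 𝔠 H) (A : Submodule ℂ (H →L[ℂ] H)) : Prop where
  stable₁ : α.Stable β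
  stable₂ : β.Stable α
  isCStarAlg : IsCStarAlg A
  nondeg : IsNondeg (A : Set (H →L[ℂ] H))
  rho₁ : opMul (Set.range α.rho) (A : Set (H →L[ℂ] H)) ≤ A
  rho₂ : opMul (Set.range β.rho) (A : Set (H →L[ℂ] H)) ≤ A

/-- Linear, multiplicative and `*`-preserving maps on a subspace of operators (a `*`-homomorphism
in case the subspace is a C*-algebra). -/
structure IsStarHom (A : Submodule ℂ (H →L[ℂ] H)) (φ : A → (L →L[ℂ] L)) : Prop where
  add : ∀ a b : A, φ (a + b) = φ a + φ b
  smul : ∀ (c : ℂ) (a : A), φ (c • a) = c • φ a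
  mul : ∀ a b c : A, (c : H →L[ℂ] H) = (a : H →L[ℂ] H) ∘L (b : H →L[ℂ] H) → φ c = φ a ∘L φ b
  star : ∀ a b : A, (b : H →L[ℂ] H) = (a : H →L[ℂ] H)† → φ b = (φ a)†

/-- The intertwiners `{T ∈ L(H_α, L_γ) | T a = φ(a) T for all a ∈ A}`. -/
def intertwiners (A : Submodule ℂ (H →L[ℂ] H)) (φ : A → (L →L[ℂ] L)) (α : CMod 𝔟 H)
    (γ : CMod 𝔟 L) : Set (H →L[ℂ] L) :=
  {T | α.IsModMap γ T ∧ ∀ a : A, T ∘L (a : H →L[ℂ] H) = φ a ∘L T}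

/-- `φ` is a morphism from the C*-algebra `(H, α, β, A)` to the C*-algebra `(L, γ, δ, C)`:
a non-degenerate `*`-homomorphism `A → M(C)` such that `[I α] = γ` and `[I' β] = δ` for the spaces
`I`, `I'` of intertwiners. -/
structure IsMor₂ (α : CMod 𝔟 H) (β : CMod 𝔠 H) (A : Submodule ℂ (H →L[ℂ] H))
    (γ : CMod 𝔟 L) (δ : CMod 𝔠 L) (C : Set (L →L[ℂ] L)) (φ : A → (L →L[ℂ] L)) : Prop where
  isStarHom : IsStarHom A φ
  mem_mult : ∀ a, φ a ∈ mult C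
  nondeg : IsNondeg (Set.range φ)
  mod₁ : opMul (intertwiners A φ α γ) (α.carrier : Set (K →L[ℂ] H)) = γ.carrier
  mod₂ : opMul (intertwiners A φ β δ) (β.carrier : Set (K →L[ℂ] H)) = δ.carrier

/-- The fiber product `A _α∗_β C ⊆ L(H _α⊗_β L)`. -/
def fiber (α : CMod 𝔟 H) (β : CMod 𝔟.op L) (A : Submodule ℂ (H →L[ℂ] H))
    (C : Submodule ℂ (L →L[ℂ] L)) : Set (RT α β →L[ℂ] RT α β) :=
  {x |
    (∀ ξ : α.carrier,
      x ∘L RT.ket1 α β ξ ∈ opMul (Set.range (RT.ket1 α β)) (C : Set (L →L[ℂ] L)) ∧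
      (x†) ∘L RT.ket1 α β ξ ∈ opMul (Set.range (RT.ket1 α β)) (C : Set (L →L[ℂ] L))) ∧
    (∀ η : β.carrier,
      x ∘L RT.ket2 α β η ∈ opMul (Set.range (RT.ket2 α β)) (A : Set (H →L[ℂ] H)) ∧
      (x†) ∘L RT.ket2 α β η ∈ opMul (Set.range (RT.ket2 α β)) (A : Set (H →L[ℂ] H)))}

/-- The raw data of a Hopf C*-bimodule over `𝔟`: two compatible modules `α` (over `𝔟`) and `β`
(over the opposite of `𝔟`) on `H`, a space `A` of operators and a map `Δ : A → L(H _α⊗_β H)`. -/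
structure BimoduleData (𝔟 : CStarBase K) (H : Type*) [NormedAddCommGroup H]
    [InnerProductSpace ℂ H] [CompleteSpace H] where
  α : CMod 𝔟 H
  β : CMod 𝔟.op H
  stable₁ : α.Stable β
  stable₂ : β.Stable α
  A : Submodule ℂ (H →L[ℂ] H)
  Δ : A → (RT α β →L[ℂ] RT α β)

namespace BimoduleData

variable (X : BimoduleData 𝔟 H)

/-- The module `α ▷ α` on `H _α⊗_β H`. -/
def αα : CMod 𝔟 (RT X.α X.β) := RT.rtri X.α X.β X.α X.stable₂

/-- The module `β ◁ β` on `H _α⊗_β H`. -/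
def ββ : CMod 𝔟.op (RT X.α X.β) := RT.ltri X.α X.β X.β X.stable₁

/-- `y = (Δ ∗ Id)(x)`, as an operator on `(H _α⊗_β H) _{α▷α}⊗_β H`: this is characterized by
`y (S ⊗ T) = (S ⊗ T) x` for all intertwiners `S` for `Δ` and `T` for `Id`. -/
def IsDeltaId (x : RT X.α X.β →L[ℂ] RT X.α X.β) (y : RT X.αα X.β →L[ℂ] RT X.αα X.β) : Prop :=
  ∀ (S : H →L[ℂ] RT X.α X.β) (hS : S ∈ intertwiners X.A X.Δ X.α X.αα)
    (T : H →L[ℂ] H) (hT : T ∈ intertwiners X.A (fun a => (a : H →L[ℂ] H)) X.β X.β),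
    y ∘L RT.map S hS.1 T hT.1 = RT.map S hS.1 T hT.1 ∘L x

/-- `y = (Id ∗ Δ)(x)`, as an operator on `H _α⊗_{β◁β} (H _α⊗_β H)`. -/
def IsIdDelta (x : RT X.α X.β →L[ℂ] RT X.α X.β) (y : RT X.α X.ββ →L[ℂ] RT X.α X.ββ) : Prop :=
  ∀ (T : H →L[ℂ] H) (hT : T ∈ intertwiners X.A (fun a => (a : H →L[ℂ] H)) X.α X.α)
    (S : H →L[ℂ] RT X.α X.β) (hS : S ∈ intertwiners X.A X.Δ X.β X.ββ),
    y ∘L RT.map T hT.1 S hS.1 = RT.map T hT.1 S hS.1 ∘L x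

/-- The identification `(H _α⊗_β H) _{α▷α}⊗_β H ≅ H _α⊗_{β◁β} (H _α⊗_β H)`. -/
def assoc : RT X.αα X.β ≃ₗᵢ[ℂ] RT X.α X.ββ :=
  RT.assoc X.α X.β X.α X.β X.stable₂ X.stable₁

/-- `(H, α, β, A, Δ)` is a Hopf C*-bimodule over `𝔟`. -/
structure IsHopf : Prop where
  isAlg : IsAlg₂ X.α X.β X.A
  nondeg_fiber : IsNondeg (fiber X.α X.β X.A X.A)
  isMor : IsMor₂ X.α X.β X.A X.αα X.ββ (fiber X.α X.β X.A X.A) X.Δ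
  coassoc : ∀ a : X.A, ∃ (y : RT X.αα X.β →L[ℂ] RT X.αα X.β)
    (z : RT X.α X.ββ →L[ℂ] RT X.α X.ββ),
    X.IsDeltaId (X.Δ a) y ∧ X.IsIdDelta (X.Δ a) z ∧ ∀ t, X.assoc (y t) = z (X.assoc t)

/-- `⟨ξ|₁ Δ(a) |ξ'⟩₁`. -/
def slice1 (a : X.A) (ξ ξ' : X.α.carrier) : H →L[ℂ] H :=
  (RT.ket1 X.α X.β ξ)† ∘L X.Δ a ∘L RT.ket1 X.α X.β ξ'

/-- `⟨η|₂ Δ(a) |η'⟩₂`. -/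
def slice2 (a : X.A) (η η' : X.β.carrier) : H →L[ℂ] H :=
  (RT.ket2 X.α X.β η)† ∘L X.Δ a ∘L RT.ket2 X.α X.β η'

/-- `ε` is a morphism from `(H, α, β, A)` to `(K, B, Bᵒᵖ, L(K))`. -/
def IsUnitMor (ε : X.A → (K →L[ℂ] K)) : Prop :=
  IsMor₂ X.α X.β X.A (unitMod 𝔟) (unitMod 𝔟.op) Set.univ ε

/-- `ε` is a bounded left counit. -/
def IsLeftCounit (ε : X.A → (K →L[ℂ] K)) : Prop :=
  X.IsUnitMor ε ∧ ∀ (a : X.A) (η η' : X.β.carrier), ∃ h : X.slice2 a η η' ∈ X.A,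
    ε ⟨X.slice2 a η η', h⟩ = (η : K →L[ℂ] H)† ∘L (a : H →L[ℂ] H) ∘L (η' : K →L[ℂ] H)

/-- `ε` is a bounded right counit. -/
def IsRightCounit (ε : X.A → (K →L[ℂ] K)) : Prop :=
  X.IsUnitMor ε ∧ ∀ (a : X.A) (ξ ξ' : X.α.carrier), ∃ h : X.slice1 a ξ ξ' ∈ X.A,
    ε ⟨X.slice1 a ξ ξ', h⟩ = (ξ : K →L[ℂ] H)† ∘L (a : H →L[ℂ] H) ∘L (ξ' : K →L[ℂ] H)

/-- `ε` is a bounded counit. -/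
def IsCounit (ε : X.A → (K →L[ℂ] K)) : Prop := X.IsLeftCounit ε ∧ X.IsRightCounit ε

/-- `φ` is a non-zero completely positive contraction. -/
structure IsCPContraction (φ : X.A → (K →L[ℂ] K)) : Prop where
  add : ∀ a b : X.A, φ (a + b) = φ a + φ b
  smul : ∀ (c : ℂ) (a : X.A), φ (c • a) = c • φ a
  completelyPositive : ∀ (n : ℕ) (a : Fin n → Fin n → X.A),
    OpPSD (fun i j => (a i j : H →L[ℂ] H)) → OpPSD (fun i j => φ (a i j))
  contraction : ∀ a : X.A, ‖φ a‖ ≤ ‖(a : H →L[ℂ] H)‖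
  nonzero : ∃ a, φ a ≠ 0

/-- `φ : A → B` is a bounded left Haar weight. -/
structure IsLeftHaar (φ : X.A → 𝔟.B) : Prop where
  cp : X.IsCPContraction fun a => (φ a : K →L[ℂ] K)
  bimod : ∀ (a : X.A) (b c : 𝔟.B), ∃ h : X.β.rho b ∘L (a : H →L[ℂ] H) ∘L X.β.rho c ∈ X.A,
    φ ⟨X.β.rho b ∘L (a : H →L[ℂ] H) ∘L X.β.rho c, h⟩ = b * φ a * c
  invariant : ∀ (a : X.A) (ξ ξ' : X.α.carrier), ∃ h : X.slice1 a ξ ξ' ∈ X.A,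
    (φ ⟨X.slice1 a ξ ξ', h⟩ : K →L[ℂ] K)
      = (ξ : K →L[ℂ] H)† ∘L X.β.rho (φ a) ∘L (ξ' : K →L[ℂ] H)

/-- `ψ : A → Bᵒᵖ` is a bounded right Haar weight. -/
structure IsRightHaar (ψ : X.A → 𝔟.Bop) : Prop where
  cp : X.IsCPContraction fun a => (ψ a : K →L[ℂ] K)
  bimod : ∀ (a : X.A) (b c : 𝔟.Bop), ∃ h : X.α.rho b ∘L (a : H →L[ℂ] H) ∘L X.α.rho c ∈ X.A,
    ψ ⟨X.α.rho b ∘L (a : H →L[ℂ] H) ∘L X.α.rho c, h⟩ = b * ψ a * c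
  invariant : ∀ (a : X.A) (η η' : X.β.carrier), ∃ h : X.slice2 a η η' ∈ X.A,
    (ψ ⟨X.slice2 a η η', h⟩ : K →L[ℂ] K)
      = (η : K →L[ℂ] H)† ∘L X.α.rho (ψ a) ∘L (η' : K →L[ℂ] H)

end BimoduleData

/-- A unitary `V : H _β̂⊗_α H → H _α⊗_β H` on a C*-module `(H, β̂, α, β)` over
`(𝔟ᵒᵖ, 𝔟, 𝔟ᵒᵖ)` that intertwines the induced module structures. -/
structure PreCPMU (𝔟 : CStarBase K) (H : Type*) [NormedAddCommGroup H] [InnerProductSpace ℂ H]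
    [CompleteSpace H] where
  βh : CMod 𝔟.op H
  α : CMod 𝔟 H
  β : CMod 𝔟.op H
  βh_α : βh.Stable α
  βh_β : βh.Stable β
  α_βh : α.Stable βh
  α_β : α.Stable β
  β_βh : β.Stable βh
  β_α : β.Stable α
  V : RT βh α ≃ₗᵢ[ℂ] RT α β
  /-- `V (α ◁ α) = α ▷ α`. -/
  intertwine₁ : {T | ∃ x ∈ (RT.ltri βh α α βh_α).carrier,
    T = (V.toContinuousLinearEquiv : RT βh α →L[ℂ] RT α β) ∘L x}
      = ((RT.rtri α β α β_α).carrier : Set (K →L[ℂ] RT α β))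
  /-- `V (β̂ ▷ β) = β̂ ◁ β`. -/
  intertwine₂ : {T | ∃ x ∈ (RT.rtri βh α β α_β).carrier,
    T = (V.toContinuousLinearEquiv : RT βh α →L[ℂ] RT α β) ∘L x}
      = ((RT.ltri α β βh α_βh).carrier : Set (K →L[ℂ] RT α β))
  /-- `V (β̂ ▷ β̂) = α ▷ β̂`. -/
  intertwine₃ : {T | ∃ x ∈ (RT.rtri βh α βh α_βh).carrier,
    T = (V.toContinuousLinearEquiv : RT βh α →L[ℂ] RT α β) ∘L x}
      = ((RT.rtri α β βh β_βh).carrier : Set (K →L[ℂ] RT α β))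
  /-- `V (β ◁ α) = β ◁ β`. -/
  intertwine₄ : {T | ∃ x ∈ (RT.ltri βh α β βh_β).carrier,
    T = (V.toContinuousLinearEquiv : RT βh α →L[ℂ] RT α β) ∘L x}
      = ((RT.ltri α β β α_β).carrier : Set (K →L[ℂ] RT α β))

/-- A unitary that maps one module onto another is a morphism of modules. -/
theorem isModMap_of_unitary (α : CMod 𝔟 H) (β : CMod 𝔟 L) (V : H ≃ₗᵢ[ℂ] L)
    (h : {T | ∃ x ∈ α.carrier, T = (V.toContinuousLinearEquiv : H →L[ℂ] L) ∘L x}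
      = (β.carrier : Set (K →L[ℂ] L))) :
    α.IsModMap β (V.toContinuousLinearEquiv : H →L[ℂ] L) := by
  constructor
  · intro ξ hξ
    have : (V.toContinuousLinearEquiv : H →L[ℂ] L) ∘L ξ ∈ (β.carrier : Set (K →L[ℂ] L)) := by
      rw [← h]; exact ⟨ξ, hξ, rfl⟩
    exact this
  · intro η hη
    have h1 : η ∈ (β.carrier : Set (K →L[ℂ] L)) := hη
    rw [← h] at h1
    obtain ⟨ξ, hξ, rfl⟩ := h1
    have : ((V.toContinuousLinearEquiv : H →L[ℂ] L)†) ∘L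
        ((V.toContinuousLinearEquiv : H →L[ℂ] L) ∘L ξ) = ξ := by
      ext ζ
      refine ext_inner_left ℂ fun x => ?_
      rw [ContinuousLinearMap.comp_apply, ContinuousLinearMap.adjoint_inner_right]
      exact V.inner_map_map x (ξ ζ)
    rw [this]
    exact hξ

/-- The flip maps `α ▷ δ` to `δ ◁ α`. -/
theorem isModMap_flip (β : CMod 𝔟 H) (γ : CMod 𝔟.op L) (δ : CMod 𝔠 L) (h : γ.Stable δ) :
    (RT.rtri β γ δ h).IsModMap (RT.ltri γ β δ h)
      ((RT.flip β γ).toContinuousLinearEquiv : RT β γ →L[ℂ] RT γ β) := by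
  set F : RT β γ →L[ℂ] RT γ β := ((RT.flip β γ).toContinuousLinearEquiv : RT β γ →L[ℂ] RT γ β)
  have hF : ∀ ξ : β.carrier, F ∘L RT.ket1 β γ ξ = RT.ket2 γ β ξ := by
    intro ξ
    refine eq_of_total γ.app_total fun p => ?_
    rw [ContinuousLinearMap.comp_apply, CMod.app, RT.ket1_apply, RT.ket2_apply]
    exact RT.flip_tmul β γ ξ p.2 p.1
  have hF' : ∀ ξ : β.carrier, (F†) ∘L RT.ket2 γ β ξ = RT.ket1 β γ ξ := by
    intro ξ
    rw [← hF]
    ext ζ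
    refine ext_inner_left ℂ fun x => ?_
    rw [ContinuousLinearMap.comp_apply, ContinuousLinearMap.adjoint_inner_right]
    exact (RT.flip β γ).inner_map_map x _
  constructor
  · intro x hx
    refine comp_mem_cspan (isClosed_cspan _) F ?_ hx
    rintro _ ⟨ξ, η, hη, rfl⟩
    rw [← ContinuousLinearMap.comp_assoc, hF]
    exact subset_cspan _ ⟨ξ, η, hη, rfl⟩
  · intro x hx
    refine comp_mem_cspan (isClosed_cspan _) (F†) ?_ hx
    rintro _ ⟨ξ, η, hη, rfl⟩
    rw [← ContinuousLinearMap.comp_assoc, hF']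
    exact subset_cspan _ ⟨ξ, η, hη, rfl⟩

namespace PreCPMU

variable (W : PreCPMU 𝔟 H)

/-- The source `H _β̂⊗_α H`. -/
abbrev Src : Type _ := RT W.βh W.α

/-- The range `H _α⊗_β H`. -/
abbrev Rng : Type _ := RT W.α W.β

/-- `V` as a continuous linear map. -/
def op : W.Src →L[ℂ] W.Rng := (W.V.toContinuousLinearEquiv : RT W.βh W.α →L[ℂ] RT W.α W.β)

/-- The modules induced on the source. -/
abbrev srcαα : CMod 𝔟 W.Src := RT.ltri W.βh W.α W.α W.βh_α
abbrev srcβhβ : CMod 𝔟.op W.Src := RT.rtri W.βh W.α W.β W.α_β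
abbrev srcβhβh : CMod 𝔟.op W.Src := RT.rtri W.βh W.α W.βh W.α_βh
abbrev srcβα : CMod 𝔟.op W.Src := RT.ltri W.βh W.α W.β W.βh_β

/-- The modules induced on the range. -/
abbrev rngαα : CMod 𝔟 W.Rng := RT.rtri W.α W.β W.α W.β_α
abbrev rngβhβ : CMod 𝔟.op W.Rng := RT.ltri W.α W.β W.βh W.α_βh
abbrev rngαβh : CMod 𝔟.op W.Rng := RT.rtri W.α W.β W.βh W.β_βh
abbrev rngββ : CMod 𝔟.op W.Rng := RT.ltri W.α W.β W.β W.α_β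

theorem mod₁ : W.srcαα.IsModMap W.rngαα W.op := isModMap_of_unitary _ _ W.V W.intertwine₁
theorem mod₂ : W.srcβhβ.IsModMap W.rngβhβ W.op := isModMap_of_unitary _ _ W.V W.intertwine₂
theorem mod₃ : W.srcβhβh.IsModMap W.rngαβh W.op := isModMap_of_unitary _ _ W.V W.intertwine₃
theorem mod₄ : W.srcβα.IsModMap W.rngββ W.op := isModMap_of_unitary _ _ W.V W.intertwine₄

/-- The module `α ◁ α` on `H _β⊗_α H`. -/
abbrev flipαα : CMod 𝔟 (RT W.β W.α) := RT.ltri W.β W.α W.α W.β_α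

/-- The upper path `V₂₃ V₁₂` of the pentagon. -/
def pentagonUpper : RT W.srcβhβh W.α →L[ℂ] RT W.α W.rngββ :=
  RT.map (β := W.α) (β' := W.α) (γ := W.srcβα) (γ' := W.rngββ) 1 W.α.isModMap_one W.op W.mod₄ ∘L
  ((RT.assoc W.α W.β W.βh W.α W.β_βh W.βh_β).toContinuousLinearEquiv :
    RT W.rngαβh W.α →L[ℂ] RT W.α W.srcβα) ∘L
  RT.map (β := W.srcβhβh) (β' := W.rngαβh) (γ := W.α) (γ' := W.α) W.op W.mod₃ 1 W.α.isModMap_one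

/-- The middle part `Σ₂₃ V₁₂ (1 ⊗ Σ)` of the lower path, from `H _β̂⊗_{α▷α} (H _α⊗_β H)` via
`H _β̂⊗_α H _β⊗_α H` to `(H _β̂⊗_α H) _{α◁α}⊗_β H`. -/
def pentagonMid : RT W.βh W.rngαα →L[ℂ] RT W.srcαα W.β :=
  ((RT.flip23 W.α W.βh W.β W.α W.α_βh W.βh_α).toContinuousLinearEquiv :
    RT W.rngβhβ W.α →L[ℂ] RT W.srcαα W.β) ∘L
  RT.map (β := W.srcβhβ) (β' := W.rngβhβ) (γ := W.α) (γ' := W.α) W.op W.mod₂ 1 W.α.isModMap_one ∘L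
  ((RT.assoc W.βh W.α W.β W.α W.α_β W.β_α).symm.toContinuousLinearEquiv :
    RT W.βh W.flipαα →L[ℂ] RT W.srcβhβ W.α) ∘L
  RT.map (β := W.βh) (β' := W.βh) (γ := W.rngαα) (γ' := W.flipαα) 1 W.βh.isModMap_one
    ((RT.flip W.α W.β).toContinuousLinearEquiv : RT W.α W.β →L[ℂ] RT W.β W.α)
    (isModMap_flip W.α W.β W.α W.β_α)

/-- The lower path `V₁₂ Σ₂₃ V₁₂ (1 ⊗ Σ) V₂₃` of the pentagon, i.e. `V₁₂ V₁₃ V₂₃`. -/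
def pentagonLower : RT W.srcβhβh W.α →L[ℂ] RT W.α W.rngββ :=
  ((RT.assoc W.α W.β W.α W.β W.β_α W.α_β).toContinuousLinearEquiv :
    RT W.rngαα W.β →L[ℂ] RT W.α W.rngββ) ∘L
  RT.map (β := W.srcαα) (β' := W.rngαα) (γ := W.β) (γ' := W.β) W.op W.mod₁ 1 W.β.isModMap_one ∘L
  W.pentagonMid ∘L
  RT.map (β := W.βh) (β' := W.βh) (γ := W.srcαα) (γ' := W.rngαα) 1 W.βh.isModMap_one
    W.op W.mod₁ ∘L
  ((RT.assoc W.βh W.α W.βh W.α W.α_βh W.βh_α).toContinuousLinearEquiv :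
    RT W.srcβhβh W.α →L[ℂ] RT W.βh W.srcαα)

end PreCPMU

/-- A C*-pseudo-multiplicative unitary over the C*-base `𝔟`. -/
structure CPMU (𝔟 : CStarBase K) (H : Type*) [NormedAddCommGroup H] [InnerProductSpace ℂ H]
    [CompleteSpace H] extends PreCPMU 𝔟 H where
  pentagon : toPreCPMU.pentagonUpper = toPreCPMU.pentagonLower

namespace CPMU

variable (W : CPMU 𝔟 H)

/-- `⟨η|₂ V |ξ⟩₂` for `η ∈ β`, `ξ ∈ α`. -/
def slice2 (η : W.β.carrier) (ξ : W.α.carrier) : H →L[ℂ] H :=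
  (RT.ket2 W.α W.β η)† ∘L W.op ∘L RT.ket2 W.βh W.α ξ

/-- `⟨η|₁ V |ξ⟩₁` for `η ∈ α`, `ξ ∈ β̂`. -/
def slice1 (η : W.α.carrier) (ξ : W.βh.carrier) : H →L[ℂ] H :=
  (RT.ket1 W.α W.β η)† ∘L W.op ∘L RT.ket1 W.βh W.α ξ

/-- `Â(V) = [⟨β|₂ V |α⟩₂]`. -/
def Ahat : Submodule ℂ (H →L[ℂ] H) := cspan {T | ∃ η ξ, T = W.slice2 η ξ}

/-- `A(V) = [⟨α|₁ V |β̂⟩₁]`. -/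
def A : Submodule ℂ (H →L[ℂ] H) := cspan {T | ∃ η ξ, T = W.slice1 η ξ}

end CPMU

/-- Membership in `L(H_α)` passes to closed linear spans. -/
theorem isModMap_of_cspan (α : CMod 𝔟 H) {S : Set (H →L[ℂ] H)} (h : ∀ x ∈ S, α.IsModMap α x)
    {x : H →L[ℂ] H} (hx : x ∈ cspan S) : α.IsModMap α x := by
  refine ⟨fun ξ hξ => cspan_comp_mem α.isClosed ξ (fun y hy => (h y hy).1 ξ hξ) hx, ?_⟩
  intro ξ hξ
  have : x† ∈ cspan (opAdj S) :=
    adj_mem_cspan (isClosed_cspan _) (fun y hy => subset_cspan (opAdj S) ⟨y, hy, rfl⟩) hx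
  refine cspan_comp_mem α.isClosed ξ ?_ this
  rintro _ ⟨y, hy, rfl⟩
  exact (h y hy).2 ξ hξ

theorem RT.bra2_mem_ltri (β : CMod 𝔟 H) (γ : CMod 𝔟.op L) (α : CMod 𝔠 H) (h : β.Stable α)
    (η : γ.carrier) {x : K →L[ℂ] RT β γ} (hx : x ∈ (RT.ltri β γ α h).carrier) :
    (RT.ket2 β γ η)† ∘L x ∈ α.carrier := by
  refine comp_mem_cspan α.isClosed _ ?_ hx
  rintro _ ⟨η', ξ, hξ, rfl⟩
  rw [← ContinuousLinearMap.comp_assoc, RT.bra2_ket2]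
  exact h.mem _ hξ

theorem RT.bra1_mem_rtri (β : CMod 𝔟 H) (γ : CMod 𝔟.op L) (δ : CMod 𝔠 L) (h : γ.Stable δ)
    (ξ : β.carrier) {x : K →L[ℂ] RT β γ} (hx : x ∈ (RT.rtri β γ δ h).carrier) :
    (RT.ket1 β γ ξ)† ∘L x ∈ δ.carrier := by
  refine comp_mem_cspan δ.isClosed _ ?_ hx
  rintro _ ⟨ξ', η, hη, rfl⟩
  rw [← ContinuousLinearMap.comp_assoc, RT.bra1_ket1]
  exact h.mem _ hη

namespace CPMU

variable (W : CPMU 𝔟 H)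

theorem isModMap_slice2 (η : W.β.carrier) (ξ : W.α.carrier) :
    W.β.IsModMap W.β (W.slice2 η ξ) := by
  have h1 : ∀ x ∈ W.β.carrier, RT.ket2 W.βh W.α ξ ∘L x ∈ W.srcβα.carrier :=
    fun x hx => subset_cspan _ ⟨ξ, x, hx, rfl⟩
  have h2 : ∀ x ∈ W.β.carrier, RT.ket2 W.α W.β η ∘L x ∈ W.rngββ.carrier :=
    fun x hx => subset_cspan _ ⟨η, x, hx, rfl⟩
  have h3 : (W.slice2 η ξ)† = (RT.ket2 W.βh W.α ξ)† ∘L (W.op†) ∘L RT.ket2 W.α W.β η := by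
    rw [slice2, ContinuousLinearMap.adjoint_comp, ContinuousLinearMap.adjoint_comp,
      ContinuousLinearMap.adjoint_adjoint, ContinuousLinearMap.comp_assoc]
  constructor
  · intro x hx
    have h4 := W.mod₄.1 _ (h1 x hx)
    have h5 := RT.bra2_mem_ltri W.α W.β W.β W.α_β η h4
    rw [slice2, ContinuousLinearMap.comp_assoc, ContinuousLinearMap.comp_assoc]
    exact h5
  · intro x hx
    have h4 := W.mod₄.2 _ (h2 x hx)
    have h5 := RT.bra2_mem_ltri W.βh W.α W.β W.βh_β ξ h4
    rw [h3, ContinuousLinearMap.comp_assoc, ContinuousLinearMap.comp_assoc]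
    exact h5

theorem isModMap_slice1 (η : W.α.carrier) (ξ : W.βh.carrier) :
    W.βh.IsModMap W.βh (W.slice1 η ξ) := by
  have h1 : ∀ x ∈ W.βh.carrier, RT.ket1 W.βh W.α ξ ∘L x ∈ W.srcβhβh.carrier :=
    fun x hx => subset_cspan _ ⟨ξ, x, hx, rfl⟩
  have h2 : ∀ x ∈ W.βh.carrier, RT.ket1 W.α W.β η ∘L x ∈ W.rngαβh.carrier :=
    fun x hx => subset_cspan _ ⟨η, x, hx, rfl⟩
  have h3 : (W.slice1 η ξ)† = (RT.ket1 W.βh W.α ξ)† ∘L (W.op†) ∘L RT.ket1 W.α W.β η := by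
    rw [slice1, ContinuousLinearMap.adjoint_comp, ContinuousLinearMap.adjoint_comp,
      ContinuousLinearMap.adjoint_adjoint, ContinuousLinearMap.comp_assoc]
  constructor
  · intro x hx
    have h4 := W.mod₃.1 _ (h1 x hx)
    have h5 := RT.bra1_mem_rtri W.α W.β W.βh W.β_βh η h4
    rw [slice1, ContinuousLinearMap.comp_assoc, ContinuousLinearMap.comp_assoc]
    exact h5
  · intro x hx
    have h4 := W.mod₃.2 _ (h2 x hx)
    have h5 := RT.bra1_mem_rtri W.βh W.α W.βh W.α_βh ξ h4
    rw [h3, ContinuousLinearMap.comp_assoc, ContinuousLinearMap.comp_assoc]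
    exact h5

theorem isModMap_Ahat {a : H →L[ℂ] H} (ha : a ∈ W.Ahat) : W.β.IsModMap W.β a := by
  refine isModMap_of_cspan W.β (S := {T | ∃ η ξ, T = W.slice2 η ξ}) ?_ ha
  rintro _ ⟨η, ξ, rfl⟩
  exact W.isModMap_slice2 η ξ

theorem isModMap_A {a : H →L[ℂ] H} (ha : a ∈ W.A) : W.βh.IsModMap W.βh a := by
  refine isModMap_of_cspan W.βh (S := {T | ∃ η ξ, T = W.slice1 η ξ}) ?_ ha
  rintro _ ⟨η, ξ, rfl⟩
  exact W.isModMap_slice1 η ξ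

/-- `Δ̂_V(a) = V* (1 ⊗ a) V`. -/
def Dhat (a : W.Ahat) : RT W.βh W.α →L[ℂ] RT W.βh W.α :=
  (W.op†) ∘L RT.map (β := W.α) (β' := W.α) (γ := W.β) (γ' := W.β) 1 W.α.isModMap_one
    (a : H →L[ℂ] H) (W.isModMap_Ahat a.2) ∘L W.op

/-- `Δ_V(a) = V (a ⊗ 1) V*`. -/
def D (a : W.A) : RT W.α W.β →L[ℂ] RT W.α W.β :=
  W.op ∘L RT.map (β := W.βh) (β' := W.βh) (γ := W.α) (γ' := W.α) (a : H →L[ℂ] H)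
    (W.isModMap_A a.2) 1 W.α.isModMap_one ∘L (W.op†)

/-- The leg `(Â(V)^{β̂,α}, Δ̂_V)`, over the opposite base. -/
def hatLeg : BimoduleData 𝔟.op H where
  α := W.βh
  β := W.α
  stable₁ := W.βh_α
  stable₂ := W.α_βh
  A := W.Ahat
  Δ := W.Dhat

/-- The leg `(A(V)^{α,β}, Δ_V)`. -/
def leg : BimoduleData 𝔟 H where
  α := W.α
  β := W.β
  stable₁ := W.α_β
  stable₂ := W.β_α
  A := W.A
  Δ := W.D

/-- `V` is well-behaved: both legs are Hopf C*-bimodules. -/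
def WellBehaved : Prop := W.hatLeg.IsHopf ∧ W.leg.IsHopf

/-- `V` is regular: `[⟨α|₁ V |α⟩₂] = [α α*]`. -/
def Regular : Prop :=
  cspan {T : H →L[ℂ] H | ∃ ξ ξ' : W.α.carrier,
      T = (RT.ket1 W.α W.β ξ)† ∘L W.op ∘L RT.ket2 W.βh W.α ξ'}
    = opMul (W.α.carrier : Set (K →L[ℂ] H)) (opAdj (W.α.carrier : Set (K →L[ℂ] H)))

/-- `η` is a fixed element for `V`: `η ∈ β̂ ∩ α` and `V |η⟩₁ = |η⟩₁`. -/
def Fix : Set (K →L[ℂ] H) :=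
  {η | ∃ (h : η ∈ W.βh.carrier) (h' : η ∈ W.α.carrier),
    W.op ∘L RT.ket1 W.βh W.α ⟨η, h⟩ = RT.ket1 W.α W.β ⟨η, h'⟩}

/-- `ξ` is a cofixed element for `V`: `ξ ∈ α ∩ β` and `V |ξ⟩₂ = |ξ⟩₂`. -/
def Cofix : Set (K →L[ℂ] H) :=
  {ξ | ∃ (h : ξ ∈ W.α.carrier) (h' : ξ ∈ W.β.carrier),
    W.op ∘L RT.ket2 W.βh W.α ⟨ξ, h⟩ = RT.ket2 W.α W.β ⟨ξ, h'⟩}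

/-- `V` is étale. -/
def Etale : Prop := ∃ η ∈ W.Fix, η† ∘L η = 1

/-- `V` is compact. -/
def Compact : Prop := ∃ ξ ∈ W.Cofix, ξ† ∘L ξ = 1

end CPMU

/-- A faithful KMS-state on a unital C*-algebra `B`, with its modular automorphism group `σ`:
a faithful state `μ` and a strongly continuous one-parameter group `σ` of `*`-automorphisms such
that for all `x, y` there is a bounded continuous function `F` on the strip `0 ≤ Im z ≤ 1`, analytic
in the interior, with `F(t) = μ(σ_t(x) y)` and `F(t + i) = μ(y σ_t(x))`. -/
structure FaithfulKMSState (B : Type*) [CStarAlgebra B] [PartialOrder B] [StarOrderedRing B] where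
  state : B →ₚ[ℂ] ℂ
  state_one : state 1 = 1
  faithful : ∀ b, state (star b * b) = 0 → b = 0
  σ : ℝ → B ≃⋆ₐ[ℂ] B
  σ_add : ∀ s t b, σ (s + t) b = σ s (σ t b)
  σ_continuous : ∀ b, Continuous fun t => σ t b
  kms : ∀ x y, ∃ F : ℂ → ℂ, DiffContOnCl ℂ F {z | 0 < z.im ∧ z.im < 1} ∧
    (∃ C : ℝ, ∀ z : ℂ, 0 ≤ z.im → z.im ≤ 1 → ‖F z‖ ≤ C) ∧
    ∀ t : ℝ, F t = state (σ t x * y) ∧ F (t + Complex.I) = state (y * σ t x)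

namespace FaithfulKMSState

variable {B : Type*} [CStarAlgebra B] [PartialOrder B] [StarOrderedRing B]
  (μ : FaithfulKMSState B)

/-- The GNS-space `H_μ`. -/
abbrev GNS : Type _ := μ.state.GNS

/-- The GNS-map `Λ_μ : B → H_μ`. -/
def Λ (b : B) : μ.GNS := (μ.state.toPreGNS b : UniformSpace.Completion μ.state.PreGNS)

/-- `b ∈ Dom(σ_{-i/2})` and `σ_{-i/2}(b) = c`. -/
def SigmaHalf (b c : B) : Prop :=
  ∃ F : ℂ → B, DiffContOnCl ℂ F {z | -(1 / 2) < z.im ∧ z.im < 0} ∧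
    (∀ t : ℝ, F t = μ.σ t b) ∧ F (-(Complex.I / 2)) = c

/-- The operators `π_{μᵒᵖ}(bᵒᵖ) : Λ_μ(x) ↦ Λ_μ(x σ_{-i/2}(b))`, `b ∈ Dom(σ_{-i/2})`. -/
def opGen : Set (μ.GNS →L[ℂ] μ.GNS) :=
  {T | ∃ b c, μ.SigmaHalf b c ∧ ∀ x, T (μ.Λ x) = μ.Λ (x * c)}

theorem Λ_dense : DenseRange μ.Λ := by
  have hd : DenseRange ((↑) : μ.state.PreGNS → UniformSpace.Completion μ.state.PreGNS) :=
    UniformSpace.Completion.denseRange_coe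
  have h2 : Function.Surjective μ.state.toPreGNS := μ.state.toPreGNS.surjective
  exact hd.comp h2.denseRange (UniformSpace.Completion.continuous_coe _)

theorem gns_Λ (a x : B) : μ.state.gnsStarAlgHom a (μ.Λ x) = μ.Λ (a * x) := by
  have := μ.state.gnsNonUnitalStarAlgHom_apply_coe (a := a) (b := μ.state.toPreGNS x)
  exact this

theorem gns_injective : Function.Injective μ.state.gnsStarAlgHom := by
  refine (injective_iff_map_eq_zero _).mpr fun b hb => μ.faithful b ?_
  have h1 : μ.Λ b = 0 := by
    have := μ.gns_Λ b 1
    rw [hb, mul_one] at this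
    exact this.symm
  have h2 : ⟪μ.Λ b, μ.Λ b⟫_ℂ = μ.state (star b * b) := by
    rw [Λ, UniformSpace.Completion.inner_coe, PositiveLinearMap.preGNS_inner_def]
    rfl
  rw [← h2, h1, inner_zero_left]

/-- The C*-base `(H_μ, B, Bᵒᵖ)`: `B` acts by the GNS-representation of `μ`, and `Bᵒᵖ` by the
GNS-representation of the opposite state on `H_{μᵒᵖ} = H_μ`, which is determined by
`bᵒᵖ Λ_μ(x) = Λ_μ(x σ_{-i/2}(b))` for `b` in the dense domain of `σ_{-i/2}`. -/
def base : CStarBase μ.GNS where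
  B := μ.state.gnsStarAlgHom.range
  Bop := (StarAlgebra.adjoin ℂ μ.opGen).topologicalClosure
  isClosed_B := by
    have h : Isometry μ.state.gnsStarAlgHom :=
      NonUnitalStarAlgHom.isometry (μ.state.gnsStarAlgHom : B →⋆ₐ[ℂ] _) μ.gns_injective
    exact h.isClosedEmbedding.isClosed_range
  isClosed_Bop := StarSubalgebra.isClosed_topologicalClosure _
  comm := by
    have h1 : StarAlgebra.adjoin ℂ μ.opGen
        ≤ StarSubalgebra.centralizer ℂ (Set.range μ.state.gnsStarAlgHom) := by
      refine StarAlgebra.adjoin_le ?_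
      rintro T ⟨b, c, -, hT⟩
      have hc : ∀ a, μ.state.gnsStarAlgHom a * T = T * μ.state.gnsStarAlgHom a := by
        intro a
        refine ContinuousLinearMap.ext fun v => ?_
        refine congrFun (μ.Λ_dense.equalizer
          (μ.state.gnsStarAlgHom a * T).continuous
          (T * μ.state.gnsStarAlgHom a).continuous ?_) v
        funext x
        change μ.state.gnsStarAlgHom a (T (μ.Λ x)) = T (μ.state.gnsStarAlgHom a (μ.Λ x))
        rw [hT, gns_Λ, gns_Λ, hT, mul_assoc]
      rw [SetLike.mem_coe, StarSubalgebra.mem_centralizer_iff]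
      rintro _ ⟨a, rfl⟩
      refine ⟨hc a, ?_⟩
      rw [← map_star]
      exact hc (star a)
    have h2 : (StarAlgebra.adjoin ℂ μ.opGen).topologicalClosure
        ≤ StarSubalgebra.centralizer ℂ (Set.range μ.state.gnsStarAlgHom) :=
      StarSubalgebra.topologicalClosure_minimal h1 (Set.isClosed_centralizer _)
    rintro _ ⟨a, rfl⟩ c hc
    exact ((StarSubalgebra.mem_centralizer_iff ℂ).mp (h2 hc) _ ⟨a, rfl⟩).1

end FaithfulKMSState

end CQG

end

/-!
Every assertion rests on two facts about an isometry `v : K → H` that is a fixed (`v = η₀`) or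
cofixed (`v = ξ₀`) element. The flip identity `|ξ⟩₁ η = |η⟩₂ ξ` allows `v` to be moved from one leg
of a relative tensor product to the other, and `V` acts trivially on `|η₀⟩₁`, respectively on
`|ξ₀⟩₂`.

*Counits.* These two facts give `⟨η|₂ V |ζ⟩₂ η₀ = η₀ η* ζ` and `⟨ζ|₁ V |ξ⟩₁ ξ₀ = ξ₀ ζ* ξ`
(`slice2_comp_of_mem_fix`, `slice1_comp_of_mem_cofix`), so the range of `v` is invariant under the
C*-algebra `Â(V)`, respectively `A(V)`. Hence `a ↦ v* a v` is a `*`-homomorphism,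
`v*` is an intertwiner that makes it a morphism to `L(K)` (`isUnitMor_compression`), and its values on generators do not
depend on `v`. Since `*`-homomorphisms of C*-algebras have closed range
(`NonUnitalStarAlgHom.isClosed_range`), the image is exactly the closed span of the values on
generators, and this is a C*-algebra. The identity for the left counit given by `η₀`, and for the
right counit given by `ξ₀`, follows by moving `v` across the comultiplication, where it meets `V`
only as `|η₀⟩₁` or `|ξ₀⟩₂`. The identity for the other side follows from
`Δ̂_V(a) |η₀⟩₂ = |η₀⟩₂ a` and `Δ_V(a) |ξ₀⟩₁ = |ξ₀⟩₁ a`, which the pentagon equation yields.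

*Haar weights.* On the other leg the compression `a ↦ v* a v` is completely positive and
contractive. It takes values in `Bᵒᵖ` because that leg leaves the module `β̂`, respectively `β`,
invariant, and the invariance identity again follows by moving `v` across the comultiplication.

*Slices.* That slices of comultiplications lie in the algebras is read off from the pentagon
equation. Sliced in one leg it says `V₁₂* V₂₃ V₁₂ = V₁₃ V₂₃` and `V₂₃ V₁₂ V₂₃* = V₁₂ V₁₃`
(`exists_Dhat_slice`, `exists_D_slice`). Since `V` maps the induced modules onto each other, a slice
of `Δ̂_V(⟨η|₂ V |ζ⟩₂)` or `Δ_V(⟨ζ|₁ V |ξ⟩₁)` by module elements on either side is again a single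
generator, with `η`, `ζ` or `ξ` replaced by another element of the same module
(`slice1_Dhat_slice2_mem` and its three analogues).
-/

/-! ### Homomorphisms of C*-algebras have closed range -/

namespace NonUnitalStarAlgHom

variable {A B : Type*} [NonUnitalCStarAlgebra A] [NonUnitalCStarAlgebra B]

open scoped CStarAlgebra in
/-- A self-adjoint element of the range has a preimage of no larger norm: cut off the spectrum of
any self-adjoint preimage. -/
theorem exists_preimage_norm_le_of_isSelfAdjoint (φ : A →⋆ₙₐ[ℂ] B) {a : A}
    (ha : IsSelfAdjoint a) : ∃ a', φ a' = φ a ∧ ‖a'‖ ≤ ‖φ a‖ := by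
  have hφa : IsSelfAdjoint (φ a) := ha.map φ
  have hφ : Continuous φ := map_continuous φ
  set r := ‖φ a‖
  have hr : 0 ≤ r := norm_nonneg _
  let f : ℝ → ℝ := fun x => max (-r) (min r x)
  have hf : Continuous f := by fun_prop
  have hf0 : f 0 = 0 := by simp [f, hr]
  refine ⟨cfcₙ f a, ?_, ?_⟩
  · rw [NonUnitalStarAlgHom.map_cfcₙ φ f a hf.continuousOn hf0 hφ ha hφa]
    conv_rhs => rw [← cfcₙ_id ℝ (φ a)]
    refine cfcₙ_congr fun x hx => ?_
    have h1 := norm_apply_le_norm_cfcₙ (id : ℝ → ℝ) (φ a) hx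
    rw [cfcₙ_id ℝ (φ a), Real.norm_eq_abs, abs_le] at h1
    simp only [f, id_eq] at h1 ⊢
    rw [min_eq_right h1.2, max_eq_right h1.1]
  · refine norm_cfcₙ_le fun x _ => ?_
    rw [Real.norm_eq_abs, abs_le]
    exact ⟨le_max_left _ _, max_le (by linarith) (min_le_left _ _)⟩

open scoped CStarAlgebra in
theorem exists_preimage_norm_le (φ : A →⋆ₙₐ[ℂ] B) (a : A) :
    ∃ a', φ a' = φ a ∧ ‖a'‖ ≤ 2 * ‖φ a‖ := by
  have hφ : Continuous φ := map_continuous φ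
  obtain ⟨x, hx, hx'⟩ := φ.exists_preimage_norm_le_of_isSelfAdjoint (realPart a).2
  obtain ⟨y, hy, hy'⟩ := φ.exists_preimage_norm_le_of_isSelfAdjoint (imaginaryPart a).2
  have hre : φ (realPart a : A) = realPart (φ a) := by
    rw [realPart_apply_coe, realPart_apply_coe, map_real_smul φ hφ, map_add, map_star]
  have him : φ (imaginaryPart a : A) = imaginaryPart (φ a) := by
    rw [imaginaryPart_apply_coe, imaginaryPart_apply_coe, map_smul, map_real_smul φ hφ, map_sub,
      map_star]
  refine ⟨x + Complex.I • y, ?_, ?_⟩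
  · rw [map_add, map_smul, hx, hy, ← map_smul, ← map_add, realPart_add_I_smul_imaginaryPart]
  · have h1 : ‖(realPart (φ a) : B)‖ ≤ ‖φ a‖ := realPart.norm_le (φ a)
    have h2 : ‖(imaginaryPart (φ a) : B)‖ ≤ ‖φ a‖ := imaginaryPart.norm_le (φ a)
    rw [← hre] at h1
    rw [← him] at h2
    calc ‖x + Complex.I • y‖ ≤ ‖x‖ + ‖Complex.I • y‖ := norm_add_le _ _
      _ = ‖x‖ + ‖y‖ := by rw [norm_smul, Complex.norm_I, one_mul]
      _ ≤ 2 * ‖φ a‖ := by linarith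

/-- The range is complete because preimages can be chosen with controlled norm. -/
theorem isClosed_range (φ : A →⋆ₙₐ[ℂ] B) : IsClosed (Set.range φ) := by
  let f : NormedAddGroupHom A B :=
    AddMonoidHom.mkNormedAddGroupHom (φ : A →+ B) 1 fun a => by
      simpa using NonUnitalStarAlgHom.norm_apply_le φ a
  have hf : f.SurjectiveOnWith f.range 2 := by
    rintro _ ⟨a, rfl⟩
    exact φ.exists_preimage_norm_le a
  have h := (controlled_closure_of_complete two_pos one_pos hf).surjOn
  refine isClosed_of_closure_subset fun x hx => ?_
  obtain ⟨a, -, ha⟩ := h hx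
  exact ⟨a, ha⟩

end NonUnitalStarAlgHom

namespace CQG

variable {K H L M : Type*} [NormedAddCommGroup K] [InnerProductSpace ℂ K] [CompleteSpace K]
  [NormedAddCommGroup H] [InnerProductSpace ℂ H] [CompleteSpace H]
  [NormedAddCommGroup L] [InnerProductSpace ℂ L] [CompleteSpace L]
  [NormedAddCommGroup M] [InnerProductSpace ℂ M] [CompleteSpace M]
  {H' L' : Type*} [NormedAddCommGroup H'] [InnerProductSpace ℂ H'] [CompleteSpace H']
  [NormedAddCommGroup L'] [InnerProductSpace ℂ L'] [CompleteSpace L']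
  {F : Type*} [NormedAddCommGroup F] [InnerProductSpace ℂ F]
  {𝔟 𝔠 : CStarBase K}

/-! ### `*`-homomorphisms on concrete C*-algebras -/

/-- A concrete C*-algebra as a non-unital `*`-subalgebra of the bounded operators. -/
def IsCStarAlg.toStarSubalgebra {A : Submodule ℂ (H →L[ℂ] H)} (hA : IsCStarAlg A) :
    NonUnitalStarSubalgebra ℂ (H →L[ℂ] H) where
  toSubmodule := A
  mul_mem' {a b} ha hb := hA.mul_mem a ha b hb
  star_mem' {a} ha := hA.adj_mem a ha

/-- A `*`-homomorphism on a concrete C*-algebra as a bundled homomorphism. -/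
def IsStarHom.toHom {A : Submodule ℂ (H →L[ℂ] H)} (hA : IsCStarAlg A) {φ : A → (L →L[ℂ] L)}
    (hφ : IsStarHom A φ) : hA.toStarSubalgebra →⋆ₙₐ[ℂ] (L →L[ℂ] L) where
  toFun a := φ ⟨a, a.2⟩
  map_smul' c a := hφ.smul c ⟨a, a.2⟩
  map_zero' := by
    have h := hφ.smul 0 0
    rw [zero_smul, zero_smul] at h
    exact h
  map_add' a b := hφ.add ⟨a, a.2⟩ ⟨b, b.2⟩
  map_mul' a b := hφ.mul ⟨a, a.2⟩ ⟨b, b.2⟩ ⟨a * b, (a * b).2⟩ rfl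
  map_star' a := hφ.star ⟨a, a.2⟩ ⟨(a : H →L[ℂ] H)†, hA.adj_mem _ a.2⟩ rfl

theorem IsStarHom.norm_le {A : Submodule ℂ (H →L[ℂ] H)} (hA : IsCStarAlg A)
    {φ : A → (L →L[ℂ] L)} (hφ : IsStarHom A φ) (a : A) : ‖φ a‖ ≤ ‖(a : H →L[ℂ] H)‖ := by
  have : IsClosed (hA.toStarSubalgebra : Set (H →L[ℂ] H)) := hA.isClosed
  have h := NonUnitalStarAlgHom.norm_apply_le (A := hA.toStarSubalgebra) (hφ.toHom hA) ⟨a, a.2⟩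
  exact h

theorem IsStarHom.isClosed_range {A : Submodule ℂ (H →L[ℂ] H)} (hA : IsCStarAlg A)
    {φ : A → (L →L[ℂ] L)} (hφ : IsStarHom A φ) : IsClosed (Set.range φ) := by
  have : IsClosed (hA.toStarSubalgebra : Set (H →L[ℂ] H)) := hA.isClosed
  have h := NonUnitalStarAlgHom.isClosed_range (A := hA.toStarSubalgebra) (hφ.toHom hA)
  exact h

/-- A closed linear condition on `φ a`, for a `*`-homomorphism `φ`, has to be checked on a total
subset of the C*-algebra only. -/
theorem IsStarHom.mem_of_cspan {A : Submodule ℂ (H →L[ℂ] H)} (hA : IsCStarAlg A)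
    {φ : A → (L →L[ℂ] L)} (hφ : IsStarHom A φ) {S : Set (H →L[ℂ] H)} (hS : A = cspan S)
    {F : Type*} [NormedAddCommGroup F] [NormedSpace ℂ F] {N : Submodule ℂ F}
    (hN : IsClosed (N : Set F)) (f : (H →L[ℂ] H) × (L →L[ℂ] L) →L[ℂ] F)
    (h : ∀ a : A, (a : H →L[ℂ] H) ∈ S → f (a, φ a) ∈ N) (a : A) : f (a, φ a) ∈ N := by
  let φL : A →L[ℂ] (L →L[ℂ] L) :=
    LinearMap.mkContinuous { toFun := φ, map_add' := hφ.add, map_smul' := hφ.smul } 1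
      fun a => by simpa using hφ.norm_le hA a
  let g : A →L[ℂ] F := f ∘L (A.subtypeL.prod φL)
  have hSA : S ⊆ A := hS ▸ subset_cspan S
  have hle : A ≤ (N.comap g.toLinearMap).map A.subtype := by
    intro x hx
    have hsp : (Submodule.span ℂ S : Set (H →L[ℂ] H)) ⊆ (N.comap g.toLinearMap).map A.subtype := by
      refine Submodule.span_le.mpr fun s hs => ?_
      exact ⟨⟨s, hSA hs⟩, h ⟨s, hSA hs⟩ hs, rfl⟩
    have hcl : IsClosed ((N.comap g.toLinearMap).map A.subtype : Set (H →L[ℂ] H)) := by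
      have h1 : IsClosed (g ⁻¹' (N : Set F)) := hN.preimage g.continuous
      exact (hA.isClosed.isClosedEmbedding_subtypeVal.isClosedMap) _ h1
    exact closure_minimal hsp hcl (by rw [hS] at hx; exact hx)
  obtain ⟨b, hb, hba⟩ := hle a.2
  have : b = a := Subtype.ext hba
  subst this
  exact hb

/-! ### Compression of a C*-algebra by an isometry with invariant range -/

section Compression

variable {A : Submodule ℂ (H →L[ℂ] H)} {v : K →L[ℂ] H}

/-- Invariance of the range of `v` has to be checked on generators only. -/
theorem invariant_of_cspan (hv : v† ∘L v = 1) {S : Set (H →L[ℂ] H)}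
    (h : ∀ s ∈ S, ∃ y, s ∘L v = v ∘L y) {a : H →L[ℂ] H} (ha : a ∈ cspan S) :
    ∃ y, a ∘L v = v ∘L y := by
  let f : (H →L[ℂ] H) →L[ℂ] (K →L[ℂ] H) := (ContinuousLinearMap.compL ℂ K H H).flip v
  let g : (H →L[ℂ] H) →L[ℂ] (K →L[ℂ] H) :=
    f - ContinuousLinearMap.compL ℂ K H H (v ∘L v†) ∘L f
  have h1 : g a ∈ (⊥ : Submodule ℂ (K →L[ℂ] H)) := by
    refine cspan_map_mem isClosed_singleton g (fun s hs => ?_) ha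
    obtain ⟨y, hy⟩ := h s hs
    change s ∘L v - (v ∘L v†) ∘L (s ∘L v) = 0
    rw [hy, ContinuousLinearMap.comp_assoc, ← ContinuousLinearMap.comp_assoc (v†) v, hv]
    exact sub_self _
  exact ⟨v† ∘L (a ∘L v), sub_eq_zero.mp h1⟩

theorem adj_comp_of_invariant (hA : IsCStarAlg A) (hv : v† ∘L v = 1)
    (hinv : ∀ a ∈ A, ∃ y, a ∘L v = v ∘L y) {a : H →L[ℂ] H} (ha : a ∈ A) :
    a ∘L v = v ∘L (v† ∘L a ∘L v) ∧ v† ∘L a = (v† ∘L a ∘L v) ∘L v† := by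
  have key : ∀ a ∈ A, a ∘L v = v ∘L (v† ∘L a ∘L v) := by
    intro a ha
    obtain ⟨y, hy⟩ := hinv a ha
    rw [hy, ← ContinuousLinearMap.comp_assoc (v†) v y, hv]
    rfl
  refine ⟨key a ha, ?_⟩
  have := congrArg (fun T => T†) (key _ (hA.adj_mem a ha))
  simpa only [ContinuousLinearMap.adjoint_comp, ContinuousLinearMap.adjoint_adjoint,
    ContinuousLinearMap.comp_assoc] using this

/-- Compression to an invariant subspace is multiplicative. -/
theorem isStarHom_compression (hA : IsCStarAlg A) (hv : v† ∘L v = 1)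
    (hinv : ∀ a ∈ A, ∃ y, a ∘L v = v ∘L y) :
    IsStarHom A (fun a => v† ∘L (a : H →L[ℂ] H) ∘L v) where
  add a b := by ext x; simp
  smul c a := by ext x; simp
  mul a b c hc := by
    have h := (adj_comp_of_invariant hA hv hinv b.2).1
    rw [hc, ContinuousLinearMap.comp_assoc, h]
    simp only [ContinuousLinearMap.comp_assoc]
    rw [← ContinuousLinearMap.comp_assoc (v†) v, hv]
    rfl
  star a b hb := by
    rw [hb]
    simp only [ContinuousLinearMap.adjoint_comp, ContinuousLinearMap.adjoint_adjoint]
    rfl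

/-- The compression of `[S]` is the closed span of the compression of `S`; no closure is needed,
since the image of a C*-algebra is closed. -/
theorem compression_eq_cspan (hA : IsCStarAlg A) (hv : v† ∘L v = 1)
    (hinv : ∀ a ∈ A, ∃ y, a ∘L v = v ∘L y) {S : Set (H →L[ℂ] H)} (hS : A = cspan S) :
    {T | ∃ a ∈ A, T = v† ∘L a ∘L v}
      = (cspan {T | ∃ s ∈ S, T = v† ∘L s ∘L v} : Set (K →L[ℂ] K)) := by
  let f : (H →L[ℂ] H) →L[ℂ] (K →L[ℂ] K) :=
    ContinuousLinearMap.compL ℂ K H K (v†) ∘L (ContinuousLinearMap.compL ℂ K H H).flip v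
  refine Set.Subset.antisymm ?_ ?_
  · rintro _ ⟨a, ha, rfl⟩
    rw [hS] at ha
    exact cspan_map_mem (S := S) (isClosed_cspan _) f
      (fun s hs => subset_cspan {T | ∃ s ∈ S, T = v† ∘L s ∘L v} ⟨s, hs, rfl⟩) ha
  · have hcl : IsClosed ((A.map f.toLinearMap : Submodule ℂ (K →L[ℂ] K)) : Set (K →L[ℂ] K)) := by
      have h1 := (isStarHom_compression hA hv hinv).isClosed_range hA
      convert h1 using 1
      ext T
      constructor
      · rintro ⟨a, ha, h⟩; exact ⟨⟨a, ha⟩, h⟩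
      · rintro ⟨a, h⟩; exact ⟨a, a.2, h⟩
    intro T hT
    have hle : cspan {T | ∃ s ∈ S, T = v† ∘L s ∘L v} ≤ A.map f.toLinearMap := by
      refine cspan_le hcl ?_
      rintro _ ⟨s, hs, rfl⟩
      exact ⟨s, hS ▸ subset_cspan S hs, rfl⟩
    obtain ⟨a, ha, rfl⟩ := hle hT
    exact ⟨a, ha, rfl⟩

theorem compression_eqOn_cspan {w : K →L[ℂ] H} {S : Set (H →L[ℂ] H)}
    (h : ∀ s ∈ S, v† ∘L s ∘L v = w† ∘L s ∘L w) {a : H →L[ℂ] H} (ha : a ∈ cspan S) :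
    v† ∘L a ∘L v = w† ∘L a ∘L w := by
  let f (u : K →L[ℂ] H) : (H →L[ℂ] H) →L[ℂ] (K →L[ℂ] K) :=
    ContinuousLinearMap.compL ℂ K H K (u†) ∘L (ContinuousLinearMap.compL ℂ K H H).flip u
  have h1 : (f v - f w) a ∈ (⊥ : Submodule ℂ (K →L[ℂ] K)) :=
    cspan_map_mem isClosed_singleton _ (fun s hs => sub_eq_zero.mpr (h s hs)) ha
  exact sub_eq_zero.mp h1

theorem isCStarAlg_compression (hA : IsCStarAlg A) (hv : v† ∘L v = 1)
    (hinv : ∀ a ∈ A, ∃ y, a ∘L v = v ∘L y) {D : Submodule ℂ (K →L[ℂ] K)}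
    (hD : {T | ∃ a ∈ A, T = v† ∘L a ∘L v} = (D : Set (K →L[ℂ] K))) : IsCStarAlg D := by
  have hmem : ∀ T, T ∈ D ↔ ∃ a ∈ A, T = v† ∘L a ∘L v := fun T => by
    rw [← SetLike.mem_coe, ← hD]; rfl
  refine ⟨?_, ?_, ?_⟩
  · rw [← hD]
    convert (isStarHom_compression hA hv hinv).isClosed_range hA using 1
    ext T
    exact ⟨fun ⟨a, ha, h⟩ => ⟨⟨a, ha⟩, h.symm⟩, fun ⟨a, h⟩ => ⟨a, a.2, h.symm⟩⟩
  · intro x hx y hy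
    obtain ⟨a, ha, rfl⟩ := (hmem x).mp hx
    obtain ⟨b, hb, rfl⟩ := (hmem y).mp hy
    refine (hmem _).mpr ⟨a ∘L b, hA.mul_mem a ha b hb, ?_⟩
    exact ((isStarHom_compression hA hv hinv).mul ⟨a, ha⟩ ⟨b, hb⟩
      ⟨a ∘L b, hA.mul_mem a ha b hb⟩ rfl).symm
  · intro x hx
    obtain ⟨a, ha, rfl⟩ := (hmem x).mp hx
    exact (hmem _).mpr ⟨a†, hA.adj_mem a ha,
      ((isStarHom_compression hA hv hinv).star ⟨a, ha⟩ ⟨a†, hA.adj_mem a ha⟩ rfl).symm⟩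

/-- The compression by an isometry `v` is a morphism to `L(K)`; the required intertwiners
are all produced by the single operator `v*`. -/
theorem isUnitMor_compression (X : BimoduleData 𝔟 H) (hX : IsAlg₂ X.α X.β X.A)
    (hα : v ∈ X.α.carrier) (hβ : v ∈ X.β.carrier) (hv : v† ∘L v = 1)
    (hinv : ∀ a ∈ X.A, ∃ y, a ∘L v = v ∘L y) :
    X.IsUnitMor (fun a => v† ∘L (a : H →L[ℂ] H) ∘L v) := by
  have hmod : ∀ {𝔡 : CStarBase K} (γ : CMod 𝔡 H), v ∈ γ.carrier →
      opMul (intertwiners X.A (fun a => v† ∘L (a : H →L[ℂ] H) ∘L v) γ (unitMod 𝔡))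
        (γ.carrier : Set (K →L[ℂ] H)) = (unitMod 𝔡).carrier := by
    intro 𝔡 γ hγ
    refine le_antisymm (cspan_le (unitMod 𝔡).isClosed ?_) fun b hb => ?_
    · rintro _ ⟨T, hT, ξ, hξ, rfl⟩
      exact hT.1.1 ξ hξ
    · refine subset_cspan _ ⟨v†, ⟨⟨fun ξ hξ => γ.gram_mem hγ hξ, fun b hb => ?_⟩, fun a => ?_⟩,
        v ∘L b, γ.mul_mem hγ hb, ?_⟩
      · rw [ContinuousLinearMap.adjoint_adjoint]
        exact γ.mul_mem hγ hb
      · exact (adj_comp_of_invariant hX.isCStarAlg hv hinv a.2).2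
      · rw [← ContinuousLinearMap.comp_assoc, hv]; rfl
  refine ⟨isStarHom_compression hX.isCStarAlg hv hinv, fun a c _ => ⟨trivial, trivial⟩, ?_,
    hmod X.α hα, hmod X.β hβ⟩
  rw [IsNondeg, eq_top_iff]
  intro k _
  have hk : (v†) (v k) = k := congrArg (fun T => T k) hv
  rw [← hk]
  have hx : v k ∈ opApp (X.A : Set (H →L[ℂ] H)) := by rw [hX.nondeg]; trivial
  refine cspan_map_mem (isClosed_cspan _) (v†) ?_ hx
  rintro _ ⟨a, ha, e, rfl⟩
  refine subset_cspan _ ⟨_, ⟨⟨a, ha⟩, rfl⟩, (v†) e, ?_⟩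
  exact congrArg (fun T => T e) (adj_comp_of_invariant hX.isCStarAlg hv hinv ha).2

/-- The compression by an isometry is a non-zero completely positive contraction. -/
theorem isCPContraction_compression [Nontrivial K] (X : BimoduleData 𝔟 H)
    (hX : IsAlg₂ X.α X.β X.A) (hv : v† ∘L v = 1) :
    X.IsCPContraction (fun a => v† ∘L (a : H →L[ℂ] H) ∘L v) where
  add a b := by ext x; simp
  smul c a := by ext x; simp
  completelyPositive n a ha s x := by
    have := ha s fun i => v (x i)
    simpa only [ContinuousLinearMap.comp_apply, ContinuousLinearMap.adjoint_inner_right] using this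
  contraction a := by
    have h1 : ‖v‖ ≤ 1 := by
      refine v.opNorm_le_bound zero_le_one fun k => ?_
      have hk : (v†) (v k) = k := congrArg (fun T => T k) hv
      have h2 : ‖v k‖ ^ 2 = ‖k‖ ^ 2 := by
        have : ⟪v k, v k⟫_ℂ = ⟪k, k⟫_ℂ := by
          rw [← ContinuousLinearMap.adjoint_inner_right, hk]
        rw [inner_self_eq_norm_sq_to_K, inner_self_eq_norm_sq_to_K] at this
        exact_mod_cast this
      rw [(sq_eq_sq₀ (norm_nonneg _) (norm_nonneg _)).mp h2, one_mul]
    have h2 : ‖(v†)‖ ≤ 1 := by rwa [LinearIsometryEquiv.norm_map]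
    calc ‖v† ∘L (a : H →L[ℂ] H) ∘L v‖ ≤ ‖(v†)‖ * (‖(a : H →L[ℂ] H)‖ * ‖v‖) :=
          (ContinuousLinearMap.opNorm_comp_le _ _).trans
            (by gcongr; exact ContinuousLinearMap.opNorm_comp_le _ _)
      _ ≤ 1 * (‖(a : H →L[ℂ] H)‖ * 1) := by gcongr
      _ = ‖(a : H →L[ℂ] H)‖ := by ring
  nonzero := by
    by_contra! h
    obtain ⟨k, hk⟩ := exists_ne (0 : K)
    -- If `v* a* a v = 0` for all `a`, then `a v = 0` for all `a`, and
    -- non-degeneracy forces `v = 0`.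
    have h1 : ∀ a ∈ X.A, a (v k) = 0 := by
      intro a ha
      have h2 := congrArg (fun T => ⟪k, T k⟫_ℂ)
        (h ⟨a† ∘L a, hX.isCStarAlg.mul_mem _ (hX.isCStarAlg.adj_mem a ha) _ ha⟩)
      simp only [ContinuousLinearMap.comp_apply, ContinuousLinearMap.adjoint_inner_right,
        _root_.zero_apply, inner_zero_right] at h2
      exact inner_self_eq_zero.mp h2
    have h2 : v k ∈ opApp (X.A : Set (H →L[ℂ] H)) := by rw [hX.nondeg]; trivial
    have h3 : innerSL ℂ (v k) (v k) ∈ (⊥ : Submodule ℂ ℂ) := by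
      refine cspan_map_mem isClosed_singleton (innerSL ℂ (v k)) ?_ h2
      rintro _ ⟨a, ha, e, rfl⟩
      rw [innerSL_apply_apply, ← ContinuousLinearMap.adjoint_inner_left,
        h1 _ (hX.isCStarAlg.adj_mem a ha), inner_zero_left]
      exact Submodule.zero_mem _
    have h4 : v k = 0 := inner_self_eq_zero.mp h3
    have hk' : (v†) (v k) = k := congrArg (fun T => T k) hv
    rw [h4, map_zero] at hk'
    exact hk hk'.symm

end Compression

/-! ### Calculus of the operators `|ξ⟩₁` and `|η⟩₂` -/

namespace CMod

theorem hom_ext (α : CMod 𝔟 H) {S T : H →L[ℂ] F}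
    (h : ∀ ξ : α.carrier, ∀ k, S ((ξ : K →L[ℂ] H) k) = T ((ξ : K →L[ℂ] H) k)) : S = T :=
  eq_of_total α.app_total fun p => h p.1 p.2

theorem IsModMap.map_rho {α : CMod 𝔟 H} {β : CMod 𝔟 L} {T : H →L[ℂ] L} (hT : α.IsModMap β T)
    (d : 𝔟.Bop) (x : H) : T (α.rho d x) = β.rho d (T x) := by
  have : T ∘L α.rho d = β.rho d ∘L T := by
    refine α.hom_ext fun ξ k => ?_
    rw [ContinuousLinearMap.comp_apply, ContinuousLinearMap.comp_apply, rho_apply _ _ ξ.2]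
    exact (rho_apply β d (hT.1 _ ξ.2) k).symm
  exact congrArg (fun A => A x) this

theorem adjoint_rho (α : CMod 𝔟 H) (d : 𝔟.Bop) : (α.rho d)† = α.rho (star d) := by
  refine eq_of_inner_total α.app_total fun p q => ?_
  rw [ContinuousLinearMap.adjoint_inner_right]
  simp only [app, rho_apply _ _ p.1.2, rho_apply _ _ q.1.2]
  have hc : (((p.1 : K →L[ℂ] H))†) ((q.1 : K →L[ℂ] H) (((star d : 𝔟.Bop) : K →L[ℂ] K) q.2))
      = ((star d : 𝔟.Bop) : K →L[ℂ] K) ((((p.1 : K →L[ℂ] H))†) ((q.1 : K →L[ℂ] H) q.2)) :=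
    congrArg (fun A => A q.2) (𝔟.comm _ (α.gram_mem p.1.2 q.1.2) _ (star d).2)
  rw [← ContinuousLinearMap.adjoint_inner_right, ← ContinuousLinearMap.adjoint_inner_right
    (p.1 : K →L[ℂ] H), hc, ← ContinuousLinearMap.adjoint_inner_right]
  rfl

/-- An operator intertwining `ρ_α` and `ρ_β` has an adjoint intertwining `ρ_β` and `ρ_α`. -/
theorem adjoint_map_rho {α : CMod 𝔟 H} {β : CMod 𝔟 L} {T : H →L[ℂ] L}
    (hT : ∀ d x, T (α.rho d x) = β.rho d (T x)) (d : 𝔟.Bop) (y : L) :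
    (T†) (β.rho d y) = α.rho d ((T†) y) := by
  refine ext_inner_left ℂ fun x => ?_
  have h1 : α.rho d = (α.rho (star d))† := by rw [adjoint_rho, star_star]
  have h2 : β.rho d = (β.rho (star d))† := by rw [adjoint_rho, star_star]
  rw [h1, h2]
  simp only [ContinuousLinearMap.adjoint_inner_right, hT]

end CMod

namespace RT

section Ket

variable {β : CMod 𝔟 H} {γ : CMod 𝔟.op L}

theorem hom_ext_ket1 {S T : RT β γ →L[ℂ] F} (h : ∀ ξ x, S (ket1 β γ ξ x) = T (ket1 β γ ξ x)) :
    S = T :=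
  eq_of_total (tfam_total β γ) fun p => by
    rw [tfam, ← ket1_apply]; exact h _ _

theorem hom_ext_ket2 {S T : RT β γ →L[ℂ] F} (h : ∀ η x, S (ket2 β γ η x) = T (ket2 β γ η x)) :
    S = T :=
  eq_of_total (tfam_total β γ) fun p => by
    rw [tfam, ← ket2_apply]; exact h _ _

theorem hom_ext_bra1 [CompleteSpace F] {S T : F →L[ℂ] RT β γ}
    (h : ∀ ξ x, ((ket1 β γ ξ)†) (S x) = ((ket1 β γ ξ)†) (T x)) : S = T := by
  have : S† = T† := by
    refine hom_ext_ket1 fun ξ x => ext_inner_left ℂ fun y => ?_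
    simp only [ContinuousLinearMap.adjoint_inner_right]
    simp only [← ContinuousLinearMap.adjoint_inner_left, h]
  simpa using congrArg (fun A => A†) this

theorem ket1_comp (ξ : β.carrier) (η : γ.carrier) (k : K) :
    ket1 β γ ξ ((η : K →L[ℂ] L) k) = ket2 β γ η ((ξ : K →L[ℂ] H) k) := by
  rw [ket1_apply, ket2_apply]

theorem bra1_ket1_apply (ξ ξ' : β.carrier) (x : L) : ((ket1 β γ ξ)†) (ket1 β γ ξ' x)
    = γ.rho ⟨(ξ : K →L[ℂ] H)† ∘L (ξ' : K →L[ℂ] H), β.gram_mem ξ.2 ξ'.2⟩ x :=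
  congrArg (fun A => A x) (bra1_ket1 ξ ξ')

theorem bra2_ket2_apply (η η' : γ.carrier) (x : H) : ((ket2 β γ η)†) (ket2 β γ η' x)
    = β.rho ⟨(η : K →L[ℂ] L)† ∘L (η' : K →L[ℂ] L), γ.gram_mem η.2 η'.2⟩ x :=
  congrArg (fun A => A x) (bra2_ket2 η η')

theorem bra1_ket2_apply (ξ : β.carrier) (η : γ.carrier) (x : H) :
    ((ket1 β γ ξ)†) (ket2 β γ η x) = (η : K →L[ℂ] L) (((ξ : K →L[ℂ] H)†) x) := by
  have : (ket1 β γ ξ)† ∘L ket2 β γ η = (η : K →L[ℂ] L) ∘L ((ξ : K →L[ℂ] H)†) := by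
    refine β.hom_ext fun ξ' k => ?_
    rw [ContinuousLinearMap.comp_apply, ContinuousLinearMap.comp_apply, ← ket1_comp,
      bra1_ket1_apply, CMod.rho_apply _ _ η.2]
    rfl
  exact congrArg (fun A => A x) this

theorem bra2_ket1_apply (ξ : β.carrier) (η : γ.carrier) (x : L) :
    ((ket2 β γ η)†) (ket1 β γ ξ x) = (ξ : K →L[ℂ] H) (((η : K →L[ℂ] L)†) x) := by
  have : (ket2 β γ η)† ∘L ket1 β γ ξ = (ξ : K →L[ℂ] H) ∘L ((η : K →L[ℂ] L)†) := by
    refine γ.hom_ext fun η' k => ?_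
    rw [ContinuousLinearMap.comp_apply, ContinuousLinearMap.comp_apply, ket1_comp,
      bra2_ket2_apply, CMod.rho_apply _ _ ξ.2]
    rfl
  exact congrArg (fun A => A x) this

end Ket

section Map

variable {β : CMod 𝔟 H} {β' : CMod 𝔟 H'} {γ : CMod 𝔟.op L} {γ' : CMod 𝔟.op L'}

theorem map_one_ket1 (T : L →L[ℂ] L') (hT : γ.IsModMap γ' T) (ξ : β.carrier) (x : L) :
    map 1 β.isModMap_one T hT (ket1 β γ ξ x) = ket1 β γ' ξ (T x) := by
  have : map 1 β.isModMap_one T hT ∘L ket1 β γ ξ = ket1 β γ' ξ ∘L T := by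
    refine γ.hom_ext fun η k => ?_
    rw [ContinuousLinearMap.comp_apply, ContinuousLinearMap.comp_apply, ket1_apply, map_tmul,
      ← ket1_apply]
    rfl
  exact congrArg (fun A => A x) this

theorem map_one_ket2 (S : H →L[ℂ] H') (hS : β.IsModMap β' S) (η : γ.carrier) (x : H) :
    map S hS 1 γ.isModMap_one (ket2 β γ η x) = ket2 β' γ η (S x) := by
  have : map S hS 1 γ.isModMap_one ∘L ket2 β γ η = ket2 β' γ η ∘L S := by
    refine β.hom_ext fun ξ k => ?_
    rw [ContinuousLinearMap.comp_apply, ContinuousLinearMap.comp_apply, ket2_apply, map_tmul,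
      ← ket2_apply]
    rfl
  exact congrArg (fun A => A x) this

/-- `S ⊗ 1` sends `|ξ⟩₁` to `|S ξ⟩₁`. -/
theorem map_one_ket1' (S : H →L[ℂ] H') (hS : β.IsModMap β' S) (ξ : β.carrier) (x : L) :
    map S hS 1 γ.isModMap_one (ket1 β γ ξ x) = ket1 β' γ ⟨S ∘L (ξ : K →L[ℂ] H), hS.1 _ ξ.2⟩ x := by
  have : map S hS 1 γ.isModMap_one ∘L ket1 β γ ξ
      = ket1 β' γ ⟨S ∘L (ξ : K →L[ℂ] H), hS.1 _ ξ.2⟩ := by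
    refine γ.hom_ext fun η k => ?_
    rw [ContinuousLinearMap.comp_apply, ket1_apply, map_tmul, ← ket1_apply]
    rfl
  exact congrArg (fun A => A x) this

/-- `1 ⊗ T` sends `|η⟩₂` to `|T η⟩₂`. -/
theorem map_one_ket2' (T : L →L[ℂ] L') (hT : γ.IsModMap γ' T) (η : γ.carrier) (x : H) :
    map 1 β.isModMap_one T hT (ket2 β γ η x) = ket2 β γ' ⟨T ∘L (η : K →L[ℂ] L), hT.1 _ η.2⟩ x := by
  have : map 1 β.isModMap_one T hT ∘L ket2 β γ η
      = ket2 β γ' ⟨T ∘L (η : K →L[ℂ] L), hT.1 _ η.2⟩ := by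
    refine β.hom_ext fun ξ k => ?_
    rw [ContinuousLinearMap.comp_apply, ket2_apply, map_tmul, ← ket2_apply]
    rfl
  exact congrArg (fun A => A x) this

theorem bra1_map_one (T : L →L[ℂ] L') (hT : γ.IsModMap γ' T) (ξ : β.carrier) (t : RT β γ) :
    ((ket1 β γ' ξ)†) (map 1 β.isModMap_one T hT t) = T (((ket1 β γ ξ)†) t) := by
  have : (ket1 β γ' ξ)† ∘L map 1 β.isModMap_one T hT = T ∘L (ket1 β γ ξ)† := by
    refine hom_ext_ket1 fun ξ' x => ?_
    simp only [ContinuousLinearMap.comp_apply, map_one_ket1, bra1_ket1_apply, hT.map_rho]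
  exact congrArg (fun A => A t) this

theorem bra2_map_one (S : H →L[ℂ] H') (hS : β.IsModMap β' S) (η : γ.carrier) (t : RT β γ) :
    ((ket2 β' γ η)†) (map S hS 1 γ.isModMap_one t) = S (((ket2 β γ η)†) t) := by
  have : (ket2 β' γ η)† ∘L map S hS 1 γ.isModMap_one = S ∘L (ket2 β γ η)† := by
    refine hom_ext_ket2 fun η' x => ?_
    simp only [ContinuousLinearMap.comp_apply, map_one_ket2, bra2_ket2_apply, hS.map_rho]
  exact congrArg (fun A => A t) this

end Map

theorem flip_ket1 (β : CMod 𝔟 H) (γ : CMod 𝔟.op L) (ξ : β.carrier) (x : L) :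
    flip β γ (ket1 β γ ξ x) = ket2 γ β ξ x := by
  have : ((flip β γ).toContinuousLinearEquiv : RT β γ →L[ℂ] RT γ β) ∘L ket1 β γ ξ
      = ket2 γ β ξ := by
    refine γ.hom_ext fun η k => ?_
    rw [ContinuousLinearMap.comp_apply, ket1_apply, ket2_apply]
    exact flip_tmul β γ ξ k η
  exact congrArg (fun A => A x) this

section Assoc

variable (β : CMod 𝔟 H) (γ : CMod 𝔟.op L) (δ : CMod 𝔠 L) (ε : CMod 𝔠.op M)
  (hγδ : γ.Stable δ) (hδγ : δ.Stable γ)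

theorem bra1_assoc_ket2 (ξ : β.carrier) (e : ε.carrier) (y : RT β γ) :
    ((ket1 β (ltri δ ε γ hδγ) ξ)†) (assoc β γ δ ε hγδ hδγ (ket2 (rtri β γ δ hγδ) ε e y))
      = ket2 δ ε e (((ket1 β γ ξ)†) y) := by
  have : (ket1 β (ltri δ ε γ hδγ) ξ)† ∘L
      ((assoc β γ δ ε hγδ hδγ).toContinuousLinearEquiv :
        RT (rtri β γ δ hγδ) ε →L[ℂ] RT β (ltri δ ε γ hδγ)) ∘L ket2 (rtri β γ δ hγδ) ε e
      = ket2 δ ε e ∘L (ket1 β γ ξ)† := by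
    refine hom_ext_ket1 fun ξ' x => ?_
    have h := assoc_apply β γ δ ε hγδ hδγ e ξ' x
    refine (congrArg ((ket1 β (ltri δ ε γ hδγ) ξ)†) h).trans ?_
    rw [bra1_ket1_apply, ContinuousLinearMap.comp_apply, bra1_ket1_apply]
    exact rho_ltri δ ε γ hδγ _ e x
  exact congrArg (fun A => A y) this

theorem bra2_bra1_assoc (ξ : β.carrier) (e : ε.carrier) (t : RT (rtri β γ δ hγδ) ε) :
    ((ket2 δ ε e)†) (((ket1 β (ltri δ ε γ hδγ) ξ)†) (assoc β γ δ ε hγδ hδγ t))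
      = ((ket1 β γ ξ)†) (((ket2 (rtri β γ δ hγδ) ε e)†) t) := by
  refine ext_inner_left ℂ fun x => ?_
  simp only [ContinuousLinearMap.adjoint_inner_right]
  rw [← assoc_apply β γ δ ε hγδ hδγ, LinearIsometryEquiv.inner_map_map]

end Assoc

end RT

theorem CMod.adjoint_apply_rho (α : CMod 𝔟 H) (d : 𝔟.Bop) {ξ : K →L[ℂ] H} (hξ : ξ ∈ α.carrier)
    (x : H) : (ξ†) (α.rho d x) = (d : K →L[ℂ] K) ((ξ†) x) := by
  have : ξ† ∘L α.rho d = (d : K →L[ℂ] K) ∘L ξ† := by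
    refine α.hom_ext fun ξ' k => ?_
    rw [ContinuousLinearMap.comp_apply, ContinuousLinearMap.comp_apply, rho_apply _ _ ξ'.2]
    exact congrArg (fun A => A k) (𝔟.comm _ (α.gram_mem hξ ξ'.2) _ d.2)
  exact congrArg (fun A => A x) this

theorem rho_comp_rho_mem {A : Submodule ℂ (H →L[ℂ] H)} (hA : IsCStarAlg A) (γ : CMod 𝔟 H)
    (h : opMul (Set.range γ.rho) (A : Set (H →L[ℂ] H)) ≤ A) (b c : 𝔟.Bop) {a : H →L[ℂ] H}
    (ha : a ∈ A) : γ.rho b ∘L a ∘L γ.rho c ∈ A := by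
  have hl : ∀ (d : 𝔟.Bop) (x : H →L[ℂ] H), x ∈ A → γ.rho d ∘L x ∈ A := fun d x hx =>
    h (subset_cspan _ ⟨_, ⟨d, rfl⟩, x, hx, rfl⟩)
  refine hl b _ ?_
  have := hA.adj_mem _ (hl (star c) _ (hA.adj_mem a ha))
  rwa [ContinuousLinearMap.adjoint_comp, ContinuousLinearMap.adjoint_adjoint, γ.adjoint_rho,
    star_star] at this

namespace RT

variable {β : CMod 𝔟 H} {γ : CMod 𝔟.op L}

/-- The adjoint form of `|ξ⟩₁ η = |η⟩₂ ξ`. -/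
theorem adjoint_bra1 (ξ : β.carrier) (η : γ.carrier) (t : RT β γ) :
    ((η : K →L[ℂ] L)†) (((ket1 β γ ξ)†) t) = ((ξ : K →L[ℂ] H)†) (((ket2 β γ η)†) t) := by
  refine ext_inner_left ℂ fun k => ?_
  simp only [ContinuousLinearMap.adjoint_inner_right, ket1_comp]

theorem bra1_ket1_self {ξ : β.carrier} (h : (ξ : K →L[ℂ] H)† ∘L (ξ : K →L[ℂ] H) = 1) (x : L) :
    ((ket1 β γ ξ)†) (ket1 β γ ξ x) = x := by
  rw [bra1_ket1_apply]
  have h1 : (⟨_, β.gram_mem ξ.2 ξ.2⟩ : 𝔟.B) = 1 := Subtype.ext h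
  rw [h1]
  exact congrArg (fun A => A x) γ.rho_one

theorem bra2_ket2_self {η : γ.carrier} (h : (η : K →L[ℂ] L)† ∘L (η : K →L[ℂ] L) = 1) (x : H) :
    ((ket2 β γ η)†) (ket2 β γ η x) = x := by
  rw [bra2_ket2_apply]
  have h1 : (⟨_, γ.gram_mem η.2 η.2⟩ : 𝔟.Bop) = 1 := Subtype.ext h
  rw [h1]
  exact congrArg (fun A => A x) β.rho_one

end RT

/-! ### The pentagon equation in slices -/

namespace PreCPMU

variable (W : PreCPMU 𝔟 H)

theorem adjoint_op_op (x : W.Src) : (W.op†) (W.op x) = x := by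
  refine ext_inner_left ℂ fun y => ?_
  rw [ContinuousLinearMap.adjoint_inner_right]
  exact W.V.inner_map_map y x

theorem op_adjoint_op (x : W.Rng) : W.op ((W.op†) x) = x := by
  obtain ⟨y, rfl⟩ : ∃ y, W.op y = x := W.V.surjective x
  rw [adjoint_op_op]

theorem pentagonMid_ket1_ket1 (ξ : W.βh.carrier) (z : W.α.carrier) (x : H) :
    W.pentagonMid (RT.ket1 W.βh W.rngαα ξ (RT.ket1 W.α W.β z x))
      = RT.flip23 W.α W.βh W.β W.α W.α_βh W.βh_α
          (RT.ket2 W.rngβhβ W.α z (W.op (RT.ket1 W.βh W.α ξ x))) := by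
  have h1 := RT.map_one_ket1 (β := W.βh) (γ := W.rngαα) (γ' := W.flipαα)
    ((RT.flip W.α W.β).toContinuousLinearEquiv : RT W.α W.β →L[ℂ] RT W.β W.α)
    (isModMap_flip W.α W.β W.α W.β_α) ξ (RT.ket1 W.α W.β z x)
  have h2 : ((RT.flip W.α W.β).toContinuousLinearEquiv : RT W.α W.β →L[ℂ] RT W.β W.α)
      (RT.ket1 W.α W.β z x) = RT.ket2 W.β W.α z x := RT.flip_ket1 W.α W.β z x
  have h3 : (RT.assoc W.βh W.α W.β W.α W.α_β W.β_α).symm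
      (RT.ket1 W.βh W.flipαα ξ (RT.ket2 W.β W.α z x))
      = RT.ket2 W.srcβhβ W.α z (RT.ket1 W.βh W.α ξ x) := by
    rw [LinearIsometryEquiv.symm_apply_eq, RT.assoc_apply]
  have h4 := RT.map_one_ket2 (β := W.srcβhβ) (β' := W.rngβhβ) (γ := W.α) W.op W.mod₂ z
    (RT.ket1 W.βh W.α ξ x)
  rw [h2] at h1
  simp only [pentagonMid, ContinuousLinearMap.comp_apply]
  rw [h1, ← h4]
  exact congrArg (fun y => RT.flip23 W.α W.βh W.β W.α W.α_βh W.βh_α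
    (RT.map W.op W.mod₂ 1 W.α.isModMap_one y)) h3

theorem bra1_pentagonUpper (z : W.α.carrier) (ζ : W.α.carrier) (t : W.Src) :
    ((RT.ket1 W.α W.rngββ z)†) (W.pentagonUpper (RT.ket2 W.srcβhβh W.α ζ t))
      = W.op (RT.ket2 W.βh W.α ζ (((RT.ket1 W.α W.β z)†) (W.op t))) := by
  have h1 := RT.map_one_ket2 (β := W.srcβhβh) (β' := W.rngαβh) (γ := W.α) W.op W.mod₃ ζ t
  simp only [pentagonUpper, ContinuousLinearMap.comp_apply]
  rw [h1, RT.bra1_map_one]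
  exact congrArg W.op (RT.bra1_assoc_ket2 W.α W.β W.βh W.α W.β_βh W.βh_β z ζ (W.op t))

/-- The lower path with its first two factors evaluated on an elementary vector. -/
theorem pentagonLower_ket (ζ : W.α.carrier) (ξ : W.βh.carrier) (x : H) :
    W.pentagonLower (RT.ket2 W.srcβhβh W.α ζ (RT.ket1 W.βh W.α ξ x))
      = RT.assoc W.α W.β W.α W.β W.β_α W.α_β (RT.map (β := W.srcαα) (β' := W.rngαα) W.op W.mod₁
          1 W.β.isModMap_one (W.pentagonMid (RT.ket1 W.βh W.rngαα ξ
            (W.op (RT.ket2 W.βh W.α ζ x))))) := by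
  have h1 := RT.map_one_ket1 (β := W.βh) (γ := W.srcαα) (γ' := W.rngαα) W.op W.mod₁ ξ
    (RT.ket2 W.βh W.α ζ x)
  have h2 := RT.assoc_apply W.βh W.α W.βh W.α W.α_βh W.βh_α ζ ξ x
  rw [← h1, ← h2]
  rfl

end PreCPMU

namespace CPMU

variable (W : CPMU 𝔟 H)

theorem slice2_mem_Ahat (η : W.β.carrier) (ζ : W.α.carrier) : W.slice2 η ζ ∈ W.Ahat :=
  subset_cspan _ ⟨η, ζ, rfl⟩

theorem slice1_mem_A (ζ : W.α.carrier) (ξ : W.βh.carrier) : W.slice1 ζ ξ ∈ W.A :=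
  subset_cspan _ ⟨ζ, ξ, rfl⟩

/-- The relation `V₁₂* V₂₃ V₁₂ = V₁₃ V₂₃`, sliced in the third leg: it expresses `Δ̂_V` on the
generators of `Â(V)`. The operator `Φ` is `⟨η|₃ V₁₃ |ξ⟩₁`. -/
theorem exists_Dhat_slice (η : W.β.carrier) (ξ : W.βh.carrier) :
    ∃ Φ : W.Rng →L[ℂ] W.Src,
      (∀ z x, Φ (RT.ket1 W.α W.β z x) = RT.ket2 W.βh W.α z
        (((RT.ket2 W.α W.β η)†) (W.op (RT.ket1 W.βh W.α ξ x)))) ∧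
      ∀ ζ x, W.Dhat ⟨W.slice2 η ζ, W.slice2_mem_Ahat η ζ⟩ (RT.ket1 W.βh W.α ξ x)
        = Φ (W.op (RT.ket2 W.βh W.α ζ x)) := by
  refine ⟨(RT.ket2 W.srcαα W.β η)† ∘L W.pentagonMid ∘L RT.ket1 W.βh W.rngαα ξ, ?_, ?_⟩
  · intro z x
    have : (RT.ket2 W.srcαα W.β η)† ∘L
        ((RT.flip23 W.α W.βh W.β W.α W.α_βh W.βh_α).toContinuousLinearEquiv :
          RT W.rngβhβ W.α →L[ℂ] RT W.srcαα W.β) ∘L RT.ket2 W.rngβhβ W.α z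
        = RT.ket2 W.βh W.α z ∘L (RT.ket2 W.α W.β η)† := by
      refine RT.hom_ext_ket2 fun g y => ?_
      have h := RT.flip23_apply W.α W.βh W.β W.α W.α_βh W.βh_α z g y
      refine (congrArg ((RT.ket2 W.srcαα W.β η)†) h).trans ?_
      rw [RT.bra2_ket2_apply, ContinuousLinearMap.comp_apply, RT.bra2_ket2_apply]
      exact RT.rho_ltri W.βh W.α W.α W.βh_α _ z y
    simp only [ContinuousLinearMap.comp_apply]
    rw [W.pentagonMid_ket1_ket1]
    exact congrArg (fun A => A (W.op (RT.ket1 W.βh W.α ξ x))) this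
  · intro ζ x
    have h1 : RT.map (β := W.α) (β' := W.α) (γ := W.β) (γ' := W.β) 1 W.α.isModMap_one
          (W.slice2 η ζ) (W.isModMap_slice2 η ζ) ∘L W.op ∘L RT.ket1 W.βh W.α ξ
        = W.op ∘L ((RT.ket2 W.srcαα W.β η)† ∘L W.pentagonMid ∘L RT.ket1 W.βh W.rngαα ξ) ∘L
          W.op ∘L RT.ket2 W.βh W.α ζ := by
      refine RT.hom_ext_bra1 fun z y => ?_
      have h2 := W.bra1_pentagonUpper z ζ (RT.ket1 W.βh W.α ξ y)
      rw [W.pentagon, W.pentagonLower_ket] at h2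
      have h3 := congrArg ((RT.ket2 W.α W.β η)†) h2
      rw [RT.bra2_bra1_assoc, RT.bra2_map_one] at h3
      simp only [ContinuousLinearMap.comp_apply]
      rw [h3, RT.bra1_map_one]
      rfl
    have h2 := congrArg (fun A => (W.op†) (A x)) h1
    simp only [ContinuousLinearMap.comp_apply, PreCPMU.adjoint_op_op] at h2
    exact h2

/-- The relation `V₂₃ V₁₂ V₂₃* = V₁₂ V₁₃`, sliced in the first leg: it expresses `Δ_V` on the
generators of `A(V)`. The operator `Θ` is `⟨ζ|₁ V₁₂ |z⟩₂`. -/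
theorem exists_D_slice (ζ z : W.α.carrier) :
    ∃ Θ : W.Rng →L[ℂ] W.Rng,
      (∀ g y, Θ (RT.ket2 W.α W.β g y) = RT.ket2 W.α W.β g
        (((RT.ket1 W.α W.β ζ)†) (W.op (RT.ket2 W.βh W.α z y)))) ∧
      ∀ ξ x, W.D ⟨W.slice1 ζ ξ, W.slice1_mem_A ζ ξ⟩ (RT.ket1 W.α W.β z x)
        = Θ (W.op (RT.ket1 W.βh W.α ξ x)) := by
  let Ψ : RT W.srcαα W.β →L[ℂ] W.Rng := (RT.ket1 W.α W.rngββ ζ)† ∘L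
    ((RT.assoc W.α W.β W.α W.β W.β_α W.α_β).toContinuousLinearEquiv :
      RT W.rngαα W.β →L[ℂ] RT W.α W.rngββ) ∘L
    RT.map (β := W.srcαα) (β' := W.rngαα) (γ := W.β) (γ' := W.β) W.op W.mod₁ 1 W.β.isModMap_one
  refine ⟨Ψ ∘L ((RT.flip23 W.α W.βh W.β W.α W.α_βh W.βh_α).toContinuousLinearEquiv :
    RT W.rngβhβ W.α →L[ℂ] RT W.srcαα W.β) ∘L RT.ket2 W.rngβhβ W.α z, ?_, ?_⟩
  · intro g y
    have h1 := RT.flip23_apply W.α W.βh W.β W.α W.α_βh W.βh_α z g y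
    have h2 := RT.map_one_ket2 (β := W.srcαα) (β' := W.rngαα) (γ := W.β) W.op W.mod₁ g
      (RT.ket2 W.βh W.α z y)
    have h3 := RT.bra1_assoc_ket2 W.α W.β W.α W.β W.β_α W.α_β ζ g (W.op (RT.ket2 W.βh W.α z y))
    rw [← h3, ← h2, ← h1]
    rfl
  · intro ξ x
    have h1 : W.op ∘L RT.map (β := W.βh) (β' := W.βh) (γ := W.α) (γ' := W.α) (W.slice1 ζ ξ)
          (W.isModMap_slice1 ζ ξ) 1 W.α.isModMap_one
        = Ψ ∘L W.pentagonMid ∘L RT.ket1 W.βh W.rngαα ξ ∘L W.op := by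
      refine RT.hom_ext_ket2 fun e y => ?_
      have h2 := W.bra1_pentagonUpper ζ e (RT.ket1 W.βh W.α ξ y)
      rw [W.pentagon, W.pentagonLower_ket] at h2
      rw [ContinuousLinearMap.comp_apply, RT.map_one_ket2]
      exact h2.symm
    have h2 := congrArg (fun A => A ((W.op†) (RT.ket1 W.α W.β z x))) h1
    simp only [ContinuousLinearMap.comp_apply, PreCPMU.op_adjoint_op] at h2
    rw [W.pentagonMid_ket1_ket1] at h2
    exact h2

end CPMU

/-! ### Slices of the comultiplications -/

namespace BimoduleData

variable {X : BimoduleData 𝔟 H}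

/-- A slice of `Δ(a)` lies in the C*-algebra as soon as this holds for generators `a`. -/
theorem IsHopf.slice_mem (hX : X.IsHopf) {S : Set (H →L[ℂ] H)} (hS : X.A = cspan S)
    (P : RT X.α X.β →L[ℂ] H) (Q : H →L[ℂ] RT X.α X.β)
    (h : ∀ a : X.A, (a : H →L[ℂ] H) ∈ S → P ∘L X.Δ a ∘L Q ∈ X.A) (a : X.A) :
    P ∘L X.Δ a ∘L Q ∈ X.A :=
  hX.isMor.isStarHom.mem_of_cspan hX.isAlg.isCStarAlg hS hX.isAlg.isCStarAlg.isClosed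
    (ContinuousLinearMap.compL ℂ H (RT X.α X.β) H P ∘L
      (ContinuousLinearMap.compL ℂ H (RT X.α X.β) (RT X.α X.β)).flip Q ∘L
      ContinuousLinearMap.snd ℂ _ _) h a

/-- An operator intertwines `A` and `Δ(A)` as soon as this holds on generators. -/
theorem IsHopf.comp_eq (hX : X.IsHopf) {S : Set (H →L[ℂ] H)} (hS : X.A = cspan S)
    (Q : H →L[ℂ] RT X.α X.β)
    (h : ∀ a : X.A, (a : H →L[ℂ] H) ∈ S → X.Δ a ∘L Q = Q ∘L (a : H →L[ℂ] H)) (a : X.A) :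
    X.Δ a ∘L Q = Q ∘L (a : H →L[ℂ] H) :=
  sub_eq_zero.mp <| hX.isMor.isStarHom.mem_of_cspan hX.isAlg.isCStarAlg hS
    (N := (⊥ : Submodule ℂ (H →L[ℂ] RT X.α X.β))) isClosed_singleton
    ((ContinuousLinearMap.compL ℂ H (RT X.α X.β) (RT X.α X.β)).flip Q ∘L
        ContinuousLinearMap.snd ℂ _ _ -
      ContinuousLinearMap.compL ℂ H H (RT X.α X.β) Q ∘L ContinuousLinearMap.fst ℂ _ _)
    (fun a ha => sub_eq_zero.mpr (h a ha)) a

end BimoduleData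

namespace CPMU

variable (W : CPMU 𝔟 H)

theorem slice2_apply (η : W.β.carrier) (ζ : W.α.carrier) (x : H) :
    W.slice2 η ζ x = ((RT.ket2 W.α W.β η)†) (W.op (RT.ket2 W.βh W.α ζ x)) := rfl

theorem slice1_apply (ζ : W.α.carrier) (ξ : W.βh.carrier) (x : H) :
    W.slice1 ζ ξ x = ((RT.ket1 W.α W.β ζ)†) (W.op (RT.ket1 W.βh W.α ξ x)) := rfl

/-- `⟨ξ|₁ Δ̂_V(⟨η|₂ V |ζ⟩₂) |ξ'⟩₁ = ⟨θ|₂ V |ζ⟩₂` for `θ = ⟨ξ'|₁ V* |η⟩₂ ξ`, which lies in `β`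
since `V` maps `β̂ ▷ β` onto `β̂ ◁ β`. -/
theorem slice1_Dhat_slice2_mem (η : W.β.carrier) (ζ : W.α.carrier) (ξ ξ' : W.βh.carrier) :
    (RT.ket1 W.βh W.α ξ)† ∘L W.Dhat ⟨W.slice2 η ζ, W.slice2_mem_Ahat η ζ⟩ ∘L RT.ket1 W.βh W.α ξ'
      ∈ W.Ahat := by
  obtain ⟨Φ, hΦ, hD⟩ := W.exists_Dhat_slice η ξ'
  have hθ : (RT.ket1 W.βh W.α ξ')† ∘L ((W.op†) ∘L (RT.ket2 W.α W.β η ∘L (ξ : K →L[ℂ] H)))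
      ∈ W.β.carrier :=
    RT.bra1_mem_rtri W.βh W.α W.β W.α_β ξ' (W.mod₂.2 _ (subset_cspan _ ⟨η, ξ, ξ.2, rfl⟩))
  have h1 : (RT.ket1 W.βh W.α ξ)† ∘L Φ = (RT.ket2 W.α W.β ⟨_, hθ⟩)† := by
    refine RT.hom_ext_ket1 fun z x => ?_
    rw [ContinuousLinearMap.comp_apply, hΦ, RT.bra1_ket2_apply, RT.bra2_ket1_apply]
    simp only [ContinuousLinearMap.adjoint_comp, ContinuousLinearMap.adjoint_adjoint,
      ContinuousLinearMap.comp_apply]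
  have h2 : (RT.ket1 W.βh W.α ξ)† ∘L W.Dhat ⟨W.slice2 η ζ, W.slice2_mem_Ahat η ζ⟩ ∘L
      RT.ket1 W.βh W.α ξ' = W.slice2 ⟨_, hθ⟩ ζ := by
    refine ContinuousLinearMap.ext fun x => ?_
    rw [slice2_apply, ← h1]
    simp only [ContinuousLinearMap.comp_apply, hD]
  rw [h2]
  exact W.slice2_mem_Ahat _ _

/-- `⟨z|₂ Δ̂_V(⟨η|₂ V |ζ⟩₂) |z'⟩₂ = ⟨η|₂ V |θ⟩₂` for `θ = ⟨z|₁ V |ζ⟩₂ z'`, which lies in `α`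
since `V` maps `α ◁ α` onto `α ▷ α`. -/
theorem slice2_Dhat_slice2_mem (η : W.β.carrier) (ζ z z' : W.α.carrier) :
    (RT.ket2 W.βh W.α z)† ∘L W.Dhat ⟨W.slice2 η ζ, W.slice2_mem_Ahat η ζ⟩ ∘L RT.ket2 W.βh W.α z'
      ∈ W.Ahat := by
  have hθ : (RT.ket1 W.α W.β z)† ∘L (W.op ∘L (RT.ket2 W.βh W.α ζ ∘L (z' : K →L[ℂ] H)))
      ∈ W.α.carrier :=
    RT.bra1_mem_rtri W.α W.β W.α W.β_α z (W.mod₁.1 _ (subset_cspan _ ⟨ζ, z', z'.2, rfl⟩))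
  have h2 : (RT.ket2 W.βh W.α z)† ∘L W.Dhat ⟨W.slice2 η ζ, W.slice2_mem_Ahat η ζ⟩ ∘L
      RT.ket2 W.βh W.α z' = W.slice2 η ⟨_, hθ⟩ := by
    refine W.βh.hom_ext fun ξ k => ?_
    obtain ⟨Φ, hΦ, hD⟩ := W.exists_Dhat_slice η ξ
    have h1 : (RT.ket2 W.βh W.α z)† ∘L Φ = (RT.ket2 W.α W.β η)† ∘L W.op ∘L
        RT.ket1 W.βh W.α ξ ∘L (RT.ket1 W.α W.β z)† := by
      refine RT.hom_ext_ket1 fun z' x => ?_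
      simp only [ContinuousLinearMap.comp_apply, hΦ, RT.bra2_ket2_apply, RT.bra1_ket1_apply]
      rw [← RT.rho_rtri W.βh W.α W.β W.α_β, W.mod₂.map_rho]
      exact (CMod.adjoint_map_rho (fun d x => (RT.rho_ltri W.α W.β W.βh W.α_βh d η x).symm) _
        _).symm
    have h3 := congrArg (fun A => A (W.op (RT.ket2 W.βh W.α ζ ((z' : K →L[ℂ] H) k)))) h1
    simp only [ContinuousLinearMap.comp_apply] at h3
    rw [slice2_apply, ← RT.ket1_comp]
    simp only [ContinuousLinearMap.comp_apply]
    rw [← RT.ket1_comp, hD, h3]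
  rw [h2]
  exact W.slice2_mem_Ahat _ _

/-- `⟨z|₁ Δ_V(⟨ζ|₁ V |ξ⟩₁) |z'⟩₁ = ⟨θ|₁ V |ξ⟩₁` for `θ = ⟨z'|₂ V* |ζ⟩₁ z`, which lies in `α`
since `V` maps `α ◁ α` onto `α ▷ α`. -/
theorem slice1_D_slice1_mem (ζ : W.α.carrier) (ξ : W.βh.carrier) (z z' : W.α.carrier) :
    (RT.ket1 W.α W.β z)† ∘L W.D ⟨W.slice1 ζ ξ, W.slice1_mem_A ζ ξ⟩ ∘L RT.ket1 W.α W.β z'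
      ∈ W.A := by
  obtain ⟨Θ, hΘ, hD⟩ := W.exists_D_slice ζ z'
  have hθ : (RT.ket2 W.βh W.α z')† ∘L ((W.op†) ∘L (RT.ket1 W.α W.β ζ ∘L (z : K →L[ℂ] H)))
      ∈ W.α.carrier :=
    RT.bra2_mem_ltri W.βh W.α W.α W.βh_α z' (W.mod₁.2 _ (subset_cspan _ ⟨ζ, z, z.2, rfl⟩))
  have h1 : (RT.ket1 W.α W.β z)† ∘L Θ = (RT.ket1 W.α W.β ⟨_, hθ⟩)† := by
    refine RT.hom_ext_ket2 fun g y => ?_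
    rw [ContinuousLinearMap.comp_apply, hΘ, RT.bra1_ket2_apply, RT.bra1_ket2_apply]
    simp only [ContinuousLinearMap.adjoint_comp, ContinuousLinearMap.adjoint_adjoint,
      ContinuousLinearMap.comp_apply]
  have h2 : (RT.ket1 W.α W.β z)† ∘L W.D ⟨W.slice1 ζ ξ, W.slice1_mem_A ζ ξ⟩ ∘L
      RT.ket1 W.α W.β z' = W.slice1 ⟨_, hθ⟩ ξ := by
    refine ContinuousLinearMap.ext fun x => ?_
    rw [slice1_apply, ← h1]
    simp only [ContinuousLinearMap.comp_apply, hD]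
  rw [h2]
  exact W.slice1_mem_A _ _

/-- `⟨g|₂ Δ_V(⟨ζ|₁ V |ξ⟩₁) |g'⟩₂ = ⟨ζ|₁ V |θ⟩₁` for `θ = ⟨g|₂ V |ξ⟩₁ g'`, which lies in `β̂`
since `V` maps `β̂ ▷ β` onto `β̂ ◁ β`. -/
theorem slice2_D_slice1_mem (ζ : W.α.carrier) (ξ : W.βh.carrier) (g g' : W.β.carrier) :
    (RT.ket2 W.α W.β g)† ∘L W.D ⟨W.slice1 ζ ξ, W.slice1_mem_A ζ ξ⟩ ∘L RT.ket2 W.α W.β g'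
      ∈ W.A := by
  have hθ : (RT.ket2 W.α W.β g)† ∘L (W.op ∘L (RT.ket1 W.βh W.α ξ ∘L (g' : K →L[ℂ] H)))
      ∈ W.βh.carrier :=
    RT.bra2_mem_ltri W.α W.β W.βh W.α_βh g (W.mod₂.1 _ (subset_cspan _ ⟨ξ, g', g'.2, rfl⟩))
  have h2 : (RT.ket2 W.α W.β g)† ∘L W.D ⟨W.slice1 ζ ξ, W.slice1_mem_A ζ ξ⟩ ∘L
      RT.ket2 W.α W.β g' = W.slice1 ζ ⟨_, hθ⟩ := by
    refine W.α.hom_ext fun z k => ?_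
    obtain ⟨Θ, hΘ, hD⟩ := W.exists_D_slice ζ z
    have h1 : (RT.ket2 W.α W.β g)† ∘L Θ = (RT.ket1 W.α W.β ζ)† ∘L W.op ∘L
        RT.ket2 W.βh W.α z ∘L (RT.ket2 W.α W.β g)† := by
      refine RT.hom_ext_ket2 fun g' y => ?_
      simp only [ContinuousLinearMap.comp_apply, hΘ, RT.bra2_ket2_apply]
      rw [← RT.rho_ltri W.βh W.α W.α W.βh_α, W.mod₁.map_rho]
      exact (CMod.adjoint_map_rho (fun d x => (RT.rho_rtri W.α W.β W.α W.β_α d ζ x).symm) _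
        _).symm
    have h3 := congrArg (fun A => A (W.op (RT.ket1 W.βh W.α ξ ((g' : K →L[ℂ] H) k)))) h1
    simp only [ContinuousLinearMap.comp_apply] at h3
    rw [slice1_apply, RT.ket1_comp]
    simp only [ContinuousLinearMap.comp_apply]
    rw [← RT.ket1_comp, hD, h3]
  rw [h2]
  exact W.slice1_mem_A _ _

/-! ### Fixed elements -/

section Fix

variable {W} {η₀ : K →L[ℂ] H}

theorem adjoint_op_ket1_of_fix {h : η₀ ∈ W.βh.carrier} {h' : η₀ ∈ W.α.carrier}
    (hη : W.op ∘L RT.ket1 W.βh W.α ⟨η₀, h⟩ = RT.ket1 W.α W.β ⟨η₀, h'⟩) (x : H) :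
    (W.op†) (RT.ket1 W.α W.β ⟨η₀, h'⟩ x) = RT.ket1 W.βh W.α ⟨η₀, h⟩ x := by
  rw [← hη, ContinuousLinearMap.comp_apply, W.adjoint_op_op]

theorem bra1_op_of_fix {h : η₀ ∈ W.βh.carrier} {h' : η₀ ∈ W.α.carrier}
    (hη : W.op ∘L RT.ket1 W.βh W.α ⟨η₀, h⟩ = RT.ket1 W.α W.β ⟨η₀, h'⟩) (t : W.Src) :
    ((RT.ket1 W.α W.β ⟨η₀, h'⟩)†) (W.op t) = ((RT.ket1 W.βh W.α ⟨η₀, h⟩)†) t := by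
  refine ext_inner_left ℂ fun x => ?_
  simp only [ContinuousLinearMap.adjoint_inner_right]
  rw [← adjoint_op_ket1_of_fix hη, ContinuousLinearMap.adjoint_inner_left]

/-- On the range of a fixed element, `⟨η|₂ V |ζ⟩₂` acts through `η* ζ`. -/
theorem slice2_comp_of_mem_fix (hη₀ : η₀ ∈ W.Fix) (η : W.β.carrier) (ζ : W.α.carrier) :
    W.slice2 η ζ ∘L η₀ = η₀ ∘L ((η : K →L[ℂ] H)† ∘L (ζ : K →L[ℂ] H)) := by
  obtain ⟨h, h', hη⟩ := hη₀
  refine ContinuousLinearMap.ext fun k => ?_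
  rw [ContinuousLinearMap.comp_apply, slice2_apply,
    ← RT.ket1_comp (⟨η₀, h⟩ : W.βh.carrier) ζ k, ← ContinuousLinearMap.comp_apply W.op, hη,
    RT.bra2_ket1_apply]
  rfl

theorem invariant_of_mem_fix (hη₀ : η₀ ∈ W.Fix) (h1 : η₀† ∘L η₀ = 1) :
    ∀ a ∈ W.Ahat, ∃ y, a ∘L η₀ = η₀ ∘L y := fun a ha => by
  refine invariant_of_cspan h1 ?_ ha
  rintro _ ⟨η, ζ, rfl⟩
  exact ⟨_, slice2_comp_of_mem_fix hη₀ η ζ⟩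

theorem counit_slice2 (hη₀ : η₀ ∈ W.Fix) (h1 : η₀† ∘L η₀ = 1) (η : W.β.carrier)
    (ζ : W.α.carrier) :
    η₀† ∘L W.slice2 η ζ ∘L η₀ = (η : K →L[ℂ] H)† ∘L (ζ : K →L[ℂ] H) := by
  rw [slice2_comp_of_mem_fix hη₀, ← ContinuousLinearMap.comp_assoc (η₀†) η₀, h1]
  rfl

theorem compression_Ahat_of_mem_fix (hA : IsCStarAlg W.Ahat) (hη₀ : η₀ ∈ W.Fix)
    (h1 : η₀† ∘L η₀ = 1) :
    {T | ∃ a ∈ W.Ahat, T = η₀† ∘L a ∘L η₀}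
      = (opMul (opAdj (W.β.carrier : Set (K →L[ℂ] H))) (W.α.carrier : Set (K →L[ℂ] H)) :
        Set (K →L[ℂ] K)) := by
  rw [compression_eq_cspan hA h1 (invariant_of_mem_fix hη₀ h1)
    (S := {T | ∃ η ξ, T = W.slice2 η ξ}) rfl, opMul]
  congr 2
  ext T
  constructor
  · rintro ⟨_, ⟨η, ξ, rfl⟩, rfl⟩
    exact ⟨_, ⟨η, η.2, rfl⟩, ξ, ξ.2, counit_slice2 hη₀ h1 η ξ⟩
  · rintro ⟨_, ⟨η, hη, rfl⟩, ξ, hξ, rfl⟩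
    exact ⟨_, ⟨⟨η, hη⟩, ⟨ξ, hξ⟩, rfl⟩, (counit_slice2 hη₀ h1 ⟨η, hη⟩ ⟨ξ, hξ⟩).symm⟩

theorem compression_eq_of_mem_fix {η₁ : K →L[ℂ] H} (hη₀ : η₀ ∈ W.Fix) (h1 : η₀† ∘L η₀ = 1)
    (hη₁ : η₁ ∈ W.Fix) (h1' : η₁† ∘L η₁ = 1) {a : H →L[ℂ] H} (ha : a ∈ W.Ahat) :
    η₁† ∘L a ∘L η₁ = η₀† ∘L a ∘L η₀ := by
  refine compression_eqOn_cspan (S := {T | ∃ η ξ, T = W.slice2 η ξ}) ?_ ha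
  rintro _ ⟨η, ξ, rfl⟩
  rw [counit_slice2 hη₀ h1, counit_slice2 hη₁ h1']

theorem isLeftCounit_of_mem_fix (hW : W.hatLeg.IsHopf) (hη₀ : η₀ ∈ W.Fix)
    (h1 : η₀† ∘L η₀ = 1) :
    W.hatLeg.IsLeftCounit (fun a => η₀† ∘L (a : H →L[ℂ] H) ∘L η₀) := by
  refine ⟨isUnitMor_compression W.hatLeg hW.isAlg hη₀.1 hη₀.2.1 h1
    (invariant_of_mem_fix hη₀ h1), fun (a : W.Ahat) (η η' : W.α.carrier) => ⟨?_, ?_⟩⟩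
  · refine hW.slice_mem (S := {T | ∃ η ξ, T = W.slice2 η ξ}) rfl _ _ ?_ a
    rintro ⟨_, _⟩ ⟨g, ζ, rfl⟩
    exact W.slice2_Dhat_slice2_mem g ζ η η'
  · obtain ⟨h, h', hη⟩ := hη₀
    refine ContinuousLinearMap.ext fun k => ?_
    change (η₀†) (((RT.ket2 W.βh W.α η)†) ((W.op†) (RT.map 1 W.α.isModMap_one
      (a : H →L[ℂ] H) (W.isModMap_Ahat a.2) (W.op (RT.ket2 W.βh W.α η' (η₀ k)))))) = _
    -- Both outer slices become slices by `η₀` in the first leg, which `V` does not affect.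
    rw [← RT.ket1_comp (⟨η₀, h⟩ : W.βh.carrier) η' k, ← ContinuousLinearMap.comp_apply W.op, hη,
      RT.map_one_ket1, adjoint_op_ket1_of_fix hη,
      ← RT.adjoint_bra1 (⟨η₀, h⟩ : W.βh.carrier) η,
      RT.bra1_ket1_self (ξ := (⟨η₀, h⟩ : W.βh.carrier)) h1]
    rfl

/-- `Δ̂_V(a) |η₀⟩₂ = |η₀⟩₂ a` for a fixed element `η₀`. -/
theorem Dhat_comp_ket2_of_fix (hW : W.hatLeg.IsHopf) {h : η₀ ∈ W.βh.carrier}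
    {h' : η₀ ∈ W.α.carrier}
    (hη : W.op ∘L RT.ket1 W.βh W.α ⟨η₀, h⟩ = RT.ket1 W.α W.β ⟨η₀, h'⟩) (a : W.Ahat) :
    W.Dhat a ∘L RT.ket2 W.βh W.α ⟨η₀, h'⟩ = RT.ket2 W.βh W.α ⟨η₀, h'⟩ ∘L (a : H →L[ℂ] H) := by
  refine hW.comp_eq (S := {T | ∃ η ξ, T = W.slice2 η ξ}) rfl (RT.ket2 W.βh W.α ⟨η₀, h'⟩) ?_ a
  rintro ⟨_, _⟩ ⟨g, ζ, rfl⟩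
  refine W.βh.hom_ext fun ξ k => ?_
  obtain ⟨Φ, hΦ, hD⟩ := W.exists_Dhat_slice g ξ
  have e1 := hD ζ (η₀ k)
  rw [← RT.ket1_comp (⟨η₀, h⟩ : W.βh.carrier) ζ k, ← ContinuousLinearMap.comp_apply W.op, hη, hΦ,
    RT.ket1_comp ξ ζ k, RT.ket1_comp ξ ⟨η₀, h'⟩ k] at e1
  exact e1

theorem isCounit_of_mem_fix (hW : W.hatLeg.IsHopf) (hη₀ : η₀ ∈ W.Fix) (h1 : η₀† ∘L η₀ = 1) :
    W.hatLeg.IsCounit (fun a => η₀† ∘L (a : H →L[ℂ] H) ∘L η₀) := by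
  have hl := isLeftCounit_of_mem_fix hW hη₀ h1
  refine ⟨hl, hl.1, fun (a : W.Ahat) (ξ ξ' : W.βh.carrier) => ⟨?_, ?_⟩⟩
  · refine hW.slice_mem (S := {T | ∃ η ξ, T = W.slice2 η ξ}) rfl _ _ ?_ a
    rintro ⟨_, _⟩ ⟨g, ζ, rfl⟩
    exact W.slice1_Dhat_slice2_mem g ζ ξ ξ'
  · obtain ⟨h, h', hη⟩ := hη₀
    refine ContinuousLinearMap.ext fun k => ?_
    have e1 := congrArg (fun A => A ((ξ' : K →L[ℂ] H) k)) (Dhat_comp_ket2_of_fix hW hη a)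
    change (η₀†) (((RT.ket1 W.βh W.α ξ)†) (W.Dhat a (RT.ket1 W.βh W.α ξ' (η₀ k)))) = _
    rw [RT.ket1_comp ξ' (⟨η₀, h'⟩ : W.α.carrier) k]
    refine (congrArg (fun y => (η₀†) (((RT.ket1 W.βh W.α ξ)†) y)) e1).trans ?_
    rw [ContinuousLinearMap.comp_apply, RT.bra1_ket2_apply]
    exact congrArg (fun A => A (((ξ : K →L[ℂ] H)†) ((a : H →L[ℂ] H) ((ξ' : K →L[ℂ] H) k)))) h1

theorem exists_isRightHaar_of_mem_fix [Nontrivial K] (hW : W.leg.IsHopf) (hη₀ : η₀ ∈ W.Fix)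
    (h1 : η₀† ∘L η₀ = 1) :
    ∃ ψ : W.leg.A → 𝔟.Bop, (∀ a, (ψ a : K →L[ℂ] K) = η₀† ∘L (a : H →L[ℂ] H) ∘L η₀) ∧
      W.leg.IsRightHaar ψ := by
  obtain ⟨h, h', hη⟩ := hη₀
  refine ⟨fun a => ⟨η₀† ∘L (a : H →L[ℂ] H) ∘L η₀,
    W.βh.gram_mem h ((W.isModMap_A a.2).1 η₀ h)⟩, fun a => rfl,
    isCPContraction_compression W.leg hW.isAlg h1, fun a b c => ⟨?_, ?_⟩,
    fun (a : W.A) (η η' : W.β.carrier) => ⟨?_, ?_⟩⟩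
  · exact rho_comp_rho_mem hW.isAlg.isCStarAlg _ hW.isAlg.rho₁ b c a.2
  · refine Subtype.ext (ContinuousLinearMap.ext fun k => ?_)
    change (η₀†) (W.α.rho b ((a : H →L[ℂ] H) (W.α.rho c (η₀ k)))) = _
    rw [W.α.adjoint_apply_rho b h', W.α.rho_apply c h']
    rfl
  · refine hW.slice_mem (S := {T | ∃ η ξ, T = W.slice1 η ξ}) rfl _ _ ?_ a
    rintro ⟨_, _⟩ ⟨ζ, ξ, rfl⟩
    exact W.slice2_D_slice1_mem ζ ξ η η'
  · refine ContinuousLinearMap.ext fun k => ?_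
    change (η₀†) (((RT.ket2 W.α W.β η)†) (W.op (RT.map (a : H →L[ℂ] H) (W.isModMap_A a.2) 1
      W.α.isModMap_one ((W.op†) (RT.ket2 W.α W.β η' (η₀ k)))))) = _
    rw [← RT.ket1_comp (⟨η₀, h'⟩ : W.α.carrier) η' k, adjoint_op_ket1_of_fix hη,
      RT.map_one_ket1', ← RT.adjoint_bra1 (⟨η₀, h'⟩ : W.α.carrier) η, bra1_op_of_fix hη,
      RT.bra1_ket1_apply]
    rfl

end Fix

/-! ### Cofixed elements -/

section Cofix

variable {W} {ξ₀ : K →L[ℂ] H}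

theorem adjoint_op_ket2_of_cofix {h : ξ₀ ∈ W.α.carrier} {h' : ξ₀ ∈ W.β.carrier}
    (hξ : W.op ∘L RT.ket2 W.βh W.α ⟨ξ₀, h⟩ = RT.ket2 W.α W.β ⟨ξ₀, h'⟩) (x : H) :
    (W.op†) (RT.ket2 W.α W.β ⟨ξ₀, h'⟩ x) = RT.ket2 W.βh W.α ⟨ξ₀, h⟩ x := by
  rw [← hξ, ContinuousLinearMap.comp_apply, W.adjoint_op_op]

theorem bra2_op_of_cofix {h : ξ₀ ∈ W.α.carrier} {h' : ξ₀ ∈ W.β.carrier}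
    (hξ : W.op ∘L RT.ket2 W.βh W.α ⟨ξ₀, h⟩ = RT.ket2 W.α W.β ⟨ξ₀, h'⟩) (t : W.Src) :
    ((RT.ket2 W.α W.β ⟨ξ₀, h'⟩)†) (W.op t) = ((RT.ket2 W.βh W.α ⟨ξ₀, h⟩)†) t := by
  refine ext_inner_left ℂ fun x => ?_
  simp only [ContinuousLinearMap.adjoint_inner_right]
  rw [← adjoint_op_ket2_of_cofix hξ, ContinuousLinearMap.adjoint_inner_left]

/-- On the range of a cofixed element, `⟨ζ|₁ V |ξ⟩₁` acts through `ζ* ξ`. -/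
theorem slice1_comp_of_mem_cofix (hξ₀ : ξ₀ ∈ W.Cofix) (ζ : W.α.carrier) (ξ : W.βh.carrier) :
    W.slice1 ζ ξ ∘L ξ₀ = ξ₀ ∘L ((ζ : K →L[ℂ] H)† ∘L (ξ : K →L[ℂ] H)) := by
  obtain ⟨h, h', hξ⟩ := hξ₀
  refine ContinuousLinearMap.ext fun k => ?_
  rw [ContinuousLinearMap.comp_apply, slice1_apply,
    RT.ket1_comp ξ (⟨ξ₀, h⟩ : W.α.carrier) k, ← ContinuousLinearMap.comp_apply W.op, hξ,
    RT.bra1_ket2_apply]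
  rfl

theorem invariant_of_mem_cofix (hξ₀ : ξ₀ ∈ W.Cofix) (h1 : ξ₀† ∘L ξ₀ = 1) :
    ∀ a ∈ W.A, ∃ y, a ∘L ξ₀ = ξ₀ ∘L y := fun a ha => by
  refine invariant_of_cspan h1 ?_ ha
  rintro _ ⟨ζ, ξ, rfl⟩
  exact ⟨_, slice1_comp_of_mem_cofix hξ₀ ζ ξ⟩

theorem counit_slice1 (hξ₀ : ξ₀ ∈ W.Cofix) (h1 : ξ₀† ∘L ξ₀ = 1) (ζ : W.α.carrier)
    (ξ : W.βh.carrier) :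
    ξ₀† ∘L W.slice1 ζ ξ ∘L ξ₀ = (ζ : K →L[ℂ] H)† ∘L (ξ : K →L[ℂ] H) := by
  rw [slice1_comp_of_mem_cofix hξ₀, ← ContinuousLinearMap.comp_assoc (ξ₀†) ξ₀, h1]
  rfl

theorem compression_A_of_mem_cofix (hA : IsCStarAlg W.A) (hξ₀ : ξ₀ ∈ W.Cofix)
    (h1 : ξ₀† ∘L ξ₀ = 1) :
    {T | ∃ a ∈ W.A, T = ξ₀† ∘L a ∘L ξ₀}
      = (opMul (opAdj (W.α.carrier : Set (K →L[ℂ] H))) (W.βh.carrier : Set (K →L[ℂ] H)) :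
        Set (K →L[ℂ] K)) := by
  rw [compression_eq_cspan hA h1 (invariant_of_mem_cofix hξ₀ h1)
    (S := {T | ∃ η ξ, T = W.slice1 η ξ}) rfl, opMul]
  congr 2
  ext T
  constructor
  · rintro ⟨_, ⟨η, ξ, rfl⟩, rfl⟩
    exact ⟨_, ⟨η, η.2, rfl⟩, ξ, ξ.2, counit_slice1 hξ₀ h1 η ξ⟩
  · rintro ⟨_, ⟨η, hη, rfl⟩, ξ, hξ, rfl⟩
    exact ⟨_, ⟨⟨η, hη⟩, ⟨ξ, hξ⟩, rfl⟩, (counit_slice1 hξ₀ h1 ⟨η, hη⟩ ⟨ξ, hξ⟩).symm⟩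

theorem compression_eq_of_mem_cofix {ξ₁ : K →L[ℂ] H} (hξ₀ : ξ₀ ∈ W.Cofix)
    (h1 : ξ₀† ∘L ξ₀ = 1) (hξ₁ : ξ₁ ∈ W.Cofix) (h1' : ξ₁† ∘L ξ₁ = 1) {a : H →L[ℂ] H}
    (ha : a ∈ W.A) : ξ₁† ∘L a ∘L ξ₁ = ξ₀† ∘L a ∘L ξ₀ := by
  refine compression_eqOn_cspan (S := {T | ∃ η ξ, T = W.slice1 η ξ}) ?_ ha
  rintro _ ⟨η, ξ, rfl⟩
  rw [counit_slice1 hξ₀ h1, counit_slice1 hξ₁ h1']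

theorem isRightCounit_of_mem_cofix (hW : W.leg.IsHopf) (hξ₀ : ξ₀ ∈ W.Cofix)
    (h1 : ξ₀† ∘L ξ₀ = 1) :
    W.leg.IsRightCounit (fun a => ξ₀† ∘L (a : H →L[ℂ] H) ∘L ξ₀) := by
  refine ⟨isUnitMor_compression W.leg hW.isAlg hξ₀.1 hξ₀.2.1 h1
    (invariant_of_mem_cofix hξ₀ h1), fun (a : W.A) (z z' : W.α.carrier) => ⟨?_, ?_⟩⟩
  · refine hW.slice_mem (S := {T | ∃ η ξ, T = W.slice1 η ξ}) rfl _ _ ?_ a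
    rintro ⟨_, _⟩ ⟨ζ, ξ, rfl⟩
    exact W.slice1_D_slice1_mem ζ ξ z z'
  · obtain ⟨h, h', hξ⟩ := hξ₀
    refine ContinuousLinearMap.ext fun k => ?_
    change (ξ₀†) (((RT.ket1 W.α W.β z)†) (W.op (RT.map (a : H →L[ℂ] H) (W.isModMap_A a.2) 1
      W.α.isModMap_one ((W.op†) (RT.ket1 W.α W.β z' (ξ₀ k)))))) = _
    -- Both outer slices become slices by `ξ₀` in the second leg, which `V` does not affect.
    rw [RT.ket1_comp z' (⟨ξ₀, h'⟩ : W.β.carrier) k, adjoint_op_ket2_of_cofix hξ,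
      RT.map_one_ket2, RT.adjoint_bra1 z (⟨ξ₀, h'⟩ : W.β.carrier), bra2_op_of_cofix hξ,
      RT.bra2_ket2_self (β := W.βh) (γ := W.α) (η := ⟨ξ₀, h⟩) h1]
    rfl

/-- `Δ_V(a) |ξ₀⟩₁ = |ξ₀⟩₁ a` for a cofixed element `ξ₀`. -/
theorem D_comp_ket1_of_cofix (hW : W.leg.IsHopf) {h : ξ₀ ∈ W.α.carrier} {h' : ξ₀ ∈ W.β.carrier}
    (hξ : W.op ∘L RT.ket2 W.βh W.α ⟨ξ₀, h⟩ = RT.ket2 W.α W.β ⟨ξ₀, h'⟩) (a : W.A) :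
    W.D a ∘L RT.ket1 W.α W.β ⟨ξ₀, h⟩ = RT.ket1 W.α W.β ⟨ξ₀, h⟩ ∘L (a : H →L[ℂ] H) := by
  refine hW.comp_eq (S := {T | ∃ η ξ, T = W.slice1 η ξ}) rfl (RT.ket1 W.α W.β ⟨ξ₀, h⟩) ?_ a
  rintro ⟨_, _⟩ ⟨ζ, ξ, rfl⟩
  obtain ⟨Θ, hΘ, hD⟩ := W.exists_D_slice ζ ⟨ξ₀, h⟩
  have e1 : Θ = RT.ket1 W.α W.β ⟨ξ₀, h⟩ ∘L (RT.ket1 W.α W.β ζ)† := by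
    refine RT.hom_ext_ket2 fun g y => ?_
    rw [hΘ, ← ContinuousLinearMap.comp_apply W.op, hξ, RT.bra1_ket2_apply,
      ContinuousLinearMap.comp_apply, RT.bra1_ket2_apply]
    exact (RT.ket1_comp (⟨ξ₀, h⟩ : W.α.carrier) g _).symm
  refine ContinuousLinearMap.ext fun x => ?_
  exact (hD ξ x).trans (congrArg (fun A => A (W.op (RT.ket1 W.βh W.α ξ x))) e1)

theorem isCounit_of_mem_cofix (hW : W.leg.IsHopf) (hξ₀ : ξ₀ ∈ W.Cofix) (h1 : ξ₀† ∘L ξ₀ = 1) :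
    W.leg.IsCounit (fun a => ξ₀† ∘L (a : H →L[ℂ] H) ∘L ξ₀) := by
  have hr := isRightCounit_of_mem_cofix hW hξ₀ h1
  refine ⟨⟨hr.1, fun (a : W.A) (g g' : W.β.carrier) => ⟨?_, ?_⟩⟩, hr⟩
  · refine hW.slice_mem (S := {T | ∃ η ξ, T = W.slice1 η ξ}) rfl _ _ ?_ a
    rintro ⟨_, _⟩ ⟨ζ, ξ, rfl⟩
    exact W.slice2_D_slice1_mem ζ ξ g g'
  · obtain ⟨h, h', hξ⟩ := hξ₀
    refine ContinuousLinearMap.ext fun k => ?_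
    have e1 := congrArg (fun A => A ((g' : K →L[ℂ] H) k)) (D_comp_ket1_of_cofix hW hξ a)
    change (ξ₀†) (((RT.ket2 W.α W.β g)†) (W.D a (RT.ket2 W.α W.β g' (ξ₀ k)))) = _
    rw [← RT.ket1_comp (⟨ξ₀, h⟩ : W.α.carrier) g' k]
    refine (congrArg (fun y => (ξ₀†) (((RT.ket2 W.α W.β g)†) y)) e1).trans ?_
    rw [ContinuousLinearMap.comp_apply, RT.bra2_ket1_apply]
    exact congrArg (fun A => A (((g : K →L[ℂ] H)†) ((a : H →L[ℂ] H) ((g' : K →L[ℂ] H) k)))) h1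

theorem exists_isLeftHaar_of_mem_cofix [Nontrivial K] (hW : W.hatLeg.IsHopf)
    (hξ₀ : ξ₀ ∈ W.Cofix) (h1 : ξ₀† ∘L ξ₀ = 1) :
    ∃ φ : W.hatLeg.A → 𝔟.Bop, (∀ a, (φ a : K →L[ℂ] K) = ξ₀† ∘L (a : H →L[ℂ] H) ∘L ξ₀) ∧
      W.hatLeg.IsLeftHaar φ := by
  obtain ⟨h, h', hξ⟩ := hξ₀
  refine ⟨fun a => ⟨ξ₀† ∘L (a : H →L[ℂ] H) ∘L ξ₀,
    W.β.gram_mem h' ((W.isModMap_Ahat a.2).1 ξ₀ h')⟩, fun a => rfl,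
    isCPContraction_compression W.hatLeg hW.isAlg h1, fun a b c => ⟨?_, ?_⟩,
    fun (a : W.Ahat) (ξ ξ' : W.βh.carrier) => ⟨?_, ?_⟩⟩
  · exact rho_comp_rho_mem hW.isAlg.isCStarAlg _ hW.isAlg.rho₂ b c a.2
  · refine Subtype.ext (ContinuousLinearMap.ext fun k => ?_)
    change (ξ₀†) (W.α.rho b ((a : H →L[ℂ] H) (W.α.rho c (ξ₀ k)))) = _
    rw [W.α.adjoint_apply_rho b h, W.α.rho_apply c h]
    rfl
  · refine hW.slice_mem (S := {T | ∃ η ξ, T = W.slice2 η ξ}) rfl _ _ ?_ a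
    rintro ⟨_, _⟩ ⟨η, ζ, rfl⟩
    exact W.slice1_Dhat_slice2_mem η ζ ξ ξ'
  · refine ContinuousLinearMap.ext fun k => ?_
    change (ξ₀†) (((RT.ket1 W.βh W.α ξ)†) ((W.op†) (RT.map 1 W.α.isModMap_one
      (a : H →L[ℂ] H) (W.isModMap_Ahat a.2) (W.op (RT.ket1 W.βh W.α ξ' (ξ₀ k)))))) = _
    rw [RT.ket1_comp ξ' (⟨ξ₀, h⟩ : W.α.carrier) k, ← ContinuousLinearMap.comp_apply W.op, hξ,
      RT.map_one_ket2', RT.adjoint_bra1 ξ (⟨ξ₀, h⟩ : W.α.carrier), ← bra2_op_of_cofix hξ,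
      W.op_adjoint_op, RT.bra2_ket2_apply]
    rfl

end Cofix

end CPMU

theorem FaithfulKMSState.nontrivial_GNS {B : Type*} [CStarAlgebra B] [PartialOrder B]
    [StarOrderedRing B] (μ : FaithfulKMSState B) : Nontrivial μ.GNS := by
  refine ⟨μ.Λ 1, 0, fun h => ?_⟩
  have h2 : ⟪μ.Λ 1, μ.Λ 1⟫_ℂ = μ.state (star 1 * 1) := by
    rw [Λ, UniformSpace.Completion.inner_coe, PositiveLinearMap.preGNS_inner_def]
    rfl
  rw [h, inner_zero_left, star_one, one_mul, μ.state_one] at h2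
  exact zero_ne_one h2

end CQG

theorem mainTheorem10 {B : Type*} [CStarAlgebra B] [PartialOrder B] [StarOrderedRing B]
    (μ : CQG.FaithfulKMSState B)
    {H : Type*} [NormedAddCommGroup H] [InnerProductSpace ℂ H] [CompleteSpace H]
    (V : CQG.CPMU μ.base H) (hV : V.WellBehaved) :
    (V.Etale → ∀ η₀ ∈ V.Fix, η₀† ∘L η₀ = 1 →
      V.hatLeg.IsLeftCounit (fun a => η₀† ∘L (a : H →L[ℂ] H) ∘L η₀) ∧
      (∀ (η : V.β.carrier) (ξ : V.α.carrier),
        η₀† ∘L V.slice2 η ξ ∘L η₀ = (η : μ.GNS →L[ℂ] H)† ∘L (ξ : μ.GNS →L[ℂ] H)) ∧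
      (∀ η₁ ∈ V.Fix, η₁† ∘L η₁ = 1 → ∀ a ∈ V.Ahat, η₁† ∘L a ∘L η₁ = η₀† ∘L a ∘L η₀) ∧
      {T | ∃ a ∈ V.Ahat, T = η₀† ∘L a ∘L η₀}
        = (CQG.opMul (CQG.opAdj (V.β.carrier : Set (μ.GNS →L[ℂ] H)))
            (V.α.carrier : Set (μ.GNS →L[ℂ] H)) : Set (μ.GNS →L[ℂ] μ.GNS)) ∧
      CQG.IsCStarAlg (CQG.opMul (CQG.opAdj (V.β.carrier : Set (μ.GNS →L[ℂ] H)))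
            (V.α.carrier : Set (μ.GNS →L[ℂ] H)) :
        Submodule ℂ (μ.GNS →L[ℂ] μ.GNS)) ∧
      (V.Regular → V.hatLeg.IsCounit (fun a => η₀† ∘L (a : H →L[ℂ] H) ∘L η₀)) ∧
      ∃ ψ : V.leg.A → μ.base.Bop,
        (∀ a, (ψ a : μ.GNS →L[ℂ] μ.GNS) = η₀† ∘L (a : H →L[ℂ] H) ∘L η₀) ∧
        V.leg.IsRightHaar ψ) ∧
    (V.Compact → ∀ ξ₀ ∈ V.Cofix, ξ₀† ∘L ξ₀ = 1 →
      V.leg.IsRightCounit (fun a => ξ₀† ∘L (a : H →L[ℂ] H) ∘L ξ₀) ∧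
      (∀ (η : V.α.carrier) (ξ : V.βh.carrier),
        ξ₀† ∘L V.slice1 η ξ ∘L ξ₀ = (η : μ.GNS →L[ℂ] H)† ∘L (ξ : μ.GNS →L[ℂ] H)) ∧
      (∀ ξ₁ ∈ V.Cofix, ξ₁† ∘L ξ₁ = 1 → ∀ a ∈ V.A, ξ₁† ∘L a ∘L ξ₁ = ξ₀† ∘L a ∘L ξ₀) ∧
      {T | ∃ a ∈ V.A, T = ξ₀† ∘L a ∘L ξ₀}
        = (CQG.opMul (CQG.opAdj (V.α.carrier : Set (μ.GNS →L[ℂ] H)))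
            (V.βh.carrier : Set (μ.GNS →L[ℂ] H)) : Set (μ.GNS →L[ℂ] μ.GNS)) ∧
      CQG.IsCStarAlg (CQG.opMul (CQG.opAdj (V.α.carrier : Set (μ.GNS →L[ℂ] H)))
            (V.βh.carrier : Set (μ.GNS →L[ℂ] H)) :
        Submodule ℂ (μ.GNS →L[ℂ] μ.GNS)) ∧
      (V.Regular → V.leg.IsCounit (fun a => ξ₀† ∘L (a : H →L[ℂ] H) ∘L ξ₀)) ∧
      ∃ φ : V.hatLeg.A → μ.base.Bop,
        (∀ a, (φ a : μ.GNS →L[ℂ] μ.GNS) = ξ₀† ∘L (a : H →L[ℂ] H) ∘L ξ₀) ∧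
        V.hatLeg.IsLeftHaar φ) := by
  have := μ.nontrivial_GNS
  refine ⟨fun _ η₀ hη₀ h1 => ?_, fun _ ξ₀ hξ₀ h1 => ?_⟩
  · have hA : CQG.IsCStarAlg V.Ahat := hV.1.isAlg.isCStarAlg
    have himg := CQG.CPMU.compression_Ahat_of_mem_fix hA hη₀ h1
    exact ⟨CQG.CPMU.isLeftCounit_of_mem_fix hV.1 hη₀ h1, CQG.CPMU.counit_slice2 hη₀ h1,
      fun η₁ hη₁ h1' a ha => CQG.CPMU.compression_eq_of_mem_fix hη₀ h1 hη₁ h1' ha, himg,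
      CQG.isCStarAlg_compression hA h1 (CQG.CPMU.invariant_of_mem_fix hη₀ h1) himg,
      fun _ => CQG.CPMU.isCounit_of_mem_fix hV.1 hη₀ h1,
      CQG.CPMU.exists_isRightHaar_of_mem_fix hV.2 hη₀ h1⟩
  · have hA : CQG.IsCStarAlg V.A := hV.2.isAlg.isCStarAlg
    have himg := CQG.CPMU.compression_A_of_mem_cofix hA hξ₀ h1
    exact ⟨CQG.CPMU.isRightCounit_of_mem_cofix hV.2 hξ₀ h1, CQG.CPMU.counit_slice1 hξ₀ h1,
      fun ξ₁ hξ₁ h1' a ha => CQG.CPMU.compression_eq_of_mem_cofix hξ₀ h1 hξ₁ h1' ha, himg,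
      CQG.isCStarAlg_compression hA h1 (CQG.CPMU.invariant_of_mem_cofix hξ₀ h1) himg,
      fun _ => CQG.CPMU.isCounit_of_mem_cofix hV.2 hξ₀ h1,
      CQG.CPMU.exists_isLeftHaar_of_mem_cofix hV.1 hξ₀ h1⟩
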